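/- Let $\pi:A\to M$ be a smooth affine bundle of rank $n$ over a smooth (Hausdorff, second countable, finite-dimensional) manifold $M$: a locally trivial smooth bundle whose fibres $A_p$ are affine spaces of dimension $n$ and whose local trivializations are affine isomorphisms on the fibres. Let $A^+\to M$ be the smooth vector bundle of rank $n+1$ with fibres $A^+_p=\mathrm{Aff}(A_p,\mathbb R)$. A function $a\in C^\infty(A)$ is called affine if it is affine on every fibre; $\tilde a\in\Gamma(A^+)$, $\tilde a(p)=a|_{A_p}$, denotes the associated section. An affine Jacobi structure on $A$ is a pair $(\Lambda,E)$ of a bivector field and a vector field on the manifold $A$ with $[\Lambda,\Lambda]=-2E\wedge\Lambda$ and $[E,\Lambda]=0$ (Schouten bracket, with the sign convention for which $[X\wedge Y,X\wedge Y]=2[X,Y]\wedge X\wedge Y$), whose Jacobi bracket $\{f,g\}=\Lambda(df,dg)+fE(g)-gE(f)$ maps pairs of affine functions to affine functions. We say that $(\Lambda,E)$ corresponds to a Lie bracket $[\![\cdot,\cdot]\!]$ on $\Gamma(A^+)$ if $$\widetilde{\{a,b\}}=[\![\tilde a,\tilde b]\!]\qquad\text{for all affine functions } a,b \text{ on } A.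 \qquad (*)$$ 1. Let $n>0$. Then $(*)$ is a one-to-one correspondence between affine Jacobi structures on $A$ and Lie algebroid structures $([\![\cdot,\cdot]\!],\rho)$ on $A^+$: every affine Jacobi structure corresponds to exactly one Lie algebroid structure, and every Lie algebroid structure to exactly one affine Jacobi structure. Here a Lie algebroid structure is a real Lie algebra bracket on $\Gamma(A^+)$ together with a smooth vector bundle morphism $\rho:A^+\to TM$ such that $[\![X,fY]\!]=f[\![X,Y]\!]+\rho(X)(f)\,Y$ for all $X,Y\in\Gamma(A^+)$, $f\in C^\infty(M)$. 2. Let $n=0$. Then $A^+=M\times\mathbb R$, that is, every section of $A^+$ is given by a unique function in $C^\infty(M)$, and $(*)$ is a one-to-one correspondence (in the same sense) between affine Jacobi structures on $A$ and local Lie algebra structures on $A^+$, i.e. real Lie algebra brackets on $\Gamma(A^+)$ with $\operatorname{supp}[\![s,t]\!]\subseteq\operatorname{supp}s\cap\operatorname{supp}t$. Likewise, $(*)$ is a one-to-one correspondence between affine Jacobi structures on $A$ and Lie QD-algebroid structures on $A^+$, i.e. real Lie algebra brackets on $\Gamma(A^+)$ together with an $\mathbb R$-linear map $X\mapsto\hat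 X$ from $\Gamma(A^+)$ to the vector fields on $M$ such that $[\![X,fY]\!]=f[\![X,Y]\!]+\hat X(f)\,Y$. -/

import Mathlib

open Set Bundle Manifold
open scoped Manifold ContDiff Bundle

noncomputable section

/-! ### Affine bundles -/

/-- A locally trivial bundle `A → M` with fibre `F` is smooth if its transition maps
`e' ∘ e⁻¹ : (U ∩ U') × F → F` are smooth. -/
class SmoothFiberBundle {E : Type*} [NormedAddCommGroup E] [NormedSpace ℝ E]
    {H : Type*} [TopologicalSpace H] (I : ModelWithCorners ℝ E H)
    {M : Type*} [TopologicalSpace M] [ChartedSpace H M]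
    (F : Type*) [NormedAddCommGroup F] [NormedSpace ℝ F]
    (A : M → Type*) [TopologicalSpace (TotalSpace F A)] [∀ p, TopologicalSpace (A p)]
    [FiberBundle F A] : Prop where
  smooth_transition : ∀ (e e' : Trivialization F (π F A)) [MemTrivializationAtlas e]
    [MemTrivializationAtlas e'],
    ContMDiffOn (I.prod 𝓘(ℝ, F)) 𝓘(ℝ, F) ∞
      (fun q : M × F => (e' (e.toOpenPartialHomeomorph.symm q)).2)
      ((e.baseSet ∩ e'.baseSet) ×ˢ (univ : Set F))

/-- A bundle `A → M` whose fibre `A p` is an affine space modelled on a vector space `V p` is an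
affine bundle if all its local trivializations are affine isomorphisms on the fibres
(consequently the transition maps are affine in the fibre, and their linear parts turn `V` into
a vector bundle). -/
class IsAffineBundle {M : Type*} [TopologicalSpace M]
    (F : Type*) [NormedAddCommGroup F] [NormedSpace ℝ F]
    (V A : M → Type*) [∀ p, AddCommGroup (V p)] [∀ p, Module ℝ (V p)]
    [∀ p, AddTorsor (V p) (A p)]
    [TopologicalSpace (TotalSpace F A)] [∀ p, TopologicalSpace (A p)]
    [FiberBundle F A] : Prop where
  exists_affineEquiv : ∀ (e : Trivialization F (π F A)) [MemTrivializationAtlas e],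
    ∀ p ∈ e.baseSet, ∃ φ : A p ≃ᵃ[ℝ] F, ∀ x : A p, φ x = (e ⟨p, x⟩).2

section TotalSpace

variable {E : Type*} [NormedAddCommGroup E] [NormedSpace ℝ E]
  {H : Type*} [TopologicalSpace H] {I : ModelWithCorners ℝ E H}
  {M : Type*} [TopologicalSpace M] [ChartedSpace H M]
  {F : Type*} [NormedAddCommGroup F] [NormedSpace ℝ F]
  {A : M → Type*} [TopologicalSpace (TotalSpace F A)] [∀ p, TopologicalSpace (A p)]
  [FiberBundle F A] [SmoothFiberBundle I F A]

theorem SmoothFiberBundle.contMDiffOn_symm_trans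
    (e e' : Trivialization F (π F A)) [MemTrivializationAtlas e] [MemTrivializationAtlas e'] :
    ContMDiffOn (I.prod 𝓘(ℝ, F)) (I.prod 𝓘(ℝ, F)) ∞
      (e.toOpenPartialHomeomorph.symm ≫ₕ e'.toOpenPartialHomeomorph)
      ((e.baseSet ∩ e'.baseSet) ×ˢ (univ : Set F)) := by
  refine (contMDiffOn_fst.prodMk (SmoothFiberBundle.smooth_transition (I := I) e e')).congr ?_
  rintro ⟨b, x⟩ hb
  have hb1 : b ∈ e.baseSet := hb.1.1
  have hb2 : b ∈ e'.baseSet := hb.1.2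
  have h1 : (e.toOpenPartialHomeomorph.symm (b, x)).1 = b := e.proj_symm_apply' hb1
  refine Prod.ext ?_ rfl
  have : (e.toOpenPartialHomeomorph.symm (b, x)).1 ∈ e'.baseSet := by rw [h1]; exact hb2
  exact (e'.coe_fst' this).trans h1

/-- The groupoid of smooth local diffeomorphisms of a product `M × F`. -/
def smoothProdGroupoid {E : Type*} [NormedAddCommGroup E] [NormedSpace ℝ E]
    {H : Type*} [TopologicalSpace H] (I : ModelWithCorners ℝ E H)
    (M : Type*) [TopologicalSpace M] [ChartedSpace H M]
    (F : Type*) [NormedAddCommGroup F] [NormedSpace ℝ F] : StructureGroupoid (M × F) :=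
  Pregroupoid.groupoid
    { property := fun f s => ContMDiffOn (I.prod 𝓘(ℝ, F)) (I.prod 𝓘(ℝ, F)) ∞ f s
      comp := fun hf hg _ _ _ => hg.comp' hf
      id_mem := contMDiffOn_id
      locality := fun _ h => contMDiffOn_of_locally_contMDiffOn h
      congr := fun _ h hf => hf.congr h }

variable [IsManifold I ∞ M]

/-- The total space of a smooth fibre bundle is a smooth manifold. -/
instance SmoothFiberBundle.isManifold : IsManifold (I.prod 𝓘(ℝ, F)) ∞ (TotalSpace F A) := by
  have : HasGroupoid (TotalSpace F A) (smoothProdGroupoid I M F) := by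
    refine ⟨?_⟩
    rintro _ _ ⟨e, he, rfl⟩ ⟨e', he', rfl⟩
    have : MemTrivializationAtlas e := ⟨he⟩
    have : MemTrivializationAtlas e' := ⟨he'⟩
    refine mem_groupoid_of_pregroupoid.2 ⟨?_, ?_⟩
    · refine (SmoothFiberBundle.contMDiffOn_symm_trans (I := I) e e').mono ?_
      exact (e.symm_trans_source_eq e').subset
    · have h := SmoothFiberBundle.contMDiffOn_symm_trans (I := I) e' e
      refine h.mono ?_
      rw [inter_comm]
      exact (e.symm_trans_target_eq e').subset
  refine { StructureGroupoid.HasGroupoid.comp (smoothProdGroupoid I M F) ?_ with }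
  intro e he
  rw [isLocalStructomorphOn_contDiffGroupoid_iff]
  exact mem_groupoid_of_pregroupoid.1 he

end TotalSpace

/-! ### The vector bundle of fibrewise affine functions -/

/-- Relative to an affine frame `φ : P ≃ F`, an affine function on `P` is the same as a pair
consisting of a linear part and the value at the origin. -/
def affineFunctionEquiv {W P F : Type*} [AddCommGroup W] [Module ℝ W] [AddTorsor W P]
    [NormedAddCommGroup F] [NormedSpace ℝ F] [FiniteDimensional ℝ F] (φ : P ≃ᵃ[ℝ] F) :
    (P →ᵃ[ℝ] ℝ) ≃ₗ[ℝ] (F →L[ℝ] ℝ) × ℝ where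
  toFun a := (LinearMap.toContinuousLinearMap (a.comp φ.symm.toAffineMap).linear, a (φ.symm 0))
  invFun v := ((v.1 : F →ₗ[ℝ] ℝ).toAffineMap + AffineMap.const ℝ F v.2).comp φ.toAffineMap
  map_add' a b := by
    refine Prod.ext ?_ rfl
    ext v; simp
  map_smul' c a := by
    refine Prod.ext ?_ rfl
    ext v; simp
  left_inv a := by
    ext x
    have h := congrFun (a.comp φ.symm.toAffineMap).decomp (φ x)
    simpa using h.symm
  right_inv v := by
    refine Prod.ext ?_ ?_
    · ext w; simp
    · simp

section AffineFunctionEquiv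

variable {W P F : Type*} [AddCommGroup W] [Module ℝ W] [AddTorsor W P]
  [NormedAddCommGroup F] [NormedSpace ℝ F] [FiniteDimensional ℝ F] (φ : P ≃ᵃ[ℝ] F)

theorem affineFunctionEquiv_symm_apply (v : (F →L[ℝ] ℝ) × ℝ) (x : P) :
    (affineFunctionEquiv φ).symm v x = v.1 (φ x) + v.2 := rfl

theorem affineFunctionEquiv_fst_apply (a : P →ᵃ[ℝ] ℝ) (w : F) :
    (affineFunctionEquiv φ a).1 w = a (φ.symm w) - a (φ.symm 0) :=
  congrFun (a.comp φ.symm.toAffineMap).decomp' w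

theorem affineFunctionEquiv_snd (a : P →ᵃ[ℝ] ℝ) :
    (affineFunctionEquiv φ a).2 = a (φ.symm 0) := rfl

end AffineFunctionEquiv

/-- A map into a space of continuous linear maps with finite-dimensional source is smooth if it is
pointwise smooth. -/
theorem contMDiffOn_of_clm_apply {E : Type*} [NormedAddCommGroup E] [NormedSpace ℝ E]
    {H : Type*} [TopologicalSpace H] {I : ModelWithCorners ℝ E H}
    {M : Type*} [TopologicalSpace M] [ChartedSpace H M]
    {F G : Type*} [NormedAddCommGroup F] [NormedSpace ℝ F] [FiniteDimensional ℝ F]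
    [NormedAddCommGroup G] [NormedSpace ℝ G] {f : M → F →L[ℝ] G} {s : Set M}
    (h : ∀ y, ContMDiffOn I 𝓘(ℝ, G) ∞ (fun x => f x y) s) :
    ContMDiffOn I 𝓘(ℝ, F →L[ℝ] G) ∞ f s := by
  let d := Module.finrank ℝ F
  have hd : d = Module.finrank ℝ (Fin d → ℝ) := (Module.finrank_fin_fun ℝ).symm
  let e₁ := ContinuousLinearEquiv.ofFinrankEq hd
  let e₂ := (e₁.arrowCongr (1 : G ≃L[ℝ] G)).trans (ContinuousLinearEquiv.piRing (Fin d))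
  have h2 : ContMDiffOn I 𝓘(ℝ, Fin d → G) ∞ (fun x => e₂ (f x)) s := by
    rw [contMDiffOn_pi_space]
    intro i
    exact h _
  have h3 := (e₂.symm.contDiff (n := ∞)).contMDiff.comp_contMDiffOn h2
  refine h3.congr ?_
  intro x _
  simp

section AffineDual

variable {E : Type*} [NormedAddCommGroup E] [NormedSpace ℝ E]
  {H : Type*} [TopologicalSpace H] (I : ModelWithCorners ℝ E H)
  {M : Type*} [TopologicalSpace M] [ChartedSpace H M]
  (F : Type*) [NormedAddCommGroup F] [NormedSpace ℝ F]
  (V A : M → Type*) [∀ p, AddCommGroup (V p)] [∀ p, Module ℝ (V p)] [∀ p, AddTorsor (V p) (A p)]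
  [TopologicalSpace (TotalSpace F A)] [∀ p, TopologicalSpace (A p)]
  [FiberBundle F A] [IsAffineBundle F V A]

/-- The fibre over `p` of the dual bundle `A⁺`: affine functions on the fibre `A p`. -/
@[nolint unusedArguments]
def AffineDual (_F : Type*) {M : Type*} (V A : M → Type*) [∀ p, AddCommGroup (V p)]
    [∀ p, Module ℝ (V p)] [∀ p, AddTorsor (V p) (A p)] (p : M) : Type _ :=
  A p →ᵃ[ℝ] ℝ

instance (p : M) : AddCommGroup (AffineDual F V A p) :=
  inferInstanceAs (AddCommGroup (A p →ᵃ[ℝ] ℝ))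

instance (p : M) : Module ℝ (AffineDual F V A p) :=
  inferInstanceAs (Module ℝ (A p →ᵃ[ℝ] ℝ))

instance (p : M) : FunLike (AffineDual F V A p) (A p) ℝ :=
  inferInstanceAs (FunLike (A p →ᵃ[ℝ] ℝ) (A p) ℝ)

/-- The model fibre of `A⁺`. -/
abbrev AffineDualModel (F : Type*) [NormedAddCommGroup F] [NormedSpace ℝ F] : Type _ :=
  (F →L[ℝ] ℝ) × ℝ

variable {F A}

open Classical in
/-- The affine isomorphism `A p ≃ F` given by a local trivialization (for `p` outside the domain
of the trivialization, the preferred trivialization at `p` is used instead). -/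
def fiberAffineEquiv (e : Trivialization F (π F A)) [MemTrivializationAtlas e] (p : M) :
    A p ≃ᵃ[ℝ] F :=
  if h : p ∈ e.baseSet then (IsAffineBundle.exists_affineEquiv (V := V) e p h).choose
  else (IsAffineBundle.exists_affineEquiv (V := V) (trivializationAt F A p) p
    (mem_baseSet_trivializationAt F A p)).choose

variable (e e' : Trivialization F (π F A)) [MemTrivializationAtlas e] [MemTrivializationAtlas e']

theorem fiberAffineEquiv_apply {p : M} (h : p ∈ e.baseSet) (x : A p) :
    fiberAffineEquiv V e p x = (e ⟨p, x⟩).2 := by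
  unfold fiberAffineEquiv
  rw [dif_pos h]
  exact (IsAffineBundle.exists_affineEquiv (V := V) e p h).choose_spec x

theorem mk_fiberAffineEquiv_symm {p : M} (h : p ∈ e.baseSet) (w : F) :
    (⟨p, (fiberAffineEquiv V e p).symm w⟩ : TotalSpace F A)
      = e.toOpenPartialHomeomorph.symm (p, w) := by
  have h1 : (⟨p, (fiberAffineEquiv V e p).symm w⟩ : TotalSpace F A) ∈ e.source :=
    e.mem_source.2 h
  have h2 : e ⟨p, (fiberAffineEquiv V e p).symm w⟩ = (p, w) := by
    refine Prod.ext (e.coe_fst h1) ?_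
    rw [← fiberAffineEquiv_apply V e h]
    simp
  rw [← h2]
  exact (e.toOpenPartialHomeomorph.left_inv h1).symm

variable [FiniteDimensional ℝ F]

/-- The local trivialization of `A⁺` induced by a local trivialization of `A`. -/
def affineDualPretrivialization :
    Pretrivialization (AffineDualModel F) (π (AffineDualModel F) (AffineDual F V A)) where
  toFun v := (v.1, affineFunctionEquiv (fiberAffineEquiv V e v.1) v.2)
  invFun q := ⟨q.1, (affineFunctionEquiv (fiberAffineEquiv V e q.1)).symm q.2⟩
  source := TotalSpace.proj ⁻¹' e.baseSet
  target := e.baseSet ×ˢ univ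
  map_source' _ h := ⟨h, mem_univ _⟩
  map_target' _ h := h.1
  left_inv' v _ := by
    refine TotalSpace.ext rfl (heq_of_eq ?_)
    exact (affineFunctionEquiv (fiberAffineEquiv V e v.1)).symm_apply_apply v.2
  right_inv' q _ := by
    refine Prod.ext rfl ?_
    exact (affineFunctionEquiv (fiberAffineEquiv V e q.1)).apply_symm_apply q.2
  open_target := e.open_baseSet.prod isOpen_univ
  baseSet := e.baseSet
  open_baseSet := e.open_baseSet
  source_eq := rfl
  target_eq := rfl
  proj_toFun _ _ := rfl

instance : (affineDualPretrivialization V e).IsLinear ℝ where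
  linear p _ := (affineFunctionEquiv (fiberAffineEquiv V e p)).toLinearMap.isLinear

/-- The change of frame of `A⁺` from `e` to `e'`. -/
def affineDualCoordChange (p : M) : AffineDualModel F →L[ℝ] AffineDualModel F :=
  LinearMap.toContinuousLinearMap
    (((affineFunctionEquiv (fiberAffineEquiv V e p)).symm.trans
      (affineFunctionEquiv (fiberAffineEquiv V e' p))).toLinearMap)

theorem affineDualCoordChange_apply (p : M) (v : AffineDualModel F) :
    affineDualCoordChange V e e' p v = affineFunctionEquiv (fiberAffineEquiv V e' p)
      ((affineFunctionEquiv (fiberAffineEquiv V e p)).symm v) := rfl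

/-- Change of frames in coordinates, through the transition map of `A`. -/
theorem affineDualCoordChange_eq {p : M} (h : p ∈ e.baseSet ∩ e'.baseSet)
    (v : AffineDualModel F) :
    (affineDualCoordChange V e e' p v).2
        = v.1 (e (e'.toOpenPartialHomeomorph.symm (p, 0))).2 + v.2 ∧
    ∀ w, (affineDualCoordChange V e e' p v).1 w
        = v.1 (e (e'.toOpenPartialHomeomorph.symm (p, w))).2
          - v.1 (e (e'.toOpenPartialHomeomorph.symm (p, 0))).2 := by
  have key : ∀ w, fiberAffineEquiv V e p ((fiberAffineEquiv V e' p).symm w)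
      = (e (e'.toOpenPartialHomeomorph.symm (p, w))).2 := by
    intro w
    rw [fiberAffineEquiv_apply V e h.1, mk_fiberAffineEquiv_symm V e' h.2]
  refine ⟨?_, fun w => ?_⟩
  · rw [affineDualCoordChange_apply, affineFunctionEquiv_snd, affineFunctionEquiv_symm_apply, key]
  · rw [affineDualCoordChange_apply, affineFunctionEquiv_fst_apply,
      affineFunctionEquiv_symm_apply, affineFunctionEquiv_symm_apply, key, key]
    ring

theorem continuousOn_affineDualCoordChange :
    ContinuousOn (affineDualCoordChange V e e') (e.baseSet ∩ e'.baseSet) := by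
  have ht : ∀ w : F, ContinuousOn
      (fun p => (e (e'.toOpenPartialHomeomorph.symm (p, w))).2) (e.baseSet ∩ e'.baseSet) := by
    intro w
    refine continuous_snd.comp_continuousOn ?_
    refine e.continuousOn.comp ?_ ?_ (t := e.source)
    · refine e'.toOpenPartialHomeomorph.continuousOn_symm.comp
        (continuous_id.prodMk continuous_const).continuousOn ?_
      intro p hp
      exact e'.mem_target.2 hp.2
    · intro p hp
      rw [e.mem_source]
      have h1 : (e'.toOpenPartialHomeomorph.symm (p, w)).1 = p := e'.proj_symm_apply' hp.2
      show (e'.toOpenPartialHomeomorph.symm (p, w)).1 ∈ e.baseSet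
      rw [h1]; exact hp.1
  rw [continuousOn_clm_apply]
  intro v
  refine ContinuousOn.prodMk (f := fun p => (affineDualCoordChange V e e' p v).1)
    (g := fun p => (affineDualCoordChange V e e' p v).2) ?_ ?_
  · rw [continuousOn_clm_apply]
    intro w
    refine ((v.1.continuous.comp_continuousOn (ht w)).sub
      (v.1.continuous.comp_continuousOn (ht 0))).congr ?_
    intro p hp
    exact (affineDualCoordChange_eq V e e' hp v).2 w
  · refine ((v.1.continuous.comp_continuousOn (ht 0)).add
      (continuousOn_const (c := v.2))).congr ?_
    intro p hp
    exact (affineDualCoordChange_eq V e e' hp v).1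

theorem contMDiffOn_affineDualCoordChange [SmoothFiberBundle I F A] :
    ContMDiffOn I 𝓘(ℝ, AffineDualModel F →L[ℝ] AffineDualModel F) ∞
      (affineDualCoordChange V e e') (e.baseSet ∩ e'.baseSet) := by
  have ht : ∀ w : F, ContMDiffOn I 𝓘(ℝ, F) ∞
      (fun p => (e (e'.toOpenPartialHomeomorph.symm (p, w))).2) (e.baseSet ∩ e'.baseSet) := by
    intro w
    refine (SmoothFiberBundle.smooth_transition (I := I) e' e).comp
      (f := fun p => (p, w)) ?_ ?_
    · exact contMDiffOn_id.prodMk contMDiffOn_const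
    · intro p hp
      exact ⟨⟨hp.2, hp.1⟩, mem_univ _⟩
  have hv : ∀ (l : F →L[ℝ] ℝ) (w : F), ContMDiffOn I 𝓘(ℝ, ℝ) ∞
      (fun p => l (e (e'.toOpenPartialHomeomorph.symm (p, w))).2) (e.baseSet ∩ e'.baseSet) :=
    fun l w => l.contMDiff.comp_contMDiffOn (ht w)
  refine contMDiffOn_of_clm_apply fun v => ?_
  refine ContMDiffOn.prodMk_space (f := fun p => (affineDualCoordChange V e e' p v).1)
    (g := fun p => (affineDualCoordChange V e e' p v).2) ?_ ?_
  · refine contMDiffOn_of_clm_apply fun w => ?_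
    refine ((hv v.1 w).sub (hv v.1 0)).congr ?_
    intro p hp
    exact (affineDualCoordChange_eq V e e' hp v).2 w
  · refine ((hv v.1 0).add (contMDiffOn_const (c := v.2))).congr ?_
    intro p hp
    exact (affineDualCoordChange_eq V e e' hp v).1

theorem affineDualCoordChange_eq_pretrivialization {p : M}
    (hp : p ∈ e.baseSet ∩ e'.baseSet) (v : AffineDualModel F) :
    affineDualCoordChange V e e' p v = (affineDualPretrivialization V e'
      ⟨p, (affineDualPretrivialization V e).symm p v⟩).2 := by
  rw [Pretrivialization.symm_apply _ hp.1]
  rfl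

variable (F A)

/-- The vector space topology of the fibres of `A⁺`. -/
instance (p : M) : TopologicalSpace (AffineDual F V A p) :=
  TopologicalSpace.induced
    (affineFunctionEquiv (fiberAffineEquiv V (trivializationAt F A p) p)) inferInstance

/-- The local trivializations of `A⁺` induced by those of `A`. -/
def affineDualPrebundle : VectorPrebundle ℝ (AffineDualModel F) (AffineDual F V A) where
  pretrivializationAtlas :=
    {ε | ∃ (e : Trivialization F (π F A)) (_ : MemTrivializationAtlas e),
      ε = affineDualPretrivialization V e}
  pretrivialization_linear' := by
    rintro _ ⟨e, he, rfl⟩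
    infer_instance
  pretrivializationAt p := affineDualPretrivialization V (trivializationAt F A p)
  mem_base_pretrivializationAt p := mem_baseSet_trivializationAt F A p
  pretrivialization_mem_atlas p := ⟨trivializationAt F A p, inferInstance, rfl⟩
  exists_coordChange := by
    rintro _ ⟨e, he, rfl⟩ _ ⟨e', he', rfl⟩
    exact ⟨affineDualCoordChange V e e', continuousOn_affineDualCoordChange V e e',
      fun p hp v => affineDualCoordChange_eq_pretrivialization V e e' hp v⟩
  totalSpaceMk_isInducing p := by
    have h : Topology.IsInducing (fun a : AffineDual F V A p =>
        affineFunctionEquiv (fiberAffineEquiv V (trivializationAt F A p) p) a) := ⟨rfl⟩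
    exact Topology.isInducing_const_prod.mpr h

instance : TopologicalSpace (TotalSpace (AffineDualModel F) (AffineDual F V A)) :=
  (affineDualPrebundle F V A).totalSpaceTopology

/-- `A⁺` is a fibre bundle. -/
instance : FiberBundle (AffineDualModel F) (AffineDual F V A) :=
  (affineDualPrebundle F V A).toFiberBundle

/-- `A⁺` is a vector bundle. -/
instance : VectorBundle ℝ (AffineDualModel F) (AffineDual F V A) :=
  (affineDualPrebundle F V A).toVectorBundle

instance [SmoothFiberBundle I F A] : (affineDualPrebundle F V A).IsContMDiff I ∞ where
  exists_contMDiffCoordChange := by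
    rintro _ ⟨e, he, rfl⟩ _ ⟨e', he', rfl⟩
    exact ⟨affineDualCoordChange V e e', contMDiffOn_affineDualCoordChange I V e e',
      fun p hp v => affineDualCoordChange_eq_pretrivialization V e e' hp v⟩

/-- `A⁺` is a smooth vector bundle. -/
instance [SmoothFiberBundle I F A] :
    ContMDiffVectorBundle ∞ (AffineDualModel F) (AffineDual F V A) I :=
  (affineDualPrebundle F V A).contMDiffVectorBundle I

end AffineDual

/-! ### Affine functions and sections of `A⁺` -/

section AffineFunctions

variable {E : Type*} [NormedAddCommGroup E] [NormedSpace ℝ E]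
  {H : Type*} [TopologicalSpace H] (I : ModelWithCorners ℝ E H)
  {M : Type*} [TopologicalSpace M] [ChartedSpace H M]
  (F : Type*) [NormedAddCommGroup F] [NormedSpace ℝ F] [FiniteDimensional ℝ F]
  (V A : M → Type*) [∀ p, AddCommGroup (V p)] [∀ p, Module ℝ (V p)] [∀ p, AddTorsor (V p) (A p)]
  [TopologicalSpace (TotalSpace F A)] [∀ p, TopologicalSpace (A p)]
  [FiberBundle F A] [IsAffineBundle F V A] [SmoothFiberBundle I F A]

/-- The space `Γ(A⁺)` of smooth global sections of `A⁺`. -/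
abbrev AffineDualSection : Type _ :=
  Cₛ^∞⟮I; AffineDualModel F, AffineDual F V A⟯

variable {I F A}

/-- A smooth function on the total space of `A` is affine if its restriction to every fibre is
an affine function. -/
def IsAffineFunction (a : C^∞⟮I.prod 𝓘(ℝ, F), TotalSpace F A; ℝ⟯) : Prop :=
  ∀ p : M, ∃ φ : A p →ᵃ[ℝ] ℝ, ∀ x : A p, a ⟨p, x⟩ = φ x

theorem contMDiff_affineDual_section (a : C^∞⟮I.prod 𝓘(ℝ, F), TotalSpace F A; ℝ⟯)
    (s : ∀ p, AffineDual F V A p) (hs : ∀ p (x : A p), a ⟨p, x⟩ = s p x) :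
    ContMDiff I (I.prod 𝓘(ℝ, AffineDualModel F)) ∞
      (fun p => TotalSpace.mk' (AffineDualModel F) p (s p)) := by
  intro p₀
  rw [Bundle.contMDiffAt_section]
  set e := trivializationAt F A p₀ with he
  have hp₀ : p₀ ∈ e.baseSet := mem_baseSet_trivializationAt F A p₀
  have hw : ∀ w : F, ContMDiffOn I 𝓘(ℝ, ℝ) ∞
      (fun p => s p ((fiberAffineEquiv V e p).symm w)) e.baseSet := by
    intro w
    have h1 : ContMDiffOn I (I.prod 𝓘(ℝ, F)) ∞
        (fun p => e.toOpenPartialHomeomorph.symm (p, w)) e.baseSet := by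
      intro p hp
      have hproj : ∀ q ∈ e.baseSet, (e.toOpenPartialHomeomorph.symm (q, w)).proj = q :=
        fun q hq => e.proj_symm_apply' hq
      rw [Bundle.contMDiffWithinAt_totalSpace]
      refine ⟨contMDiffWithinAt_id.congr hproj (hproj p hp), ?_⟩
      rw [hproj p hp]
      set e' := trivializationAt F A p with he'
      have h2 : ContMDiffAt (I.prod 𝓘(ℝ, F)) 𝓘(ℝ, F) ∞
          (fun q : M × F => (e' (e.toOpenPartialHomeomorph.symm q)).2) (p, w) :=
        (SmoothFiberBundle.smooth_transition (I := I) e e').contMDiffAt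
          (((e.open_baseSet.inter e'.open_baseSet).prod isOpen_univ).mem_nhds
            ⟨⟨hp, mem_baseSet_trivializationAt F A p⟩, mem_univ _⟩)
      exact (h2.comp p (contMDiffAt_id.prodMk contMDiffAt_const)).contMDiffWithinAt
    refine (a.contMDiff.comp_contMDiffOn h1).congr ?_
    intro p hp
    rw [← hs, mk_fiberAffineEquiv_symm V e hp]
    rfl
  have hsm : ContMDiffOn I 𝓘(ℝ, AffineDualModel F) ∞
      (fun p => affineFunctionEquiv (fiberAffineEquiv V e p) (s p)) e.baseSet := by
    refine ContMDiffOn.prodMk_space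
      (f := fun p => (affineFunctionEquiv (fiberAffineEquiv V e p) (s p)).1)
      (g := fun p => (affineFunctionEquiv (fiberAffineEquiv V e p) (s p)).2) ?_ (hw 0)
    refine contMDiffOn_of_clm_apply fun w => ?_
    refine ((hw w).sub (hw 0)).congr ?_
    intro p _
    exact affineFunctionEquiv_fst_apply _ _ w
  exact hsm.contMDiffAt (e.open_baseSet.mem_nhds hp₀)

/-- The section of `A⁺` associated with an affine function `a`: at `p` it is the restriction of `a`
to the fibre `A p`. -/
def IsAffineFunction.toSection {a : C^∞⟮I.prod 𝓘(ℝ, F), TotalSpace F A; ℝ⟯}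
    (ha : IsAffineFunction V a) : AffineDualSection I F V A where
  toFun p := (ha p).choose
  contMDiff_toFun := contMDiff_affineDual_section V a _ fun p x => (ha p).choose_spec x

theorem IsAffineFunction.toSection_apply {a : C^∞⟮I.prod 𝓘(ℝ, F), TotalSpace F A; ℝ⟯}
    (ha : IsAffineFunction V a) (p : M) (x : A p) : ha.toSection V p x = a ⟨p, x⟩ :=
  ((ha p).choose_spec x).symm

end AffineFunctions

/-! ### Jacobi structures -/

section Jacobi

variable {E : Type*} [NormedAddCommGroup E] [NormedSpace ℝ E]
  {H : Type*} [TopologicalSpace H] (I : ModelWithCorners ℝ E H)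
  (N : Type*) [TopologicalSpace N] [ChartedSpace H N] [IsManifold I ∞ N]

/-- Smooth vector fields on the manifold `N`. -/
abbrev SmoothVectorField : Type _ := Cₛ^∞⟮I; E, (TangentSpace I : N → Type _)⟯

/-- Smooth bivector fields (`2`-vectors) on the manifold `N`: alternating bilinear forms on the
cotangent spaces depending smoothly on the point. -/
structure BivectorField where
  toFun : ∀ x : N, LinearMap.BilinForm ℝ (TangentSpace I x →L[ℝ] ℝ)
  alt : ∀ x, (toFun x).IsAlt
  smooth : ∀ f g : C^∞⟮I, N; ℝ⟯,
    ContMDiff I 𝓘(ℝ, ℝ) ∞ (fun x => toFun x (mvfderiv I f x) (mvfderiv I g x))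

variable {I N}

/-- The derivative `X(f)` of a smooth function along a vector field. -/
def SmoothVectorField.deriv (X : SmoothVectorField I N) (f : C^∞⟮I, N; ℝ⟯) : C^∞⟮I, N; ℝ⟯ :=
  ⟨fun x => mvfderiv I f x (X x), by
    have h1 : ContMDiff I I.tangent ∞ (fun x => (⟨x, X x⟩ : TangentBundle I N)) := X.contMDiff
    have h2 := (f.contMDiff.contMDiff_tangentMap (m := ∞) (by simp)).comp h1
    exact (contMDiff_snd_tangentBundle_modelSpace ℝ 𝓘(ℝ, ℝ)).comp h2⟩

/-- The function `Λ(df, dg)`. -/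
def BivectorField.eval (Λ : BivectorField I N) (f g : C^∞⟮I, N; ℝ⟯) : C^∞⟮I, N; ℝ⟯ :=
  ⟨fun x => Λ.toFun x (mvfderiv I f x) (mvfderiv I g x), Λ.smooth f g⟩

/-- The Schouten bracket `[Λ, Λ]` of a bivector field with itself, as a trivector field evaluated
on `df, dg, dh`. The sign convention is that of the graded Lie bracket extending the Lie bracket of
vector fields, for which `[X ∧ Y, X ∧ Y] = 2 [X, Y] ∧ X ∧ Y`. -/
def BivectorField.schoutenSelf (Λ : BivectorField I N) (f g h : C^∞⟮I, N; ℝ⟯) : C^∞⟮I, N; ℝ⟯ :=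
  (-2 : ℝ) • (Λ.eval (Λ.eval f g) h + Λ.eval (Λ.eval g h) f + Λ.eval (Λ.eval h f) g)

/-- The Schouten bracket `[X, Λ]` (that is, the Lie derivative `ℒ_X Λ`) of a vector field and a
bivector field, as a bivector field evaluated on `df, dg`. -/
def BivectorField.schoutenVector (X : SmoothVectorField I N) (Λ : BivectorField I N)
    (f g : C^∞⟮I, N; ℝ⟯) : C^∞⟮I, N; ℝ⟯ :=
  SmoothVectorField.deriv X (Λ.eval f g)
    - Λ.eval (SmoothVectorField.deriv X f) g - Λ.eval f (SmoothVectorField.deriv X g)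

/-- The trivector field `X ∧ Λ` evaluated on `df, dg, dh`. -/
def BivectorField.wedgeVector (X : SmoothVectorField I N) (Λ : BivectorField I N)
    (f g h : C^∞⟮I, N; ℝ⟯) : C^∞⟮I, N; ℝ⟯ :=
  SmoothVectorField.deriv X f * Λ.eval g h + SmoothVectorField.deriv X g * Λ.eval h f
    + SmoothVectorField.deriv X h * Λ.eval f g

variable (I N)

/-- A Jacobi structure on `N`: a bivector field `Λ` and a vector field `E` with
`[Λ, Λ] = -2 E ∧ Λ` and `[E, Λ] = 0`. -/
@[ext]
structure JacobiStructure where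
  bivector : BivectorField I N
  reeb : SmoothVectorField I N
  schouten_self : ∀ f g h : C^∞⟮I, N; ℝ⟯,
    bivector.schoutenSelf f g h = (-2 : ℝ) • BivectorField.wedgeVector reeb bivector f g h
  schouten_reeb : ∀ f g : C^∞⟮I, N; ℝ⟯, BivectorField.schoutenVector reeb bivector f g = 0

variable {I N}

/-- The Jacobi bracket `{f, g} = Λ(df, dg) + f E(g) - g E(f)`. -/
def JacobiStructure.bracket (J : JacobiStructure I N) (f g : C^∞⟮I, N; ℝ⟯) : C^∞⟮I, N; ℝ⟯ :=
  J.bivector.eval f g + f * SmoothVectorField.deriv J.reeb g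
    - g * SmoothVectorField.deriv J.reeb f

end Jacobi

/-- An affine Jacobi structure on the affine bundle `A`: a Jacobi structure on the total space of
`A` such that the Jacobi bracket of any two affine functions is an affine function. -/
structure AffineJacobiStructure {E : Type*} [NormedAddCommGroup E] [NormedSpace ℝ E]
    {H : Type*} [TopologicalSpace H] (I : ModelWithCorners ℝ E H)
    {M : Type*} [TopologicalSpace M] [ChartedSpace H M] [IsManifold I ∞ M]
    (F : Type*) [NormedAddCommGroup F] [NormedSpace ℝ F]
    (V A : M → Type*) [∀ p, AddCommGroup (V p)] [∀ p, Module ℝ (V p)]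
    [∀ p, AddTorsor (V p) (A p)]
    [TopologicalSpace (TotalSpace F A)] [∀ p, TopologicalSpace (A p)]
    [FiberBundle F A] [SmoothFiberBundle I F A]
    extends JacobiStructure (I.prod 𝓘(ℝ, F)) (TotalSpace F A) where
  isAffine_bracket : ∀ a b : C^∞⟮I.prod 𝓘(ℝ, F), TotalSpace F A; ℝ⟯,
    IsAffineFunction V a → IsAffineFunction V b → IsAffineFunction V (toJacobiStructure.bracket a b)

/-! ### Lie algebroids, Lie QD-algebroids, local Lie algebras -/

/-- A Lie algebra structure on a given real vector space. -/
structure LieBracketStructure (L : Type*) [AddCommGroup L] [Module ℝ L] where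
  bracket : L →ₗ[ℝ] L →ₗ[ℝ] L
  bracket_self : ∀ X, bracket X X = 0
  jacobi : ∀ X Y Z,
    bracket X (bracket Y Z) + bracket Y (bracket Z X) + bracket Z (bracket X Y) = 0

section LieAlgebroids

variable {E : Type*} [NormedAddCommGroup E] [NormedSpace ℝ E]
  {H : Type*} [TopologicalSpace H] (I : ModelWithCorners ℝ E H)
  {M : Type*} [TopologicalSpace M] [ChartedSpace H M]
  (G : Type*) [NormedAddCommGroup G] [NormedSpace ℝ G]
  (B : M → Type*) [∀ p, AddCommGroup (B p)] [∀ p, Module ℝ (B p)]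
  [TopologicalSpace (TotalSpace G B)] [∀ p, TopologicalSpace (B p)]
  [FiberBundle G B] [VectorBundle ℝ G B]

variable {I G B}

/-- The product `f s` of a smooth function and a smooth section of a vector bundle `B`. -/
def functionSmul (f : C^∞⟮I, M; ℝ⟯) (s : Cₛ^∞⟮I; G, B⟯) : Cₛ^∞⟮I; G, B⟯ :=
  ⟨fun p => f p • s p, f.contMDiff.smul_section s.contMDiff⟩

/-- The support of a section. -/
def sectionSupport (s : Cₛ^∞⟮I; G, B⟯) : Set M := closure {p | s p ≠ 0}

variable (I G B)

/-- A local Lie algebra structure (in the sense of Kirillov) on a vector bundle `B`: a Lie bracket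
on its smooth sections with `supp [s, t] ⊆ supp s ∩ supp t`. -/
structure LocalLieAlgebra extends LieBracketStructure Cₛ^∞⟮I; G, B⟯ where
  support_bracket : ∀ s t, sectionSupport (bracket s t) ⊆ sectionSupport s ∩ sectionSupport t

variable [IsManifold I ∞ M]

/-- A Lie algebroid structure on a smooth vector bundle `B → M`: a Lie bracket on its smooth
sections and an anchor, i.e. a smooth vector bundle morphism `ρ : B → TM`, with
`[X, f Y] = f [X, Y] + ρ(X)(f) Y`. -/
structure LieAlgebroid extends LieBracketStructure Cₛ^∞⟮I; G, B⟯ where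
  anchor : ∀ p : M, B p →ₗ[ℝ] TangentSpace I p
  contMDiff_anchor : ContMDiff (I.prod 𝓘(ℝ, G)) I.tangent ∞
    (fun v : TotalSpace G B => (⟨v.1, anchor v.1 v.2⟩ : TangentBundle I M))
  leibniz : ∀ (X Y : Cₛ^∞⟮I; G, B⟯) (f : C^∞⟮I, M; ℝ⟯) (p : M),
    bracket X (functionSmul f Y) p
      = f p • bracket X Y p + mvfderiv I f p (anchor p (X p)) • Y p

/-- A Lie QD-algebroid structure on a smooth vector bundle `B → M`: a Lie bracket on its smooth
sections and a linear map `X ↦ X̂` from sections to vector fields, not necessarily given by a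
bundle morphism, with `[X, f Y] = f [X, Y] + X̂(f) Y`. -/
structure LieQDAlgebroid extends LieBracketStructure Cₛ^∞⟮I; G, B⟯ where
  anchor : Cₛ^∞⟮I; G, B⟯ →ₗ[ℝ] SmoothVectorField I M
  leibniz : ∀ (X Y : Cₛ^∞⟮I; G, B⟯) (f : C^∞⟮I, M; ℝ⟯),
    bracket X (functionSmul f Y)
      = functionSmul f (bracket X Y) + functionSmul (SmoothVectorField.deriv (anchor X) f) Y

end LieAlgebroids

/-! ### The correspondence -/

section Correspondence

variable {E : Type*} [NormedAddCommGroup E] [NormedSpace ℝ E]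
  {H : Type*} [TopologicalSpace H] {I : ModelWithCorners ℝ E H}
  {M : Type*} [TopologicalSpace M] [ChartedSpace H M] [IsManifold I ∞ M]
  {F : Type*} [NormedAddCommGroup F] [NormedSpace ℝ F] [FiniteDimensional ℝ F]
  {V A : M → Type*} [∀ p, AddCommGroup (V p)] [∀ p, Module ℝ (V p)] [∀ p, AddTorsor (V p) (A p)]
  [TopologicalSpace (TotalSpace F A)] [∀ p, TopologicalSpace (A p)]
  [FiberBundle F A] [IsAffineBundle F V A] [SmoothFiberBundle I F A]

/-- An affine Jacobi structure corresponds to a Lie bracket on `Γ(A⁺)` if the section associated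
with the Jacobi bracket of two affine functions is the bracket of the associated sections. -/
def AffineJacobiStructure.CorrespondsTo (J : AffineJacobiStructure I F V A)
    (L : LieBracketStructure (AffineDualSection I F V A)) : Prop :=
  ∀ (a b : C^∞⟮I.prod 𝓘(ℝ, F), TotalSpace F A; ℝ⟯) (ha : IsAffineFunction V a)
    (hb : IsAffineFunction V b),
    (J.isAffine_bracket a b ha hb).toSection V = L.bracket (ha.toSection V) (hb.toSection V)

end Correspondence

end

set_option linter.unusedSectionVars false

section FirstOrder

variable {R : Type*} [CommRing R] [Algebra ℝ R]

theorem eq_zero_of_forall_sum_pow_smul {Y : Type*} [AddCommGroup Y] [Module ℝ Y] (n : ℕ) (y : ℕ → Y)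
    (h : ∀ t : ℝ, ∑ i ∈ Finset.range n, t ^ i • y i = 0) : ∀ i < n, y i = 0 := by
  intro i hi
  rw [← Module.forall_dual_apply_eq_zero_iff ℝ]
  intro l
  let P : Polynomial ℝ := ∑ i ∈ Finset.range n, Polynomial.monomial i (l (y i))
  have hP : P = 0 := by
    refine Polynomial.funext fun t => ?_
    have h1 := congrArg l (h t)
    simp only [map_sum, map_smul, smul_eq_mul, map_zero] at h1
    simp only [P, Polynomial.eval_finsetSum, Polynomial.eval_monomial, Polynomial.eval_zero]
    rw [← h1]
    exact Finset.sum_congr rfl fun j _ => mul_comm _ _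
  have h2 := congrArg (fun Q : Polynomial ℝ => Q.coeff i) hP
  simpa [P, Polynomial.finsetSum_coeff, Polynomial.coeff_monomial, hi] using h2

theorem Commute.add_smul_pow_apply {Y : Type*} [AddCommGroup Y] [Module ℝ Y] {A B : Module.End ℝ Y}
    (h : Commute A B) (n : ℕ) (t : ℝ) (y : Y) :
    ((A + t • B) ^ n) y
      = ∑ i ∈ Finset.range (n + 1), t ^ i • ((n.choose i : ℝ) • (A ^ (n - i) * B ^ i) y) := by
  rw [add_comm, ((h.symm.smul_left t).add_pow n), LinearMap.sum_apply]
  refine Finset.sum_congr rfl fun i _ => ?_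
  rw [smul_pow, smul_mul_assoc, smul_mul_assoc, LinearMap.smul_apply, (h.pow_pow _ _).eq,
    ← Nat.cast_comm, Module.End.mul_apply, Module.End.natCast_apply, Nat.cast_smul_eq_nsmul]

theorem Commute.pow_mul_apply_eq_zero {Y : Type*} [AddCommGroup Y] [Module ℝ Y]
    {A B : Module.End ℝ Y} (h : Commute A B) (n : ℕ) (y : Y)
    (hy : ∀ t : ℝ, ((A + t • B) ^ (n + 1)) y = 0) : (A ^ n * B) y = 0 := by
  have h1 := eq_zero_of_forall_sum_pow_smul (n + 2)
    (fun i => (((n + 1).choose i : ℕ) : ℝ) • (A ^ (n + 1 - i) * B ^ i) y)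
    (fun t => by rw [← h.add_smul_pow_apply]; exact hy t) 1 (by omega)
  have h2 : ((n : ℝ) + 1) ≠ 0 := by positivity
  simpa [h2] using h1

/-- The commutator `T ↦ [T, u]` of operators on `R` with the multiplication by `u`. -/
noncomputable def mulCommutator : R →ₗ[ℝ] Module.End ℝ (Module.End ℝ R) where
  toFun u := LinearMap.mulRight ℝ (LinearMap.mulLeft ℝ u) - LinearMap.mulLeft ℝ (LinearMap.mulLeft ℝ u)
  map_add' u v := by
    ext T f; simp [add_mul]; ring
  map_smul' c u := by
    ext T f; simp [smul_sub]

theorem mulCommutator_apply (u : R) (T : Module.End ℝ R) (f : R) :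
    mulCommutator u T f = T (u * f) - u * T f := rfl

theorem commute_mulCommutator (u v : R) : Commute (mulCommutator u) (mulCommutator v) := by
  refine LinearMap.ext fun T => LinearMap.ext fun f => ?_
  simp only [Module.End.mul_apply, mulCommutator_apply, mul_left_comm u v f]
  ring

theorem mulCommutator_mul (u : R) (S T : Module.End ℝ R) :
    mulCommutator u (S * T) = mulCommutator u S * T + S * mulCommutator u T := by
  ext f
  simp [mulCommutator_apply]

theorem mulCommutator_mulLeft_mul (u c : R) (T : Module.End ℝ R) :
    mulCommutator u (LinearMap.mulLeft ℝ c * T) = LinearMap.mulLeft ℝ c * mulCommutator u T := by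
  ext f
  simp [mulCommutator_apply]; ring

theorem mulCommutator_pow_mulLeft_mul (u c : R) (n : ℕ) (T : Module.End ℝ R) :
    (mulCommutator u ^ n) (LinearMap.mulLeft ℝ c * T)
      = LinearMap.mulLeft ℝ c * (mulCommutator u ^ n) T := by
  induction n with
  | zero => rfl
  | succ n ih => rw [pow_succ', Module.End.mul_apply, ih, mulCommutator_mulLeft_mul]; rfl

theorem eq_mulLeft_of_mulCommutator_eq_zero {T : Module.End ℝ R} (h : ∀ w, mulCommutator w T = 0) :
    T = LinearMap.mulLeft ℝ (T 1) := by
  ext f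
  have := LinearMap.congr_fun (h f) 1
  simp only [mulCommutator_apply, mul_one, LinearMap.zero_apply] at this
  rw [LinearMap.mulLeft_apply, mul_comm, ← sub_eq_zero, this]

theorem mulCommutator_pow_mul_of_derivation (v c : R) (Q S : Module.End ℝ R)
    (hQ : mulCommutator v Q = LinearMap.mulLeft ℝ c) (n : ℕ) :
    (mulCommutator v ^ (n + 1)) (Q * S) = Q * (mulCommutator v ^ (n + 1)) S
      + ((n : ℝ) + 1) • (LinearMap.mulLeft ℝ c * (mulCommutator v ^ n) S) := by
  induction n with
  | zero => simp [mulCommutator_mul, hQ, add_comm]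
  | succ n ih =>
    rw [pow_succ', Module.End.mul_apply, ih, map_add, map_smul, mulCommutator_mul, hQ,
      mulCommutator_mulLeft_mul, ← Module.End.mul_apply, ← Module.End.mul_apply, ← pow_succ',
      ← pow_succ']
    push_cast
    module

theorem mulCommutator_pow_apply_eq (u v : R) (n k : ℕ) (b : R →ₗ[ℝ] R →ₗ[ℝ] R) (h : R)
    (hb : ∀ g, (mulCommutator v ^ n) (b.flip g) = 0) :
    (mulCommutator v ^ n)
      ((LinearMap.applyₗ h).comp ((mulCommutator u ^ k : Module.End ℝ (Module.End ℝ R)).comp b)) = 0 := by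
  induction k generalizing h with
  | zero => exact hb h
  | succ k ih =>
    have : (LinearMap.applyₗ h).comp ((mulCommutator u ^ (k + 1) : Module.End ℝ (Module.End ℝ R)).comp b)
        = (LinearMap.applyₗ (u * h)).comp ((mulCommutator u ^ k : Module.End ℝ (Module.End ℝ R)).comp b)
          - LinearMap.mulLeft ℝ u * (LinearMap.applyₗ h).comp ((mulCommutator u ^ k : Module.End ℝ (Module.End ℝ R)).comp b) := by
      ext f
      simp [pow_succ', mulCommutator_apply]
    rw [this, map_sub, ih, mulCommutator_pow_mulLeft_mul, ih]
    simp

theorem mulCommutator_pow_commutator (u : R) (k : ℕ) (X Y : Module.End ℝ R)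
    (hX : (mulCommutator u ^ (k + 2)) X = 0) (hY : (mulCommutator u ^ (k + 2)) Y = 0) :
    (mulCommutator u ^ (2 * k + 1)) (X * Y)
      = ((2 * k + 1).choose k : ℝ) • ((mulCommutator u ^ (k + 1)) X * (mulCommutator u ^ k) Y
        + (mulCommutator u ^ k) X * (mulCommutator u ^ (k + 1)) Y) := by
  have hzX : ∀ j, (mulCommutator u ^ (k + 2 + j)) X = 0 := by
    intro j; rw [add_comm, pow_add, Module.End.mul_apply, hX, map_zero]
  have hzY : ∀ j, (mulCommutator u ^ (k + 2 + j)) Y = 0 := by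
    intro j; rw [add_comm, pow_add, Module.End.mul_apply, hY, map_zero]
  have hL : ∀ n, (mulCommutator u ^ n) (X * Y) = ∑ ij ∈ Finset.HasAntidiagonal.antidiagonal n,
      (n.choose ij.1 : ℝ) • ((mulCommutator u ^ ij.1) X * (mulCommutator u ^ ij.2) Y) := by
    intro n
    induction n with
    | zero => simp
    | succ n ih =>
      have hch := Finset.sum_antidiagonal_choose_succ_nsmul
        (fun i j => (mulCommutator u ^ i) X * (mulCommutator u ^ j) Y) n
      simp only [← Nat.cast_smul_eq_nsmul ℝ] at hch
      rw [hch, pow_succ', Module.End.mul_apply, ih, map_sum, ← Finset.sum_add_distrib]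
      refine Finset.sum_congr rfl fun ij hij => ?_
      have hc : n.choose ij.2 = n.choose ij.1 :=
        Nat.choose_symm_of_eq_add ((Finset.HasAntidiagonal.mem_antidiagonal.1 hij).symm.trans (add_comm _ _))
      rw [hc, map_smul, mulCommutator_mul, pow_succ' _ ij.1, pow_succ' _ ij.2, smul_add,
        add_comm]
      rfl
  rw [hL, Finset.Nat.sum_antidiagonal_eq_sum_range_succ_mk]
  rw [Finset.sum_eq_add (k + 1) k (by omega)]
  · have e1 : 2 * k + 1 - (k + 1) = k := by omega
    have e2 : 2 * k + 1 - k = k + 1 := by omega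
    have e3 : (2 * k + 1).choose (k + 1) = (2 * k + 1).choose k :=
      Nat.choose_symm_of_eq_add (by omega)
    simp only [e1, e2, e3, smul_add]
  · intro i hi hne
    rw [Finset.mem_range] at hi
    rcases Nat.lt_or_ge i k with h | h
    · obtain ⟨j, hj⟩ : ∃ j, 2 * k + 1 - i = k + 2 + j := ⟨2 * k + 1 - i - (k + 2), by omega⟩
      simp [hj, hzY]
    · obtain ⟨j, hj⟩ : ∃ j, i = k + 2 + j := ⟨i - (k + 2), by omega⟩
      simp [hj, hzX]
  · intro h; exact absurd (Finset.mem_range.2 (by omega)) h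
  · intro h; exact absurd (Finset.mem_range.2 (by omega)) h

/-- The zeroth and first coefficients of a product of a polynomial with an affine polynomial. -/
theorem coeff_mul_affine_eq_zero (n : ℕ) (q : ℕ → R) (hq : ∀ i, n < i → q i = 0) (r₀ r₁ : R)
    (h : ∀ t : ℝ, (∑ i ∈ Finset.range (n + 1), t ^ i • q i) * (r₀ + t • r₁) = 0) :
    q 0 * r₀ = 0 ∧ q 1 * r₀ + q 0 * r₁ = 0 := by
  let y : ℕ → R := fun i => q i * r₀ + match i with
    | 0 => 0
    | j + 1 => q j * r₁
  have h1 := eq_zero_of_forall_sum_pow_smul (n + 2) y (fun t => by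
    rw [← h t, mul_add, Finset.sum_mul, Finset.sum_mul]
    simp only [y, smul_add, Finset.sum_add_distrib]
    congr 1
    · rw [Finset.sum_range_succ, hq (n + 1) (by omega)]
      simp
    · rw [Finset.sum_range_succ']
      simp only [smul_zero, add_zero]
      refine Finset.sum_congr rfl fun i _ => ?_
      rw [smul_mul_smul_comm, pow_succ])
  exact ⟨by simpa [y] using h1 0 (by omega), h1 1 (by omega)⟩

variable (b : R →ₗ[ℝ] R →ₗ[ℝ] R)

/-- The polarised symbol `f ↦ ([[[b f, w], u], …, u]) 1`. -/
noncomputable def polarSymbol (k : ℕ) (u : R) : R →ₗ[ℝ] Module.End ℝ R where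
  toFun w := (LinearMap.applyₗ (1 : R)).comp
    ((mulCommutator w * mulCommutator u ^ k : Module.End ℝ (Module.End ℝ R)).comp b)
  map_add' w w' := by ext f; simp
  map_smul' c w := by ext f; simp

theorem polarSymbol_apply (k : ℕ) (u w f : R) :
    polarSymbol b k u w f = (mulCommutator w ((mulCommutator u ^ k) (b f))) 1 := rfl

variable {b}

theorem polarSymbol_self (k : ℕ) (u f : R) :
    polarSymbol b k u u f = ((mulCommutator u ^ (k + 1)) (b f)) 1 := by
  rw [polarSymbol_apply, pow_succ']; rfl

section Step

variable {k : ℕ} (hk : ∀ u f, (mulCommutator u ^ (k + 3)) (b f) = 0)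
include hk

theorem mulCommutator_mul_pow_eq_zero (w u f : R) :
    mulCommutator w ((mulCommutator u ^ (k + 2)) (b f)) = 0 := by
  have h := (commute_mulCommutator u w).pow_mul_apply_eq_zero (k + 2) (b f) (fun t => by
    rw [← map_smul, ← map_add]; exact hk _ f)
  rw [← Module.End.mul_apply, ← ((commute_mulCommutator u w).pow_left _).eq]
  exact h

theorem mulCommutator_mul_mul_pow_eq_zero (w w' u f : R) :
    mulCommutator w (mulCommutator w' ((mulCommutator u ^ (k + 1)) (b f))) = 0 := by
  have h := (commute_mulCommutator u w).pow_mul_apply_eq_zero (k + 1) (mulCommutator w' (b f))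
    (fun t => by
      rw [← map_smul, ← map_add, ← Module.End.mul_apply,
        ((commute_mulCommutator _ w').pow_left _).eq]
      exact mulCommutator_mul_pow_eq_zero hk _ _ f)
  have e := LinearMap.congr_fun ((commute_mulCommutator u w').pow_left (k + 1)).eq (b f)
  rw [Module.End.mul_apply, Module.End.mul_apply] at e
  rw [((commute_mulCommutator u w).pow_left _).eq, Module.End.mul_apply, e] at h
  exact h

theorem mulCommutator_flip_polarSymbol (u v f : R) :
    mulCommutator v ((polarSymbol b (k + 1) u).flip f)
      = LinearMap.mulLeft ℝ (polarSymbol b (k + 1) u v f) := by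
  ext w
  have h := LinearMap.congr_fun (mulCommutator_mul_mul_pow_eq_zero hk w v u f) 1
  simp only [mulCommutator_apply, LinearMap.flip_apply, polarSymbol_apply, mul_one,
    LinearMap.zero_apply, LinearMap.mulLeft_apply, mul_assoc] at h ⊢
  linear_combination h

variable (anti : ∀ f g, b f g = -b g f)
  (jac : ∀ f g h, b f (b g h) = b (b f g) h + b g (b f h))

include jac in
theorem polarSymbol_polarSymbol_comm (u f g : R) :
    polarSymbol b (k + 1) u (polarSymbol b (k + 1) u u g) f
      = polarSymbol b (k + 1) u (polarSymbol b (k + 1) u u f) g := by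
  have hb : b (b f g) = b f * b g - b g * b f := by
    ext h; simp [jac f g h]
  have hs : ∀ f, (mulCommutator u ^ (k + 1 + 1)) (b f)
      = LinearMap.mulLeft ℝ (polarSymbol b (k + 1) u u f) := by
    intro f
    rw [polarSymbol_self]
    exact eq_mulLeft_of_mulCommutator_eq_zero fun w => mulCommutator_mul_pow_eq_zero hk w u f
  have h0 : (mulCommutator u ^ (2 * (k + 1) + 1)) (b (b f g)) = 0 := by
    have : 2 * (k + 1) + 1 = k + (k + 3) := by ring
    rw [this, pow_add, Module.End.mul_apply, hk, map_zero]
  rw [hb, map_sub, mulCommutator_pow_commutator u (k + 1) _ _ (hk u f) (hk u g),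
    mulCommutator_pow_commutator u (k + 1) _ _ (hk u g) (hk u f), hs, hs] at h0
  have hc : (((2 * (k + 1) + 1).choose (k + 1) : ℕ) : ℝ) ≠ 0 :=
    Nat.cast_ne_zero.2 (Nat.choose_pos (by omega)).ne'
  have h1 := LinearMap.congr_fun h0 1
  simp only [LinearMap.sub_apply, LinearMap.smul_apply, LinearMap.add_apply, Module.End.mul_apply,
    LinearMap.mulLeft_apply, mul_one, LinearMap.zero_apply] at h1
  rw [← smul_sub] at h1
  replace h1 := (smul_eq_zero.1 h1).resolve_left hc
  rw [polarSymbol_apply b (k + 1) u (polarSymbol b (k + 1) u u g) f,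
    polarSymbol_apply b (k + 1) u (polarSymbol b (k + 1) u u f) g, mulCommutator_apply,
    mulCommutator_apply, mul_one, mul_one]
  linear_combination h1

include anti in
theorem mulCommutator_pow_symbol_eq_zero (u v : R) :
    (mulCommutator v ^ (k + 3)) (polarSymbol b (k + 1) u u) = 0 := by
  have h := mulCommutator_pow_apply_eq u v (k + 3) (k + 2) b 1 (fun g => by
    have : b.flip g = -b g := by ext f; simp [anti f g]
    rw [this, map_neg, hk, neg_zero])
  rw [← h]
  congr 1
  ext f
  exact polarSymbol_self _ _ _

include jac in
theorem mulCommutator_pow_symbol_of_succ [IsReduced R] (m : ℕ)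
    (hm : ∀ u v, (mulCommutator v ^ (m + 1)) (polarSymbol b (k + 1) u u) = 0) (u v : R) :
    (mulCommutator v ^ m) (polarSymbol b (k + 1) u u) = 0 := by
  have hpol : ∀ u w v, (mulCommutator v ^ (m + 1)) (polarSymbol b (k + 1) u w) = 0 := by
    intro u w v
    ext f
    let ev : R → (Module.End ℝ R →ₗ[ℝ] R) := fun h => LinearMap.applyₗ h
    have key : ∀ h u, (mulCommutator v ^ (m + 1))
        ((ev h).comp ((mulCommutator u ^ (k + 2) : Module.End ℝ (Module.End ℝ R)).comp b))
        = LinearMap.mulLeft ℝ h *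
          (mulCommutator v ^ (m + 1)) (polarSymbol b (k + 1) u u) := by
      intro h u
      rw [← mulCommutator_pow_mulLeft_mul]
      congr 1
      ext f
      have := eq_mulLeft_of_mulCommutator_eq_zero
        fun w => mulCommutator_mul_pow_eq_zero hk w u f
      simp only [ev, LinearMap.comp_apply, LinearMap.applyₗ_apply_apply]
      rw [this, Module.End.mul_apply, polarSymbol_self, LinearMap.mulLeft_apply,
        LinearMap.mulLeft_apply, mul_comm]
    let Ψ : Module.End ℝ (Module.End ℝ R) →ₗ[ℝ] R :=
      (LinearMap.applyₗ f).comp ((mulCommutator v ^ (m + 1) : Module.End ℝ (Module.End ℝ R)).comp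
        (LinearMap.lcomp ℝ _ b |>.comp (LinearMap.llcomp ℝ _ _ _ (ev 1))))
    have hΨ : ∀ u, Ψ (mulCommutator u ^ (k + 2)) = 0 := by
      intro u
      have := LinearMap.congr_fun (key 1 u) f
      rw [hm, mul_zero] at this
      exact this
    have h2 := eq_zero_of_forall_sum_pow_smul (k + 3)
      (fun i => (((k + 2).choose i : ℕ) : ℝ) • Ψ (mulCommutator u ^ (k + 2 - i) * mulCommutator w ^ i))
      (fun t => by
        rw [← hΨ (u + t • w), map_add, map_smul, add_comm (mulCommutator u),
          (((commute_mulCommutator u w).symm.smul_left t).add_pow (k + 2)), map_sum]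
        refine Finset.sum_congr rfl fun i _ => ?_
        rw [smul_pow, smul_mul_assoc, smul_mul_assoc, map_smul, ← Nat.cast_comm, ← nsmul_eq_mul,
          map_nsmul, ← Nat.cast_smul_eq_nsmul ℝ,
          ((commute_mulCommutator u w).pow_pow _ _).eq]) 1 (by omega)
    have h3 : ((k : ℝ) + 2) ≠ 0 := by positivity
    have h4 : Ψ (mulCommutator u ^ (k + 1) * mulCommutator w) = 0 := by simpa [h3] using h2
    rw [((commute_mulCommutator u w).pow_left _).eq] at h4
    exact h4
  have hprod : ∀ f g u v, polarSymbol b (k + 1) u v f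
      * ((mulCommutator v ^ m) (polarSymbol b (k + 1) u u)) g = 0 := by
    intro f g u v
    have h1 : (polarSymbol b (k + 1) u).flip f * polarSymbol b (k + 1) u u
        = polarSymbol b (k + 1) u (polarSymbol b (k + 1) u u f) := by
      ext g
      exact polarSymbol_polarSymbol_comm hk jac u f g
    have h2 := mulCommutator_pow_mul_of_derivation v _ _ (polarSymbol b (k + 1) u u)
      (mulCommutator_flip_polarSymbol hk u v f) m
    rw [h1, hpol, hm, mul_zero, zero_add] at h2
    have h3 : ((m : ℝ) + 1) ≠ 0 := by positivity
    exact LinearMap.congr_fun ((smul_eq_zero.1 h2.symm).resolve_left h3) g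
  have hprod' : ∀ f u v z, ((mulCommutator z ^ m) (polarSymbol b (k + 1) u v)) f
      * ((mulCommutator v ^ m) (polarSymbol b (k + 1) u u)) f = 0 := by
    intro f u v z
    have h1 : LinearMap.mulLeft ℝ (((mulCommutator v ^ m) (polarSymbol b (k + 1) u u)) f)
        * polarSymbol b (k + 1) u v = 0 := by
      ext g
      rw [Module.End.mul_apply, LinearMap.mulLeft_apply, mul_comm]
      exact hprod g f u v
    have h2 := mulCommutator_pow_mulLeft_mul z
      (((mulCommutator v ^ m) (polarSymbol b (k + 1) u u)) f) m (polarSymbol b (k + 1) u v)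
    rw [h1, map_zero] at h2
    rw [mul_comm]
    exact (LinearMap.congr_fun h2 f).symm
  ext f
  let S := polarSymbol b (k + 1) u u
  let q : ℕ → R := fun i => ((m.choose i : ℝ) • (mulCommutator v ^ (m - i) * mulCommutator u ^ i) S) f
  have h := coeff_mul_affine_eq_zero m q (fun i hi => by
      simp [q, Nat.choose_eq_zero_of_lt hi])
    (((mulCommutator v ^ m) (polarSymbol b (k + 1) u v)) f) (((mulCommutator v ^ m) S) f)
    (fun t => by
      have h1 := hprod' f u (v + t • u) v
      rw [map_add (mulCommutator), map_smul (mulCommutator),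
        (commute_mulCommutator v u).add_smul_pow_apply, map_add, map_smul, map_add, map_smul,
        mul_comm, LinearMap.sum_apply] at h1
      exact h1)
  have hq0 : q 0 = ((mulCommutator v ^ m) S) f := by simp [q]
  rw [hq0] at h
  set x := ((mulCommutator v ^ m) S) f
  have hx : x ^ 3 = 0 := by
    linear_combination x * h.2 - q 1 * h.1
  exact pow_eq_zero_iff (by norm_num) |>.1 hx

include anti jac in
theorem mulCommutator_pow_of_succ [IsReduced R] (u f : R) :
    (mulCommutator u ^ (k + 2)) (b f) = 0 := by
  have h : ∀ m ≤ k + 3, ∀ u v,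
      (mulCommutator v ^ (k + 3 - m)) (polarSymbol b (k + 1) u u) = 0 := by
    intro m
    induction m with
    | zero => intro _; exact mulCommutator_pow_symbol_eq_zero hk anti
    | succ m ih =>
      intro hm
      refine mulCommutator_pow_symbol_of_succ hk jac _ ?_
      have : k + 3 - (m + 1) + 1 = k + 3 - m := by omega
      rw [this]
      exact ih (by omega)
  have h0 := h (k + 3) le_rfl u u
  rw [Nat.sub_self, pow_zero, Module.End.one_apply] at h0
  rw [eq_mulLeft_of_mulCommutator_eq_zero fun w => mulCommutator_mul_pow_eq_zero hk w u f,
    ← polarSymbol_self, h0]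
  ext; simp

end Step

/-- A Lie bracket of finite order on a reduced commutative algebra is of order one. -/
theorem mulCommutator_sq_eq_zero [IsReduced R] (k : ℕ)
    (hk : ∀ u f, (mulCommutator u ^ (k + 2)) (b f) = 0) (anti : ∀ f g, b f g = -b g f)
    (jac : ∀ f g h, b f (b g h) = b (b f g) h + b g (b f h)) (u f : R) :
    (mulCommutator u ^ 2) (b f) = 0 := by
  induction k with
  | zero => exact hk u f
  | succ k ih => exact ih (mulCommutator_pow_of_succ hk anti jac)

theorem mulCommutator_mulCommutator_eq_zero (hk : ∀ u f, (mulCommutator u ^ 2) (b f) = 0) (u w f : R) :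
    mulCommutator w (mulCommutator u (b f)) = 0 := by
  have h := (commute_mulCommutator u w).pow_mul_apply_eq_zero 1 (b f) (fun t => by
    rw [← map_smul, ← map_add]; exact hk _ f)
  rw [pow_one, (commute_mulCommutator u w).eq] at h
  exact h

end FirstOrder

section JacobiIdentities

variable {C : Type*} [CommRing C]

/-- The Jacobiator of `{f, g} = P(f, g) + f D(g) - g D(f)`. -/
theorem jacobiator_eq (P : C → C → C) (D : C → C)
    (hPa : ∀ a b c, P a (b + c) = P a b + P a c) (hPs : ∀ a b c, P a (b - c) = P a b - P a c)
    (hPm : ∀ a b c, P a (b * c) = b * P a c + c * P a b) (anti : ∀ a b, P a b = -P b a)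
    (hDa : ∀ a b, D (a + b) = D a + D b) (hDs : ∀ a b, D (a - b) = D a - D b)
    (hDm : ∀ a b, D (a * b) = a * D b + b * D a)
    (br : C → C → C) (hbr : ∀ f g, br f g = P f g + f * D g - g * D f) (f g h : C) :
    br f (br g h) + br g (br h f) + br h (br f g)
      = -(P (P f g) h + P (P g h) f + P (P h f) g
          - (D f * P g h + D g * P h f + D h * P f g))
        + (f * (D (P g h) - P (D g) h - P g (D h)) + g * (D (P h f) - P (D h) f - P h (D f))
          + h * (D (P f g) - P (D f) g - P f (D g))) := by
  simp only [hbr, hPa, hPs, hPm, hDa, hDs, hDm]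
  rw [anti (P f g) h, anti (P g h) f, anti (P h f) g, anti (D f) g, anti (D g) h, anti (D h) f,
    anti h g, anti g f, anti f h]
  ring

end JacobiIdentities

section SmoothFunctions

variable {E : Type*} [NormedAddCommGroup E] [NormedSpace ℝ E] [FiniteDimensional ℝ E]
  {H : Type*} [TopologicalSpace H] {I : ModelWithCorners ℝ E H}
  {N : Type*} [TopologicalSpace N] [ChartedSpace H N] [IsManifold I ∞ N]

open Filter Topology

theorem exists_smooth_eventuallyEq_one [T2Space N] (x : N) {s : Set N} (hs : s ∈ 𝓝 x) :
    ∃ χ : C^∞⟮I, N; ℝ⟯, (χ =ᶠ[𝓝 x] fun _ => (1 : ℝ)) ∧ tsupport χ ⊆ s := by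
  obtain ⟨f, -, hf⟩ := (SmoothBumpFunction.nhds_basis_tsupport (I := I) x).mem_iff.1 hs
  exact ⟨⟨f, f.contMDiff⟩, f.eventuallyEq_one, hf⟩

theorem exists_contDiff_eventuallyEq {G : Type*} [NormedAddCommGroup G] [NormedSpace ℝ G]
    {g : E → G} {s : Set E} (hs : IsOpen s) (hg : ContDiffOn ℝ ∞ g s)
    {y : E} (hy : y ∈ s) : ∃ g' : E → G, ContDiff ℝ ∞ g' ∧ g' =ᶠ[𝓝 y] g := by
  obtain ⟨χ, h1, h2⟩ := exists_smooth_eventuallyEq_one (I := 𝓘(ℝ, E)) y (hs.mem_nhds hy)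
  refine ⟨fun z => χ z • g z, ?_, ?_⟩
  · rw [contDiff_iff_contDiffAt]
    intro z
    by_cases hz : z ∈ tsupport χ
    · exact (χ.contMDiff.contDiff.contDiffAt).smul (hg.contDiffAt (hs.mem_nhds (h2 hz)))
    · refine (contDiffAt_const (c := (0 : G))).congr_of_eventuallyEq ?_
      filter_upwards [notMem_tsupport_iff_eventuallyEq.1 hz] with w hw
      simp [hw]
  · filter_upwards [h1] with z hz
    simp [hz]

theorem exists_smooth_eqOn_comp_extChartAt [T2Space N] (x : N) :
    ∃ U : Set N, IsOpen U ∧ x ∈ U ∧ U ⊆ (chartAt H x).source ∧ ∀ g : E → ℝ, ContDiff ℝ ∞ g →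
      ∃ f : C^∞⟮I, N; ℝ⟯, ∀ z ∈ U, f z = g (extChartAt I x z) := by
  let χ : SmoothBumpFunction I x := Classical.arbitrary _
  refine ⟨interior {z | χ z = 1} ∩ (chartAt H x).source, isOpen_interior.inter
    (chartAt H x).open_source, ⟨mem_interior_iff_mem_nhds.2 χ.eventuallyEq_one,
    mem_chart_source H x⟩, inter_subset_right, fun g hg => ?_⟩
  refine ⟨⟨fun z => χ z • g (extChartAt I x z), χ.contMDiff_smul ?_⟩, fun z hz => ?_⟩
  · exact (hg.contMDiff.comp_contMDiffOn (contMDiffOn_extChartAt (I := I) (x := x)))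
  · have h1 : χ z = 1 := (interior_subset hz.1 :)
    show χ z • g (extChartAt I x z) = _
    rw [h1, one_smul]

theorem exists_smooth_eventuallyEq_comp_extChartAt [T2Space N] (x : N) {g : E → ℝ}
    (hg : ContDiff ℝ ∞ g) :
    ∃ f : C^∞⟮I, N; ℝ⟯, f =ᶠ[𝓝 x] fun z => g (extChartAt I x z) := by
  obtain ⟨U, hU, hx, -, h⟩ := exists_smooth_eqOn_comp_extChartAt (I := I) x
  obtain ⟨f, hf⟩ := h g hg
  exact ⟨f, Filter.eventuallyEq_of_mem (hU.mem_nhds hx) hf⟩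

variable [I.Boundaryless]

theorem contDiffOn_comp_extChartAt_symm (x : N) (f : C^∞⟮I, N; ℝ⟯) :
    ContDiffOn ℝ ∞ (f ∘ (extChartAt I x).symm) (extChartAt I x).target :=
  (f.contMDiff.comp_contMDiffOn (contMDiffOn_extChartAt_symm x)).contDiffOn

theorem mvfderiv_eq_fderiv_comp {x z : N} (hz : z ∈ (chartAt H x).source) (f : C^∞⟮I, N; ℝ⟯)
    (v : TangentSpace I z) :
    mvfderiv I f z v = fderiv ℝ (f ∘ (extChartAt I x).symm) (extChartAt I x z)
      (mfderiv I 𝓘(ℝ, E) (extChartAt I x) z v) := by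
  have hz' : z ∈ (extChartAt I x).source := by rwa [extChartAt_source]
  have h1 : f =ᶠ[𝓝 z] (f ∘ (extChartAt I x).symm) ∘ extChartAt I x := by
    filter_upwards [(isOpen_extChartAt_source x).mem_nhds hz'] with w hw
    exact congrArg f ((extChartAt I x).left_inv hw).symm
  have h2 : MDifferentiableAt 𝓘(ℝ, E) 𝓘(ℝ, ℝ) (f ∘ (extChartAt I x).symm) (extChartAt I x z) :=
    (((contDiffOn_comp_extChartAt_symm x f).contDiffAt
      ((isOpen_extChartAt_target x).mem_nhds ((extChartAt I x).map_source hz'))).differentiableAt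
        (by simp)).mdifferentiableAt
  have h3 : MDifferentiableAt I 𝓘(ℝ, E) (extChartAt I x) z :=
    (contMDiffAt_extChartAt' hz).mdifferentiableAt (by simp : (∞ : WithTop ℕ∞) ≠ 0)
  have h4 := mfderiv_comp_apply z h2 h3 v
  rw [← h1.mfderiv_eq] at h4
  rw [mfderiv_eq_fderiv] at h4
  exact h4

theorem mvfderiv_eq_fderiv (x : N) (f : C^∞⟮I, N; ℝ⟯) :
    mvfderiv I f x = fderiv ℝ (f ∘ (extChartAt I x).symm) (extChartAt I x x) := by
  rw [f.mdifferentiableAt.mvfderiv, I.range_eq_univ, fderivWithin_univ]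
  rfl

theorem mvfderiv_congr {f g : N → ℝ} {x : N} (h : f =ᶠ[𝓝 x] g) :
    mvfderiv I f x = mvfderiv I g x := by
  ext v
  exact congrArg (fun L : TangentSpace I x →L[ℝ] ℝ => L v) h.mfderiv_eq

theorem mvfderiv_of_eventuallyEq_comp_extChartAt {x : N} (f : C^∞⟮I, N; ℝ⟯) {g : E → ℝ}
    (h : f =ᶠ[𝓝 x] fun z => g (extChartAt I x z)) :
    mvfderiv I f x = fderiv ℝ g (extChartAt I x x) := by
  rw [mvfderiv_eq_fderiv]
  refine Filter.EventuallyEq.fderiv_eq ?_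
  have h1 : Tendsto (extChartAt I x).symm (𝓝 (extChartAt I x x)) (𝓝 x) := by
    have := continuousAt_extChartAt_symm (I := I) x
    rwa [ContinuousAt, (extChartAt I x).left_inv (mem_extChartAt_source x)] at this
  filter_upwards [h1.eventually h, extChartAt_target_mem_nhds (I := I) x] with y hy hy'
  simp only [Function.comp_apply, hy, (extChartAt I x).right_inv hy']

theorem exists_mvfderiv_eq [T2Space N] (x : N) (α : TangentSpace I x →L[ℝ] ℝ) :
    ∃ f : C^∞⟮I, N; ℝ⟯, mvfderiv I f x = α := by
  obtain ⟨f, hf⟩ := exists_smooth_eventuallyEq_comp_extChartAt (I := I) x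
    (g := fun y => (show E →L[ℝ] ℝ from α) y) (ContinuousLinearMap.contDiff _)
  refine ⟨f, ?_⟩
  rw [mvfderiv_of_eventuallyEq_comp_extChartAt f hf]
  exact ContinuousLinearMap.fderiv _

end SmoothFunctions

section Hadamard

variable {E : Type*} [NormedAddCommGroup E] [NormedSpace ℝ E] [FiniteDimensional ℝ E]

open Filter Topology MeasureTheory

theorem contDiff_integral_comp_smul {G : Type*} [NormedAddCommGroup G] [NormedSpace ℝ G]
    [CompleteSpace G] {g : E → G} (hg : ContDiff ℝ ∞ g) :
    ContDiff ℝ ∞ (fun y => ∫ t in (0 : ℝ)..1, g (t • y)) := by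
  obtain ⟨θ, hθ, hθc⟩ : ∃ θ : ContDiffBump (0 : ℝ), θ.rIn = 2 ∧ θ.rOut = 3 :=
    ⟨⟨2, 3, by norm_num, by norm_num⟩, rfl, rfl⟩
  let k : E → ℝ → G := fun p s => θ s • g ((-s) • p)
  have hk : ContDiff ℝ ∞ (Function.uncurry k) := by
    refine (θ.contDiff.comp contDiff_snd).smul (hg.comp ?_)
    exact contDiff_snd.neg.smul contDiff_fst
  have hf : LocallyIntegrable (indicator (Ioc (0 : ℝ) 1) (fun _ => (1 : ℝ))) volume :=
    (IntegrableOn.integrable_indicator (by simp) measurableSet_Ioc).locallyIntegrable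
  have h := contDiffOn_convolution_right_with_param (n := ⊤) (ContinuousLinearMap.lsmul ℝ ℝ) (g := k)
    (s := univ) (k := Metric.closedBall (0 : ℝ) 3) (f := indicator (Ioc (0 : ℝ) 1) (fun _ => (1 : ℝ)))
    (μ := volume)
    isOpen_univ (isCompact_closedBall 0 3) (fun p x _ hx => by
      have : θ x = 0 := by
        refine θ.zero_of_le_dist ?_
        rw [hθc]
        exact (not_le.1 (mt Metric.mem_closedBall.2 hx)).le
      simp [k, this]) hf (hk.contDiffOn)
  rw [univ_prod_univ, contDiffOn_univ] at h
  have h' := h.comp (contDiff_id.prodMk contDiff_const : ContDiff ℝ ∞ fun p : E => (p, (0 : ℝ)))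
  refine (congrArg (ContDiff ℝ ∞) (funext fun y => ?_)).mpr h'
  rw [intervalIntegral.integral_of_le zero_le_one, ← integral_indicator measurableSet_Ioc]
  show _ = convolution _ _ _ _ _
  unfold convolution
  refine integral_congr_ae (Eventually.of_forall fun t => ?_)
  by_cases ht : t ∈ Ioc (0 : ℝ) 1
  · have : θ (0 - t) = 1 := by
      refine θ.one_of_mem_closedBall ?_
      rw [hθ, mem_closedBall_zero_iff, zero_sub, norm_neg, Real.norm_eq_abs, abs_of_pos ht.1]
      linarith [ht.2]
    simp only [ht, indicator_of_mem, k, this, id]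
    simp
  · simp only [ht, indicator_of_notMem, not_false_iff, id]
    simp

theorem exists_hadamard {g : E → ℝ} (hg : ContDiff ℝ ∞ g) (p : E) (h0 : fderiv ℝ g p = 0) :
    ∃ B : E → (E →L[ℝ] ℝ), ContDiff ℝ ∞ B ∧ B p = 0 ∧ ∀ y, g y = g p + B y (y - p) := by
  have hd : ContDiff ℝ ∞ (fun y => fderiv ℝ g (p + y)) :=
    (hg.fderiv_right (by simp)).comp (contDiff_const.add contDiff_id)
  refine ⟨fun y => ∫ t in (0 : ℝ)..1, fderiv ℝ g (p + t • (y - p)), ?_, ?_, fun y => ?_⟩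
  · exact (contDiff_integral_comp_smul hd).comp (contDiff_id.sub contDiff_const)
  · simp [h0]
  · have hline : ∀ t : ℝ, HasDerivAt (fun t : ℝ => g (p + t • (y - p)))
        (fderiv ℝ g (p + t • (y - p)) (y - p)) t := by
      intro t
      have h1 : HasDerivAt (fun t : ℝ => p + t • (y - p)) (y - p) t := by
        simpa using ((hasDerivAt_id t).smul_const (y - p)).const_add p
      exact ((hg.differentiable (by simp)) _).hasFDerivAt.comp_hasDerivAt t h1
    have hc : Continuous fun t : ℝ => fderiv ℝ g (p + t • (y - p)) :=
      hd.continuous.comp (by fun_prop)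
    have h2 := intervalIntegral.integral_eq_sub_of_hasDerivAt (a := 0) (b := 1)
      (fun t _ => hline t) ((hc.clm_apply continuous_const).intervalIntegrable _ _)
    have h3 := ContinuousLinearMap.intervalIntegral_comp_comm (ContinuousLinearMap.apply ℝ ℝ (y - p))
      (hc.intervalIntegrable (μ := volume) 0 1)
    simp only [ContinuousLinearMap.apply_apply] at h3
    rw [h3] at h2
    simp only [one_smul, zero_smul, add_zero, add_sub_cancel] at h2
    rw [h2]; ring

end Hadamard

section VectorFields

variable {E : Type*} [NormedAddCommGroup E] [NormedSpace ℝ E] [FiniteDimensional ℝ E]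
  {H : Type*} [TopologicalSpace H] {I : ModelWithCorners ℝ E H}
  {N : Type*} [TopologicalSpace N] [ChartedSpace H N] [IsManifold I ∞ N]

open Filter Topology

section Mvfderiv

variable (f g : C^∞⟮I, N; ℝ⟯) (x : N)

theorem mvfderiv_smooth_add : mvfderiv I (f + g : C^∞⟮I, N; ℝ⟯) x = mvfderiv I f x + mvfderiv I g x := by
  rw [ContMDiffMap.coe_add, mvfderiv_add f.mdifferentiableAt g.mdifferentiableAt]

theorem mvfderiv_smooth_sub : mvfderiv I (f - g : C^∞⟮I, N; ℝ⟯) x = mvfderiv I f x - mvfderiv I g x := by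
  rw [ContMDiffMap.coe_sub, mvfderiv_sub f.mdifferentiableAt g.mdifferentiableAt]

theorem mvfderiv_smooth_mul :
    mvfderiv I (f * g : C^∞⟮I, N; ℝ⟯) x = f x • mvfderiv I g x + g x • mvfderiv I f x := by
  rw [ContMDiffMap.coe_mul, mvfderiv_mul f.mdifferentiableAt g.mdifferentiableAt]

theorem mvfderiv_smooth_one : mvfderiv I (1 : C^∞⟮I, N; ℝ⟯) x = 0 := mvfderiv_const (1 : ℝ)

theorem mvfderiv_smooth_smul (c : ℝ) :
    mvfderiv I (c • f : C^∞⟮I, N; ℝ⟯) x = c • mvfderiv I f x := by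
  have h : (c • f : C^∞⟮I, N; ℝ⟯) = (c • (1 : C^∞⟮I, N; ℝ⟯)) * f := by simp
  have h1 : mvfderiv I (c • (1 : C^∞⟮I, N; ℝ⟯) : C^∞⟮I, N; ℝ⟯) x = 0 := mvfderiv_const (c • 1 : ℝ)
  rw [h, mvfderiv_smooth_mul, h1, smul_zero, add_zero]
  congr 1
  show c • (1 : ℝ) = c
  simp

/-- The differential at a point, as a linear map on smooth functions. -/
noncomputable def smoothDifferential : C^∞⟮I, N; ℝ⟯ →ₗ[ℝ] (TangentSpace I x →L[ℝ] ℝ) where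
  toFun f := mvfderiv I f x
  map_add' f g := mvfderiv_smooth_add f g x
  map_smul' c f := mvfderiv_smooth_smul f x c

theorem smoothDifferential_apply : smoothDifferential x f = mvfderiv I f x := rfl

end Mvfderiv

section PointDerivation

variable [T2Space N] {x : N} (D : C^∞⟮I, N; ℝ⟯ →ₗ[ℝ] ℝ) (hD : ∀ f g, D (f * g) = f x * D g + g x * D f)
include hD

theorem pointDerivation_eq_zero_of_eventuallyEq_zero {f : C^∞⟮I, N; ℝ⟯} (hf : f =ᶠ[𝓝 x] fun _ => (0 : ℝ)) :
    D f = 0 := by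
  obtain ⟨χ, h1, h2⟩ := exists_smooth_eventuallyEq_one (I := I) x hf
  have h3 : f = f - χ * f := by
    ext z
    show f z = f z - χ z * f z
    by_cases hz : χ z = 0
    · simp [hz]
    · have : f z = 0 := h2 (subset_tsupport _ hz)
      simp [this]
  have h4 := h1.self_of_nhds
  have h5 := hf.self_of_nhds
  have h6 : D f = D f - D (χ * f) := by rw [← map_sub, ← h3]
  rw [hD, h4, h5] at h6
  linarith

theorem pointDerivation_congr {f g : C^∞⟮I, N; ℝ⟯} (hf : f =ᶠ[𝓝 x] g) : D f = D g := by
  rw [← sub_eq_zero, ← map_sub]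
  refine pointDerivation_eq_zero_of_eventuallyEq_zero D hD ?_
  filter_upwards [hf] with z hz
  show f z - g z = 0
  rw [hz, sub_self]

variable [I.Boundaryless]

theorem pointDerivation_eq_zero {f : C^∞⟮I, N; ℝ⟯} (hf : mvfderiv I f x = 0) : D f = 0 := by
  have hD1 : D 1 = 0 := by
    have h := hD 1 1
    have h1 : (1 : C^∞⟮I, N; ℝ⟯) x = 1 := rfl
    rw [mul_one, h1] at h
    linarith
  set p := extChartAt I x x with hp
  obtain ⟨g, hg, hgf⟩ := exists_contDiff_eventuallyEq (isOpen_extChartAt_target (I := I) x)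
    (contDiffOn_comp_extChartAt_symm x f) (mem_extChartAt_target x)
  have hg0 : fderiv ℝ g p = 0 := by
    rw [hgf.fderiv_eq, ← mvfderiv_eq_fderiv, hf]; rfl
  obtain ⟨B, hB, hBp, hBg⟩ := exists_hadamard hg p hg0
  let bs := Module.finBasis ℝ E
  let l : Fin (Module.finrank ℝ E) → E →L[ℝ] ℝ := fun i => LinearMap.toContinuousLinearMap (bs.coord i)
  have ha : ∀ i, ∃ a : C^∞⟮I, N; ℝ⟯, a =ᶠ[𝓝 x] fun z => l i (extChartAt I x z - p) := fun i =>
    exists_smooth_eventuallyEq_comp_extChartAt (I := I) x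
      ((l i).contDiff.comp (contDiff_id.sub contDiff_const))
  have hc : ∀ i, ∃ c : C^∞⟮I, N; ℝ⟯, c =ᶠ[𝓝 x] fun z => B (extChartAt I x z) (bs i) := fun i =>
    exists_smooth_eventuallyEq_comp_extChartAt (I := I) x (hB.clm_apply contDiff_const)
  choose a ha using ha
  choose c hc using hc
  have key : f =ᶠ[𝓝 x] (f x • (1 : C^∞⟮I, N; ℝ⟯) + ∑ i, a i * c i : C^∞⟮I, N; ℝ⟯) := by
    have e1 := (continuousAt_extChartAt (I := I) x).eventually hgf
    filter_upwards [e1, Filter.eventually_all.2 ha, Filter.eventually_all.2 hc,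
      extChartAt_source_mem_nhds (I := I) x] with z h1 h2 h3 h4
    have e2 : f z = g (extChartAt I x z) := by
      rw [h1, Function.comp_apply, (extChartAt I x).left_inv h4]
    have e3 : g p = f x := by
      rw [hgf.self_of_nhds, Function.comp_apply, (extChartAt I x).left_inv (mem_extChartAt_source x)]
    have e4 : ((f x • (1 : C^∞⟮I, N; ℝ⟯) + ∑ i, a i * c i : C^∞⟮I, N; ℝ⟯)) z
        = f x + ∑ i, a i z * c i z := by
      have e5 : (∑ i, a i * c i : C^∞⟮I, N; ℝ⟯) z = ∑ i, a i z * c i z := by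
        have := map_sum (ContMDiffMap.coeFnAddMonoidHom (I := I) (I' := 𝓘(ℝ, ℝ)) (n := ∞) (N := N) (G := ℝ))
          (fun i => a i * c i) Finset.univ
        have h := congrFun this z
        rw [Finset.sum_apply] at h
        exact h
      show f x • (1 : ℝ) + _ = _
      rw [e5]; simp
    rw [e2, hBg, e3, e4]
    congr 1
    have e6 := congrArg (B (extChartAt I x z)) (bs.sum_repr (extChartAt I x z - p))
    rw [map_sum] at e6
    rw [← e6]
    refine Finset.sum_congr rfl fun i _ => ?_
    rw [h2 i, h3 i, map_smul]
    rfl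
  rw [pointDerivation_congr D hD key, map_add, map_smul, hD1, map_sum, smul_zero, zero_add]
  refine Finset.sum_eq_zero fun i _ => ?_
  have h1 : a i x = 0 := by
    refine (ha i).self_of_nhds.trans ?_
    show l i (p - p) = 0
    rw [sub_self, map_zero]
  have h2 : c i x = 0 := by
    refine (hc i).self_of_nhds.trans ?_
    show B p (bs i) = 0
    rw [hBp]; rfl
  rw [hD, h1, h2, zero_mul, zero_mul, add_zero]

theorem pointDerivation_eq {f g : C^∞⟮I, N; ℝ⟯} (h : mvfderiv I f x = mvfderiv I g x) : D f = D g := by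
  rw [← sub_eq_zero, ← map_sub]
  refine pointDerivation_eq_zero D hD ?_
  rw [mvfderiv_smooth_sub, h, sub_self]

end PointDerivation

section Bidual

/-- The vector representing a linear functional on the dual space. -/
noncomputable def bidualVector : ((E →L[ℝ] ℝ) →ₗ[ℝ] ℝ) →ₗ[ℝ] E :=
  (Module.evalEquiv ℝ E).symm.toLinearMap ∘ₗ
    (LinearMap.lcomp ℝ ℝ (LinearMap.toContinuousLinearMap (𝕜 := ℝ) (E := E) (F' := ℝ)).toLinearMap)

theorem apply_bidualVector (L : (E →L[ℝ] ℝ) →ₗ[ℝ] ℝ) (α : E →L[ℝ] ℝ) : α (bidualVector L) = L α := by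
  have h := LinearMap.congr_fun ((Module.evalEquiv ℝ E).apply_symm_apply
    (LinearMap.lcomp ℝ ℝ (LinearMap.toContinuousLinearMap (𝕜 := ℝ) (E := E) (F' := ℝ)).toLinearMap L))
    (α : E →ₗ[ℝ] ℝ)
  exact h

variable {x : N}

/-- The tangent vector representing a linear functional on the cotangent space. -/
noncomputable def tangentOfFunctional :
    ((TangentSpace I x →L[ℝ] ℝ) →ₗ[ℝ] ℝ) →ₗ[ℝ] TangentSpace I x :=
  bidualVector (E := E)

theorem apply_tangentOfFunctional (L : (TangentSpace I x →L[ℝ] ℝ) →ₗ[ℝ] ℝ)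
    (α : TangentSpace I x →L[ℝ] ℝ) : α (tangentOfFunctional L) = L α :=
  apply_bidualVector (E := E) L α

theorem tangent_ext {v w : TangentSpace I x} (h : ∀ α : TangentSpace I x →L[ℝ] ℝ, α v = α w) :
    v = w := by
  have : ∀ v w : E, (∀ α : E →L[ℝ] ℝ, α v = α w) → v = w := fun v w h =>
    (Module.finBasis ℝ E).ext_elem fun i => h (LinearMap.toContinuousLinearMap ((Module.finBasis ℝ E).coord i))
  exact this v w h

end Bidual

variable [T2Space N] [I.Boundaryless]

theorem exists_mvfderiv_frame (𝒮 : Set C^∞⟮I, N; ℝ⟯) (x : N)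
    (h𝒮 : ∀ α : TangentSpace I x →L[ℝ] ℝ, ∃ a ∈ 𝒮, mvfderiv I a x = α) :
    ∃ a : Fin (Module.finrank ℝ E) → C^∞⟮I, N; ℝ⟯, (∀ i, a i ∈ 𝒮) ∧
      ∀ f : C^∞⟮I, N; ℝ⟯, ∃ c : Fin (Module.finrank ℝ E) → N → ℝ,
        (∀ i, ContMDiffAt I 𝓘(ℝ, ℝ) ∞ (c i) x) ∧
        ∀ᶠ z in 𝓝 x, mvfderiv I f z = ∑ i, c i z • mvfderiv I (a i) z := by
  set d := Module.finrank ℝ E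
  let e : E ≃L[ℝ] (Fin d → ℝ) :=
    ContinuousLinearEquiv.ofFinrankEq (Module.finrank_fin_fun ℝ).symm
  have h1 : ∀ i : Fin d, ∃ a ∈ 𝒮,
      mvfderiv I a x = ((ContinuousLinearMap.proj i).comp (e : E →L[ℝ] (Fin d → ℝ)) : E →L[ℝ] ℝ) :=
    fun i => h𝒮 _
  choose a ha hae using h1
  refine ⟨a, ha, fun f => ?_⟩
  set p := extChartAt I x x with hp
  let φ : C^∞⟮I, N; ℝ⟯ → E → (E →L[ℝ] ℝ) := fun f y => fderiv ℝ (f ∘ (extChartAt I x).symm) y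
  have hφ : ∀ f, ContDiffAt ℝ ∞ (φ f) p := fun f =>
    ((contDiffOn_comp_extChartAt_symm x f).contDiffAt
      (extChartAt_target_mem_nhds (I := I) x)).fderiv_right (by simp)
  let Φ : E → (E →L[ℝ] (Fin d → ℝ)) := fun y => ContinuousLinearMap.pi fun i => φ (a i) y
  have hΦ : ContDiffAt ℝ ∞ Φ p := by
    have : ContDiffAt ℝ ∞ (fun y => fun i => φ (a i) y) p := contDiffAt_pi.2 fun i => hφ (a i)
    have h3 := (ContinuousLinearMap.piEquivL ℝ E (fun _ : Fin d => ℝ)).contDiff.contDiffAt.comp p this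
    exact h3
  have hΦp : Φ p = (e : E →L[ℝ] (Fin d → ℝ)) := by
    ext v i
    have := congrArg (fun L : TangentSpace I x →L[ℝ] ℝ => L v) (hae i)
    simp only [mvfderiv_eq_fderiv] at this
    exact this
  have hinv : ContDiffAt ℝ ∞ (fun y => ContinuousLinearMap.inverse (Φ y)) p := by
    have h2 := contDiffAt_map_inverse (𝕜 := ℝ) (n := ∞) e
    rw [← hΦp] at h2
    exact h2.comp p hΦ
  refine ⟨fun i z => φ f (extChartAt I x z)
    (ContinuousLinearMap.inverse (Φ (extChartAt I x z)) (Pi.single i 1)), fun i => ?_, ?_⟩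
  · have h3 : ContDiffAt ℝ ∞ (fun y => φ f y (ContinuousLinearMap.inverse (Φ y) (Pi.single i 1))) p :=
      (hφ f).clm_apply (hinv.clm_apply contDiffAt_const)
    exact h3.contMDiffAt.comp x (contMDiffAt_extChartAt (I := I))
  · have h4 : ∀ᶠ y in 𝓝 p, Φ y ∈ range ((↑) : (E ≃L[ℝ] (Fin d → ℝ)) → E →L[ℝ] (Fin d → ℝ)) := by
      refine hΦ.continuousAt.eventually ?_
      rw [hΦp]
      exact ContinuousLinearEquiv.nhds e
    filter_upwards [(continuousAt_extChartAt (I := I) x).eventually h4,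
      (chartAt H x).open_source.mem_nhds (mem_chart_source H x)] with z h5 hz
    obtain ⟨e', he'⟩ := h5
    ext v
    rw [sum_apply, mvfderiv_eq_fderiv_comp hz]
    set w : E := mfderiv I 𝓘(ℝ, E) (extChartAt I x) z v with hw
    have h6 : w = ContinuousLinearMap.inverse (Φ (extChartAt I x z)) (Φ (extChartAt I x z) w) := by
      rw [← he', ContinuousLinearMap.inverse_equiv]
      simp
    have h7 : Φ (extChartAt I x z) w = ∑ i, (mvfderiv I (a i) z v) • (Pi.single i 1 : Fin d → ℝ) := by
      rw [← pi_eq_sum_univ' ]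
      ext i
      exact (mvfderiv_eq_fderiv_comp hz (a i) v).symm
    show φ f (extChartAt I x z) w = _
    conv_lhs => rw [h6, h7, map_sum, map_sum]
    refine Finset.sum_congr rfl fun i _ => ?_
    rw [map_smul, map_smul, smul_eq_mul, mul_comm]
    rfl

theorem contMDiff_vectorField_of_forall (X : ∀ z : N, TangentSpace I z)
    (hX : ∀ f : C^∞⟮I, N; ℝ⟯, ContMDiff I 𝓘(ℝ, ℝ) ∞ fun z => mvfderiv I f z (X z)) :
    ContMDiff I I.tangent ∞ fun z => (⟨z, X z⟩ : TangentBundle I N) := by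
  intro x
  refine (contMDiffAt_section (F := E) (E := (TangentSpace I : N → Type _)) (s := X) x).2 ?_
  obtain ⟨U, hU, hxU, hUs, h⟩ := exists_smooth_eqOn_comp_extChartAt (I := I) x
  set d := Module.finrank ℝ E
  let e : E ≃L[ℝ] (Fin d → ℝ) :=
    ContinuousLinearEquiv.ofFinrankEq (Module.finrank_fin_fun ℝ).symm
  let l : Fin d → E →L[ℝ] ℝ := fun i => (ContinuousLinearMap.proj i).comp (e : E →L[ℝ] (Fin d → ℝ))
  have h1 := fun i => h (l i) (l i).contDiff
  choose f hf using h1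
  have h2 : ContMDiffAt I 𝓘(ℝ, Fin d → ℝ) ∞ (fun z => fun i => mvfderiv I (f i) z (X z)) x :=
    contMDiffAt_pi_space.2 fun i => (hX (f i)).contMDiffAt
  have h3 := e.symm.contDiff.contMDiff.contMDiffAt.comp (n := ∞) x h2
  refine h3.congr_of_eventuallyEq ?_
  filter_upwards [hU.mem_nhds hxU] with z hz
  have hzs := hUs hz
  have h4 : (trivializationAt E (TangentSpace I) x ⟨z, X z⟩).2
      = mfderiv I 𝓘(ℝ, E) (extChartAt I x) z (X z) := by
    have : z ∈ (trivializationAt E (TangentSpace I : N → Type _) x).baseSet := by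
      rwa [TangentBundle.trivializationAt_baseSet]
    have h : (trivializationAt E (TangentSpace I) x ⟨z, X z⟩).2
        = (trivializationAt E (TangentSpace I) x).continuousLinearMapAt ℝ z (X z) := by
      rw [Trivialization.continuousLinearMapAt_apply, Trivialization.coe_linearMapAt_of_mem _ this]
    exact h.trans (congrArg (fun L : TangentSpace I z →L[ℝ] E => L (X z))
      (TangentBundle.continuousLinearMapAt_trivializationAt hzs))
  rw [h4]
  refine (e.symm_apply_eq.2 ?_).symm
  ext i
  have h5 : (f i ∘ (extChartAt I x).symm) =ᶠ[𝓝 (extChartAt I x z)] l i := by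
    have hz' : z ∈ (extChartAt I x).source := by rwa [extChartAt_source]
    have hc : Tendsto (extChartAt I x).symm (𝓝 (extChartAt I x z)) (𝓝 z) := by
      have := continuousAt_extChartAt_symm'' (I := I) ((extChartAt I x).map_source hz')
      rwa [ContinuousAt, (extChartAt I x).left_inv hz'] at this
    filter_upwards [hc.eventually (hU.mem_nhds hz), (isOpen_extChartAt_target x).mem_nhds
      ((extChartAt I x).map_source hz')] with y hy hy'
    rw [Function.comp_apply, hf i _ hy, (extChartAt I x).right_inv hy']
  have h6 := mvfderiv_eq_fderiv_comp hzs (f i) (X z)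
  rw [h5.fderiv_eq, ContinuousLinearMap.fderiv] at h6
  exact h6

theorem contMDiff_vectorField (𝒮 : Set C^∞⟮I, N; ℝ⟯)
    (h𝒮 : ∀ x, ∀ α : TangentSpace I x →L[ℝ] ℝ, ∃ a ∈ 𝒮, mvfderiv I a x = α)
    (X : ∀ z : N, TangentSpace I z)
    (hX : ∀ f ∈ 𝒮, ContMDiff I 𝓘(ℝ, ℝ) ∞ fun z => mvfderiv I f z (X z)) :
    ContMDiff I I.tangent ∞ fun z => (⟨z, X z⟩ : TangentBundle I N) := by
  refine contMDiff_vectorField_of_forall X fun f x => ?_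
  obtain ⟨a, ha, h⟩ := exists_mvfderiv_frame 𝒮 x (h𝒮 x)
  obtain ⟨c, hc, hfc⟩ := h f
  have h1 : ContMDiffAt I 𝓘(ℝ, ℝ) ∞ (fun z => ∑ i, c i z • mvfderiv I (a i) z (X z)) x :=
    ContMDiffAt.sum fun i _ => (hc i).smul (hX _ (ha i)).contMDiffAt
  refine h1.congr_of_eventuallyEq ?_
  filter_upwards [hfc] with z hz
  rw [hz, sum_apply]
  rfl

theorem contMDiff_bilinear_mvfderiv (𝒮 : Set C^∞⟮I, N; ℝ⟯)
    (h𝒮 : ∀ x, ∀ α : TangentSpace I x →L[ℝ] ℝ, ∃ a ∈ 𝒮, mvfderiv I a x = α)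
    (Λ : ∀ x : N, LinearMap.BilinForm ℝ (TangentSpace I x →L[ℝ] ℝ))
    (hΛ : ∀ f ∈ 𝒮, ∀ g ∈ 𝒮, ContMDiff I 𝓘(ℝ, ℝ) ∞ fun z => Λ z (mvfderiv I f z) (mvfderiv I g z))
    (f g : C^∞⟮I, N; ℝ⟯) :
    ContMDiff I 𝓘(ℝ, ℝ) ∞ fun z => Λ z (mvfderiv I f z) (mvfderiv I g z) := by
  intro x
  obtain ⟨a, ha, h⟩ := exists_mvfderiv_frame 𝒮 x (h𝒮 x)
  obtain ⟨c, hc, hfc⟩ := h f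
  obtain ⟨c', hc', hgc⟩ := h g
  have h1 : ContMDiffAt I 𝓘(ℝ, ℝ) ∞ (fun z => ∑ i, c i z • ∑ j, c' j z •
      Λ z (mvfderiv I (a i) z) (mvfderiv I (a j) z)) x :=
    ContMDiffAt.sum fun i _ => (hc i).smul (ContMDiffAt.sum fun j _ =>
      (hc' j).smul (hΛ _ (ha i) _ (ha j)).contMDiffAt)
  refine h1.congr_of_eventuallyEq ?_
  filter_upwards [hfc, hgc] with z hz hz'
  simp only [hz, hz', map_sum, map_smul, LinearMap.sum_apply, LinearMap.smul_apply, Finset.smul_sum]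
  rw [Finset.sum_comm]
  exact Finset.sum_congr rfl fun i _ => Finset.sum_congr rfl fun j _ => smul_comm _ _ _

end VectorFields

section Gluing

variable {E : Type*} [NormedAddCommGroup E] [NormedSpace ℝ E] [FiniteDimensional ℝ E]

open Filter Topology

theorem exists_bound_iteratedFDeriv_of_hasCompactSupport {f : E → ℝ} (hf : ContDiff ℝ ∞ f)
    (hc : HasCompactSupport f) (n : ℕ) :
    ∃ C : ℝ, 0 < C ∧ ∀ k ≤ n, ∀ x, ‖iteratedFDeriv ℝ k f x‖ ≤ C := by
  have h : ∀ k, ∃ C : ℝ, ∀ x, ‖iteratedFDeriv ℝ k f x‖ ≤ C := fun k =>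
    (hc.iteratedFDeriv k).exists_bound_of_continuous
      (hf.continuous_iteratedFDeriv (by exact_mod_cast le_top))
  choose C hC using h
  refine ⟨1 + ∑ k ∈ Finset.range (n + 1), |C k|, by positivity, fun k hk x => ?_⟩
  have := Finset.single_le_sum (f := fun k => |C k|) (fun i _ => abs_nonneg _)
    (Finset.mem_range.2 (Nat.lt_succ_of_le hk))
  linarith [hC k x, le_abs_self (C k)]

theorem exists_smul_iteratedFDeriv_le {f : E → ℝ} (hf : ContDiff ℝ ∞ f)
    (hc : HasCompactSupport f) (n : ℕ) {δ : ℝ} (hδ : 0 < δ) :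
    ∃ c : ℝ, 0 < c ∧ ∀ k ≤ n, ∀ x, ‖iteratedFDeriv ℝ k (fun y => c * f y) x‖ ≤ δ := by
  obtain ⟨C, hC, h⟩ := exists_bound_iteratedFDeriv_of_hasCompactSupport hf hc n
  refine ⟨δ / C, by positivity, fun k hk x => ?_⟩
  have h1 : iteratedFDeriv ℝ k (fun y => (δ / C) * f y) x = (δ / C) • iteratedFDeriv ℝ k f x :=
    iteratedFDeriv_const_smul_apply (a := δ / C)
      ((hf.of_le (by exact_mod_cast le_top)).contDiffAt)
  rw [h1, norm_smul, Real.norm_of_nonneg (by positivity)]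
  calc δ / C * _ ≤ δ / C * C := by gcongr; exact h k hk x
    _ = δ := by field_simp

/-- A flat function times a smooth function can be cut off so as to have small derivatives. -/
theorem exists_small_eq_mul_pow {θ u : E → ℝ} (hθ : ContDiff ℝ ∞ θ) (hc : HasCompactSupport θ)
    (hu : ContDiff ℝ ∞ u) (n : ℕ) {δ : ℝ} (hδ : 0 < δ) :
    ∃ g : E → ℝ, ContDiff ℝ ∞ g ∧ (∀ x, θ x = 0 → g x = 0) ∧
      (∀ x, u x = 0 → g =ᶠ[𝓝 x] fun y => θ y * u y ^ (n + 1)) ∧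
      ∀ k ≤ n, ∀ x, ‖iteratedFDeriv ℝ k g x‖ ≤ δ := by
  let χ : ContDiffBump (0 : ℝ) := ⟨1, 2, by norm_num, by norm_num⟩
  let ψ : ℝ → ℝ := fun t => χ t * t ^ (n + 1)
  have hψ : ContDiff ℝ ∞ ψ := χ.contDiff.mul (contDiff_id.pow _)
  have hψc : HasCompactSupport ψ := χ.hasCompactSupport.mul_right
  obtain ⟨Cψ, hCψ, hbψ⟩ := exists_bound_iteratedFDeriv_of_hasCompactSupport hψ hψc n
  obtain ⟨Cθ, hCθ, hbθ⟩ := exists_bound_iteratedFDeriv_of_hasCompactSupport hθ hc n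
  obtain ⟨D, hD1, hbD⟩ : ∃ D : ℝ, 1 ≤ D ∧ ∀ i ≤ n, ∀ x ∈ tsupport θ, ‖iteratedFDeriv ℝ i u x‖ ≤ D := by
    have h : ∀ k, ∃ C : ℝ, ∀ x ∈ tsupport θ, ‖iteratedFDeriv ℝ k u x‖ ≤ C := fun k =>
      hc.isCompact.exists_bound_of_continuousOn
        (hu.continuous_iteratedFDeriv (m := k) (by exact_mod_cast le_top)).continuousOn
    choose C hC using h
    refine ⟨1 + ∑ k ∈ Finset.range (n + 1), |C k|, by
      have : (0 : ℝ) ≤ ∑ k ∈ Finset.range (n + 1), |C k| := Finset.sum_nonneg fun _ _ => abs_nonneg _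
      linarith, fun k hk x hx => ?_⟩
    have := Finset.single_le_sum (f := fun k => |C k|) (fun i _ => abs_nonneg _)
      (Finset.mem_range.2 (Nat.lt_succ_of_le hk))
    linarith [hC k x hx, le_abs_self (C k)]
  let K : ℝ := 2 ^ n * (Cθ * (n.factorial * Cψ * D ^ n))
  have hK : 0 < K := by positivity
  let ε : ℝ := min 1 (δ / K)
  have hε : 0 < ε := lt_min one_pos (by positivity)
  have hε1 : ε ≤ 1 := min_le_left _ _
  let w : ℝ → ℝ := fun t => ε ^ (n + 1) * ψ (ε⁻¹ * t)
  have hw : ContDiff ℝ ∞ w := contDiff_const.mul (hψ.comp (contDiff_const.mul contDiff_id))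
  have hbw : ∀ j ≤ n, ∀ t, ‖iteratedFDeriv ℝ j w t‖ ≤ ε * Cψ := by
    intro j hj t
    have hψj : ContDiff ℝ j ψ := hψ.of_le (by exact_mod_cast le_top)
    have h1 : iteratedDeriv j w t = ε ^ (n + 1) * (ε⁻¹ ^ j * iteratedDeriv j ψ (ε⁻¹ * t)) := by
      have e1 : iteratedDeriv j w t = ε ^ (n + 1) * iteratedDeriv j (fun t => ψ (ε⁻¹ * t)) t :=
        iteratedDeriv_const_mul_field _ _
      rw [e1, iteratedDeriv_comp_const_mul hψj]
    rw [norm_iteratedFDeriv_eq_norm_iteratedDeriv, h1]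
    have h2 : ‖iteratedDeriv j ψ (ε⁻¹ * t)‖ ≤ Cψ := by
      rw [← norm_iteratedFDeriv_eq_norm_iteratedDeriv]; exact hbψ j hj _
    have h3 : ε ^ (n + 1) * (ε⁻¹ ^ j * iteratedDeriv j ψ (ε⁻¹ * t))
        = ε ^ (n - j) * ε * iteratedDeriv j ψ (ε⁻¹ * t) := by
      have : ε ^ (n + 1) = ε ^ (n - j) * ε * ε ^ j := by
        rw [← pow_succ, ← pow_add]; congr 1; omega
      rw [this, inv_pow]
      field_simp
    rw [h3, norm_mul, Real.norm_of_nonneg (by positivity)]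
    have h4 : ε ^ (n - j) ≤ 1 := pow_le_one₀ hε.le hε1
    calc ε ^ (n - j) * ε * ‖iteratedDeriv j ψ (ε⁻¹ * t)‖ ≤ 1 * ε * Cψ := by gcongr
      _ = ε * Cψ := by ring
  refine ⟨fun x => θ x * w (u x), hθ.mul (hw.comp hu), fun x hx => by simp [hx], fun x hx => ?_,
    fun k hk x => ?_⟩
  · have h1 : ∀ᶠ y in 𝓝 x, |u y| < ε := by
      have : Tendsto (fun y => |u y|) (𝓝 x) (𝓝 |u x|) := hu.continuous.abs.tendsto x
      rw [hx, abs_zero] at this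
      exact this.eventually (gt_mem_nhds hε)
    filter_upwards [h1] with y hy
    have h2 : χ (ε⁻¹ * u y) = 1 := by
      refine χ.one_of_mem_closedBall ?_
      rw [mem_closedBall_zero_iff, norm_mul, Real.norm_of_nonneg (by positivity), Real.norm_eq_abs,
        inv_mul_le_iff₀ hε]
      show _ ≤ ε * 1
      linarith
    simp only [w, ψ, h2, one_mul]
    rw [mul_pow, inv_pow]
    field_simp
  · by_cases hx : x ∈ tsupport θ
    · have hcomp : ∀ j ≤ n, ‖iteratedFDeriv ℝ j (fun y => w (u y)) x‖ ≤ ε * (n.factorial * Cψ * D ^ n) := by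
        intro j hj
        have h := norm_iteratedFDeriv_comp_le (n := j) (N := ∞) hw hu (by exact_mod_cast le_top) x
          (C := ε * Cψ) (D := D)
          (fun i hi => hbw i (hi.trans hj) _) (fun i hi1 hi => (hbD i (hi.trans hj) x hx).trans
            (le_self_pow₀ hD1 (by omega)))
        refine h.trans ?_
        have e1 : (j.factorial : ℝ) ≤ n.factorial := by exact_mod_cast Nat.factorial_le hj
        have e2 : D ^ j ≤ D ^ n := pow_le_pow_right₀ hD1 hj
        calc (j.factorial : ℝ) * (ε * Cψ) * D ^ j ≤ n.factorial * (ε * Cψ) * D ^ n := by gcongr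
          _ = _ := by ring
      have h := norm_iteratedFDeriv_mul_le (N := ∞) hθ (hw.comp hu) x (n := k) (by exact_mod_cast le_top)
      refine h.trans ?_
      calc _ ≤ ∑ i ∈ Finset.range (k + 1), (k.choose i : ℝ) * Cθ * (ε * (n.factorial * Cψ * D ^ n)) := by
            refine Finset.sum_le_sum fun i hi => ?_
            have hi' : i ≤ k := Nat.lt_succ_iff.1 (Finset.mem_range.1 hi)
            gcongr
            · exact hbθ i (hi'.trans hk) x
            · exact hcomp (k - i) ((Nat.sub_le _ _).trans hk)
        _ = 2 ^ k * (Cθ * (n.factorial * Cψ * D ^ n)) * ε := by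
            rw [← Finset.sum_mul, ← Finset.sum_mul]
            have : (∑ i ∈ Finset.range (k + 1), (k.choose i : ℝ)) = 2 ^ k := by
              exact_mod_cast Nat.sum_range_choose k
            rw [this]; ring
        _ ≤ K * ε := by
            have : (2 : ℝ) ^ k ≤ 2 ^ n := pow_le_pow_right₀ (by norm_num) hk
            simp only [K]
            gcongr
        _ ≤ K * (δ / K) := by gcongr; exact min_le_right _ _
        _ = δ := by field_simp
    · have h0 : (fun x => θ x * w (u x)) =ᶠ[𝓝 x] fun _ => (0 : ℝ) := by
        filter_upwards [notMem_tsupport_iff_eventuallyEq.1 hx] with y hy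
        simp [hy]
      rw [h0.iteratedFDeriv ℝ k |>.self_of_nhds]
      simp only [iteratedFDeriv_fun_zero, Pi.zero_apply, norm_zero]
      exact hδ.le

/-- Gluing small functions with supports in disjoint annuli shrinking to `p`. -/
theorem exists_smooth_glue (p : E) (y : ℕ → E) (hy : ∀ j, y j ≠ p)
    (hdist : ∀ j, dist (y (j + 1)) p < dist (y j) p / 2) (g : ℕ → E → ℝ)
    (hg : ∀ j, ContDiff ℝ ∞ (g j)) (hs : ∀ j x, dist (y j) p / 4 ≤ dist x (y j) → g j x = 0)
    (hb : ∀ j, ∀ k ≤ j, ∀ x, ‖iteratedFDeriv ℝ k (g j) x‖ ≤ (1 / 2) ^ j) :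
    ∃ G : E → ℝ, ContDiff ℝ ∞ G ∧ ∀ j, G =ᶠ[𝓝 (y j)] g j := by
  have hlt : ∀ j m, dist (y (j + 1 + m)) p < dist (y j) p / 2 := by
    intro j m
    induction m with
    | zero => exact hdist j
    | succ m ih =>
      have h1 := hdist (j + 1 + m)
      have h2 : 0 ≤ dist (y (j + 1 + m)) p := dist_nonneg
      have : j + 1 + (m + 1) = j + 1 + m + 1 := by ring
      rw [this]
      linarith
  refine ⟨fun x => ∑' j, g j x, ?_, fun j => ?_⟩
  · refine contDiff_tsum_of_eventually (v := fun _ j => (1 / 2 : ℝ) ^ j) (N := ⊤) hg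
      (fun k _ => summable_geometric_two) (fun k _ => ?_)
    rw [Nat.cofinite_eq_atTop]
    filter_upwards [eventually_ge_atTop k] with j hj x
    exact hb j k hj x
  · have hd : 0 < dist (y j) p := dist_pos.2 (hy j)
    filter_upwards [Metric.ball_mem_nhds (y j) (show 0 < dist (y j) p / 4 by positivity)] with x hx
    rw [Metric.mem_ball] at hx
    refine tsum_eq_single j fun i hij => hs i x ?_
    have t1 := dist_triangle (y j) x p
    have t2 := dist_triangle x (y i) p
    have t3 := dist_triangle x (y j) p
    have t4 := dist_triangle (y i) x p
    rw [dist_comm (y j) x] at t1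
    rw [dist_comm (y i) x] at t4
    rcases lt_or_gt_of_ne hij with h | h
    · obtain ⟨m, rfl⟩ : ∃ m, j = i + 1 + m := ⟨j - (i + 1), by omega⟩
      have := hlt i m
      linarith
    · obtain ⟨m, rfl⟩ : ∃ m, i = j + 1 + m := ⟨i - (j + 1), by omega⟩
      have := hlt j m
      linarith

variable (p : E) (y : ℕ → E) (hy : ∀ j, y j ≠ p) (hdist : ∀ j, dist (y (j + 1)) p < dist (y j) p / 2)
include hy hdist

theorem exists_smooth_eventuallyEq_smul (f : ℕ → E → ℝ) (hf : ∀ j, ContDiff ℝ ∞ (f j)) :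
    ∃ F : E → ℝ, ∃ c : ℕ → ℝ, ContDiff ℝ ∞ F ∧ ∀ j, 0 < c j ∧ F =ᶠ[𝓝 (y j)] fun x => c j * f j x := by
  have hd : ∀ j, 0 < dist (y j) p := fun j => dist_pos.2 (hy j)
  let θ : ∀ j, ContDiffBump (y j) := fun j =>
    ⟨dist (y j) p / 8, dist (y j) p / 4, by linarith [hd j], by linarith [hd j]⟩
  have h : ∀ j, ∃ c : ℝ, 0 < c ∧ ∀ k ≤ j, ∀ x,
      ‖iteratedFDeriv ℝ k (fun y => c * (θ j y * f j y)) x‖ ≤ (1 / 2) ^ j := fun j =>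
    exists_smul_iteratedFDeriv_le ((θ j).contDiff.mul (hf j)) ((θ j).hasCompactSupport.mul_right) j
      (by positivity)
  choose c hc hb using h
  obtain ⟨F, hF, hFe⟩ := exists_smooth_glue p y hy hdist (fun j y => c j * (θ j y * f j y))
    (fun j => contDiff_const.mul ((θ j).contDiff.mul (hf j)))
    (fun j x hx => by simp only [(θ j).zero_of_le_dist hx, zero_mul, mul_zero]) hb
  refine ⟨F, c, hF, fun j => ⟨hc j, (hFe j).trans ?_⟩⟩
  filter_upwards [(θ j).eventuallyEq_one] with x hx
  simp [hx]

theorem exists_smooth_eventuallyEq_mul_pow (f u : ℕ → E → ℝ) (hf : ∀ j, ContDiff ℝ ∞ (f j))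
    (hu : ∀ j, ContDiff ℝ ∞ (u j)) (hu0 : ∀ j, u j (y j) = 0) :
    ∃ G : E → ℝ, ContDiff ℝ ∞ G ∧ ∀ j, G =ᶠ[𝓝 (y j)] fun x => f j x * u j x ^ (j + 1) := by
  have hd : ∀ j, 0 < dist (y j) p := fun j => dist_pos.2 (hy j)
  let θ : ∀ j, ContDiffBump (y j) := fun j =>
    ⟨dist (y j) p / 8, dist (y j) p / 4, by linarith [hd j], by linarith [hd j]⟩
  have h := fun j => exists_small_eq_mul_pow ((θ j).contDiff.mul (hf j)) (θ j).hasCompactSupport.mul_right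
    (hu j) j (show (0 : ℝ) < (1 / 2) ^ j by positivity)
  choose g hg hg0 hge hb using h
  obtain ⟨G, hG, hGe⟩ := exists_smooth_glue p y hy hdist g hg
    (fun j x hx => hg0 j x (by simp only [(θ j).zero_of_le_dist hx, zero_mul])) hb
  refine ⟨G, hG, fun j => (hGe j).trans ((hge j _ (hu0 j)).trans ?_)⟩
  filter_upwards [(θ j).eventuallyEq_one] with x hx
  simp [hx]

end Gluing

section LocalBrackets

variable {E : Type*} [NormedAddCommGroup E] [NormedSpace ℝ E] [FiniteDimensional ℝ E]
  {H : Type*} [TopologicalSpace H] {I : ModelWithCorners ℝ E H}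
  {N : Type*} [TopologicalSpace N] [ChartedSpace H N] [IsManifold I ∞ N]

open Filter Topology

theorem mulCommutator_pow_apply_apply (T : Module.End ℝ C^∞⟮I, N; ℝ⟯) (u h : C^∞⟮I, N; ℝ⟯) (x : N) (n : ℕ) :
    ((mulCommutator u ^ n) T) h x = T (h * (u - u x • 1) ^ n) x := by
  induction n generalizing h with
  | zero => simp
  | succ n ih =>
    rw [pow_succ', Module.End.mul_apply, mulCommutator_apply]
    show ((mulCommutator u ^ n) T) (u * h) x - u x * ((mulCommutator u ^ n) T) h x = _
    rw [ih, ih]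
    have : h * (u - u x • 1) ^ (n + 1) = u * h * (u - u x • 1) ^ n - u x • (h * (u - u x • 1) ^ n) := by
      have e : u x • (h * (u - u x • 1) ^ n) = (u x • 1) * (h * (u - u x • 1) ^ n) := by
        rw [smul_mul_assoc, one_mul]
      rw [e]; ring
    rw [this, map_sub, map_smul]
    rfl

variable [T2Space N] [I.Boundaryless]
  (b : C^∞⟮I, N; ℝ⟯ →ₗ[ℝ] C^∞⟮I, N; ℝ⟯ →ₗ[ℝ] C^∞⟮I, N; ℝ⟯)
  (hb : ∀ (x : N) (f g : C^∞⟮I, N; ℝ⟯), (g =ᶠ[𝓝 x] fun _ => (0 : ℝ)) → b f g x = 0)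
  (anti : ∀ f g, b f g = -b g f)

include hb anti in
theorem local_bracket_congr {x : N} {f f' g g' : C^∞⟮I, N; ℝ⟯} (hf : f =ᶠ[𝓝 x] f') (hg : g =ᶠ[𝓝 x] g') :
    b f g x = b f' g' x := by
  have h1 : ∀ f g g' : C^∞⟮I, N; ℝ⟯, g =ᶠ[𝓝 x] g' → b f g x = b f g' x := by
    intro f g g' h
    have h0 := hb x f (g - g') (by
      filter_upwards [h] with z hz
      show g z - g' z = 0
      rw [hz, sub_self])
    rw [map_sub] at h0
    exact sub_eq_zero.1 h0
  rw [h1 f g g' hg, anti f g', anti f' g']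
  show -(b g' f x) = -(b g' f' x)
  rw [h1 g' f f' hf]

include hb anti in
/-- A bilinear version of Peetre's theorem: local bilinear operators are locally of finite order. -/
theorem exists_order_bound (p : N) : ∃ U : Set N, IsOpen U ∧ p ∈ U ∧ ∃ k : ℕ,
    ∀ x ∈ U, ∀ f u h : C^∞⟮I, N; ℝ⟯, ((mulCommutator u ^ (k + 1)) (b f)) h x = 0 := by
  by_contra! hcon
  have h1 : ∀ s ∈ 𝓝 p, ∀ k : ℕ, ∃ x ∈ s, x ≠ p ∧ ∃ f u h : C^∞⟮I, N; ℝ⟯, u x = 0 ∧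
      b f (h * u ^ (k + 1)) x ≠ 0 := by
    intro s hs k
    obtain ⟨U, hUs, hU, hp⟩ := mem_nhds_iff.1 hs
    obtain ⟨x, hx, f, u, h, hne⟩ := hcon U hU hp k
    have key : ∃ z ∈ U, z ≠ p ∧ ((mulCommutator u ^ (k + 1)) (b f)) h z ≠ 0 := by
      by_cases hxp : x = p
      · subst hxp
        have hn : (𝓝[≠] x).NeBot := by
          rw [neBot_iff]
          intro hbot
          have hsing : ({x} : Set N) ∈ 𝓝 x := by
            rw [nhdsWithin, ← mem_iff_inf_principal_compl] at hbot
            exact hbot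
          refine hne ?_
          rw [mulCommutator_pow_apply_apply]
          refine hb x _ _ ?_
          filter_upwards [hsing] with z hz
          rw [mem_singleton_iff.1 hz]
          show h x * (u x - u x * 1) ^ (k + 1) = 0
          simp
        have hc := (((mulCommutator u ^ (k + 1)) (b f)) h).contMDiff.continuous.continuousAt.eventually_ne hne
        have h2 : ∀ᶠ z in 𝓝[≠] x, z ∈ U ∧ ((mulCommutator u ^ (k + 1)) (b f)) h z ≠ 0 :=
          nhdsWithin_le_nhds (Filter.inter_mem (hU.mem_nhds hx) hc)
        obtain ⟨z, hz1, hz2⟩ := (h2.and self_mem_nhdsWithin).exists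
        exact ⟨z, hz1.1, hz2, hz1.2⟩
      · exact ⟨x, hx, hxp, hne⟩
    obtain ⟨z, hz, hzp, hzne⟩ := key
    refine ⟨z, hUs hz, hzp, f, u - u z • 1, h, ?_, ?_⟩
    · show u z - u z * 1 = 0
      simp
    · rwa [← mulCommutator_pow_apply_apply]
  obtain ⟨U, hU, hpU, hUs, hext⟩ := exists_smooth_eqOn_comp_extChartAt (I := I) p
  set φ := extChartAt I p with hφ
  have hφs : ∀ {z}, z ∈ U → z ∈ φ.source := fun {z} hz => by
    rw [hφ, extChartAt_source]; exact hUs hz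
  have h2 : ∀ (k : ℕ) (r : {r : ℝ // 0 < r}), ∃ x ∈ U, x ≠ p ∧ dist (φ x) (φ p) < r ∧
      ∃ f u h : C^∞⟮I, N; ℝ⟯, u x = 0 ∧ b f (h * u ^ (k + 1)) x ≠ 0 := by
    intro k r
    have hs : U ∩ {x | dist (φ x) (φ p) < r} ∈ 𝓝 p := by
      refine inter_mem (hU.mem_nhds hpU) ?_
      exact (continuousAt_extChartAt (I := I) p).eventually (Metric.ball_mem_nhds _ r.2)
    obtain ⟨x, hx, hxp, h⟩ := h1 _ hs k
    exact ⟨x, hx.1, hxp, hx.2, h⟩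
  choose X hXU hXp hXr f u h hu0 hne using h2
  have hpos : ∀ k r, 0 < dist (φ (X k r)) (φ p) := fun k r =>
    dist_pos.2 fun he => hXp k r (φ.injOn (hφs (hXU k r)) (hφs hpU) he)
  let rs : ℕ → {r : ℝ // 0 < r} := fun n =>
    Nat.rec ⟨1, one_pos⟩ (fun k r => ⟨dist (φ (X k r)) (φ p) / 2, half_pos (hpos k r)⟩) n
  let x : ℕ → N := fun j => X j (rs j)
  let y : ℕ → E := fun j => φ (x j)
  have hy : ∀ j, y j ≠ φ p := fun j => dist_pos.1 (hpos j (rs j))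
  have hdist : ∀ j, dist (y (j + 1)) (φ p) < dist (y j) (φ p) / 2 := fun j =>
    hXr (j + 1) (rs (j + 1))
  have hytar : ∀ j, y j ∈ φ.target := fun j => φ.map_source (hφs (hXU j _))
  have hsymm : ∀ j, φ.symm (y j) = x j := fun j => φ.left_inv (hφs (hXU j _))
  have hytend : Tendsto y atTop (𝓝 (φ p)) := by
    rw [tendsto_iff_dist_tendsto_zero]
    have hle : ∀ j, dist (y j) (φ p) ≤ dist (y 0) (φ p) * (1 / 2) ^ j := by
      intro j
      induction j with
      | zero => simp
      | succ j ih =>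
        rw [pow_succ]
        linarith [hdist j]
    refine squeeze_zero (fun _ => dist_nonneg) hle ?_
    have := (tendsto_pow_atTop_nhds_zero_of_lt_one (r := (1 / 2 : ℝ)) (by norm_num)
      (by norm_num)).const_mul (dist (y 0) (φ p))
    rwa [mul_zero] at this
  have hxtend : Tendsto x atTop (𝓝 p) := by
    have h3 := continuousAt_extChartAt_symm (I := I) p
    rw [ContinuousAt, (extChartAt I p).left_inv (mem_extChartAt_source p)] at h3
    exact (h3.comp hytend).congr hsymm
  -- transfer to the chart
  have hloc : ∀ (w : C^∞⟮I, N; ℝ⟯) (j : ℕ), ∃ w' : E → ℝ, ContDiff ℝ ∞ w' ∧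
      w' =ᶠ[𝓝 (y j)] w ∘ φ.symm := fun w j =>
    exists_contDiff_eventuallyEq (isOpen_extChartAt_target (I := I) p)
      (contDiffOn_comp_extChartAt_symm p w) (hytar j)
  have hback : ∀ (W : C^∞⟮I, N; ℝ⟯) (W' : E → ℝ), (∀ z ∈ U, W z = W' (φ z)) →
      ∀ (j : ℕ) (w' : E → ℝ), W' =ᶠ[𝓝 (y j)] w' → W =ᶠ[𝓝 (x j)] fun z => w' (φ z) := by
    intro W W' hW j w' hw
    have hc : ContinuousAt φ (x j) := continuousAt_extChartAt' (hφs (hXU j _))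
    filter_upwards [hc.eventually hw, hU.mem_nhds (hXU j (rs j))] with z hz hzU
    rw [hW z hzU, hz]
  have hpull : ∀ (w : C^∞⟮I, N; ℝ⟯) (j : ℕ) (w' : E → ℝ), w' =ᶠ[𝓝 (y j)] w ∘ φ.symm →
      (fun z => w' (φ z)) =ᶠ[𝓝 (x j)] w := by
    intro w j w' hw
    have hc : ContinuousAt φ (x j) := continuousAt_extChartAt' (hφs (hXU j _))
    filter_upwards [hc.eventually hw, hU.mem_nhds (hXU j (rs j))] with z hz hzU
    rw [hz, Function.comp_apply, φ.left_inv (hφs hzU)]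
  choose f' hf' hfe using fun j => hloc (f j (rs j)) j
  choose u' hu' hue using fun j => hloc (u j (rs j)) j
  choose h' hh' hhe using fun j => hloc (h j (rs j)) j
  obtain ⟨F', c, hF', hFc⟩ := exists_smooth_eventuallyEq_smul (φ p) y hy hdist f' hf'
  let β : ℕ → ℝ := fun j => b (f j (rs j)) (h j (rs j) * u j (rs j) ^ (j + 1)) (x j)
  let a : ℕ → ℝ := fun j => j / (c j * β j)
  obtain ⟨G', hG', hGe⟩ := exists_smooth_eventuallyEq_mul_pow (φ p) y hy hdist
    (fun j z => a j * h' j z) u' (fun j => contDiff_const.mul (hh' j)) hu' (fun j => by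
      rw [(hue j).self_of_nhds, Function.comp_apply, hsymm]; exact hu0 j (rs j))
  obtain ⟨F, hF⟩ := hext F' hF'
  obtain ⟨G, hG⟩ := hext G' hG'
  have hval : ∀ j, b F G (x j) = j := by
    intro j
    have e1 : F =ᶠ[𝓝 (x j)] (c j • f j (rs j) : C^∞⟮I, N; ℝ⟯) := by
      filter_upwards [hback F F' hF j _ (hFc j).2, hpull _ j _ (hfe j)] with z hz1 hz2
      rw [hz1, hz2]; rfl
    have e2 : G =ᶠ[𝓝 (x j)] (a j • (h j (rs j) * u j (rs j) ^ (j + 1)) : C^∞⟮I, N; ℝ⟯) := by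
      filter_upwards [hback G G' hG j _ (hGe j), hpull _ j _ (hue j), hpull _ j _ (hhe j)] with z hz1 hz2 hz3
      rw [hz1, hz2, hz3, mul_assoc]; rfl
    rw [local_bracket_congr b hb anti e1 e2, map_smul, map_smul, LinearMap.smul_apply]
    show a j * (c j * β j) = j
    have hβ : β j ≠ 0 := hne j (rs j)
    have hcj := (hFc j).1.ne'
    simp only [a]
    field_simp
  have hlim : Tendsto (fun j => b F G (x j)) atTop (𝓝 (b F G p)) :=
    ((b F G).contMDiff.continuous.tendsto p).comp hxtend
  simp only [hval] at hlim
  exact not_tendsto_nhds_of_tendsto_atTop tendsto_natCast_atTop_atTop _ hlim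

/-- Restriction of smooth functions to a subset. -/
noncomputable def smoothRestrict (U : Set N) : C^∞⟮I, N; ℝ⟯ →ₐ[ℝ] (U → ℝ) where
  toFun f x := f x
  map_one' := rfl
  map_mul' _ _ := rfl
  map_zero' := rfl
  map_add' _ _ := rfl
  commutes' _ := rfl

include hb anti in
/-- A local Lie bracket on smooth functions is a first order bidifferential operator. -/
theorem mulCommutator_sq_eq_zero_of_local (jac : ∀ f g h, b f (b g h) = b (b f g) h + b g (b f h))
    (u f : C^∞⟮I, N; ℝ⟯) : (mulCommutator u ^ 2) (b f) = 0 := by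
  ext h p
  obtain ⟨U, hU, hpU, k, hk⟩ := exists_order_bound b hb anti p
  let ρ := (smoothRestrict (I := I) U).rangeRestrict
  have hρ : Function.Surjective ρ := (smoothRestrict (I := I) U).rangeRestrict_surjective
  have hρe : ∀ {f g}, ρ f = ρ g ↔ ∀ x ∈ U, f x = g x := by
    intro f g
    constructor
    · intro h x hx
      exact congrFun (congrArg Subtype.val h) ⟨x, hx⟩
    · intro h
      exact Subtype.ext (funext fun x => h x x.2)
  obtain ⟨σ, hσ⟩ := ρ.toLinearMap.exists_rightInverse_of_surjective (LinearMap.range_eq_top.2 hρ)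
  have hσ' : ∀ r, ρ (σ r) = r := fun r => LinearMap.congr_fun hσ r
  let b' : (smoothRestrict (I := I) U).range →ₗ[ℝ] (smoothRestrict (I := I) U).range →ₗ[ℝ]
      (smoothRestrict (I := I) U).range :=
    ((b.compl₁₂ σ σ).compr₂ ρ.toLinearMap)
  have hb' : ∀ f g, b' (ρ f) (ρ g) = ρ (b f g) := by
    intro f g
    refine hρe.2 fun x hx => ?_
    exact local_bracket_congr b hb anti
      (eventuallyEq_of_mem (hU.mem_nhds hx) (hρe.1 (hσ' (ρ f))))
      (eventuallyEq_of_mem (hU.mem_nhds hx) (hρe.1 (hσ' (ρ g))))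
  have hmc : ∀ (u f h) (n : ℕ), ((mulCommutator (ρ u) ^ n) (b' (ρ f))) (ρ h) = ρ (((mulCommutator u ^ n) (b f)) h) := by
    intro u f h n
    induction n generalizing h with
    | zero => exact hb' f h
    | succ n ih =>
      rw [pow_succ', pow_succ', Module.End.mul_apply, Module.End.mul_apply, mulCommutator_apply,
        mulCommutator_apply, ← map_mul, ih, ih, map_sub,
        map_mul ρ u (((mulCommutator u ^ n) (b f)) h)]
  have : IsReduced (smoothRestrict (I := I) U).range :=
    isReduced_of_injective (smoothRestrict (I := I) U).range.val Subtype.val_injective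
  have h2 := mulCommutator_sq_eq_zero (b := b') k (fun u f => by
      obtain ⟨u, rfl⟩ := hρ u
      obtain ⟨f, rfl⟩ := hρ f
      ext1 h
      obtain ⟨h, rfl⟩ := hρ h
      rw [hmc, LinearMap.zero_apply, ← map_zero ρ]
      refine hρe.2 fun x hx => ?_
      have h3 := hk x hx f u (h * (u - u x • 1))
      rw [mulCommutator_pow_apply_apply] at h3 ⊢
      rw [pow_succ', ← mul_assoc]
      exact h3)
    (fun f g => by
      obtain ⟨f, rfl⟩ := hρ f
      obtain ⟨g, rfl⟩ := hρ g
      rw [hb', hb', anti, map_neg])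
    (fun f g h => by
      obtain ⟨f, rfl⟩ := hρ f
      obtain ⟨g, rfl⟩ := hρ g
      obtain ⟨h, rfl⟩ := hρ h
      simp only [hb', ← map_add, jac f g h]) (ρ u) (ρ f)
  have h3 := LinearMap.congr_fun h2 (ρ h)
  rw [hmc, LinearMap.zero_apply, ← map_zero ρ] at h3
  exact hρe.1 h3 p hpU

end LocalBrackets

section VectorBundles

open Filter Topology

variable {E : Type*} [NormedAddCommGroup E] [NormedSpace ℝ E] [FiniteDimensional ℝ E]
  {H : Type*} [TopologicalSpace H] {I : ModelWithCorners ℝ E H}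
  {M : Type*} [TopologicalSpace M] [ChartedSpace H M] [IsManifold I ∞ M] [T2Space M]
  {G : Type*} [NormedAddCommGroup G] [NormedSpace ℝ G] [FiniteDimensional ℝ G]
  {B : M → Type*} [∀ p, AddCommGroup (B p)] [∀ p, Module ℝ (B p)]
  [TopologicalSpace (TotalSpace G B)] [∀ p, TopologicalSpace (B p)]
  [FiberBundle G B] [VectorBundle ℝ G B]

theorem ContMDiffSection.sum_apply {ι : Type*} (t : Finset ι) (s : ι → Cₛ^∞⟮I; G, B⟯) (p : M) :
    (∑ i ∈ t, s i) p = ∑ i ∈ t, s i p := by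
  have h := congrFun (map_sum (ContMDiffSection.coeAddHom I G ∞ B) s t) p
  rw [Finset.sum_apply] at h
  exact h

section Frames

variable [ContMDiffVectorBundle ∞ G B I]

theorem exists_section_const_coord (p₀ : M) (v : G) :
    ∃ s : Cₛ^∞⟮I; G, B⟯, ∀ᶠ p in 𝓝 p₀, p ∈ (trivializationAt G B p₀).baseSet ∧
      (trivializationAt G B p₀ ⟨p, s p⟩).2 = v := by
  set e := trivializationAt G B p₀
  have hp₀ : e.baseSet ∈ 𝓝 p₀ := e.open_baseSet.mem_nhds (mem_baseSet_trivializationAt G B p₀)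
  have hσ : ContMDiffOn I (I.prod 𝓘(ℝ, G)) ∞ (fun p => TotalSpace.mk' G p (e.symm p v)) e.baseSet := by
    rw [e.contMDiffOn_section_baseSet_iff]
    refine (contMDiffOn_const (c := v)).congr fun p hp => ?_
    exact congrArg Prod.snd (e.apply_mk_symm hp v)
  obtain ⟨χ, h1, h2⟩ := exists_smooth_eventuallyEq_one (I := I) p₀ hp₀
  refine ⟨⟨fun p => χ p • e.symm p v, ContMDiffOn.smul_section_of_tsupport (u := e.baseSet)
    χ.contMDiff.contMDiffOn e.open_baseSet h2 hσ⟩, ?_⟩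
  filter_upwards [h1, hp₀] with p hp hpb
  refine ⟨hpb, ?_⟩
  show (e ⟨p, χ p • e.symm p v⟩).2 = v
  rw [hp, one_smul]
  exact congrArg Prod.snd (e.apply_mk_symm hpb v)

theorem exists_section_frame (p₀ : M) :
    ∃ s : Fin (Module.finrank ℝ G) → Cₛ^∞⟮I; G, B⟯, ∀ᶠ p in 𝓝 p₀,
      p ∈ (trivializationAt G B p₀).baseSet ∧ ∀ φ : B p,
      φ = ∑ i, (Module.finBasis ℝ G).repr (trivializationAt G B p₀ ⟨p, φ⟩).2 i • s i p := by
  choose s hs using fun i => exists_section_const_coord (I := I) (G := G) (B := B) p₀ (Module.finBasis ℝ G i)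
  refine ⟨s, ?_⟩
  set e := trivializationAt G B p₀
  filter_upwards [e.open_baseSet.mem_nhds (mem_baseSet_trivializationAt G B p₀),
    Filter.eventually_all.2 hs] with p hp hsp
  refine ⟨hp, fun φ => ?_⟩
  have hinj : Function.Injective (e.continuousLinearEquivAt ℝ p hp) :=
    (e.continuousLinearEquivAt ℝ p hp).injective
  refine hinj ?_
  rw [map_sum]
  simp only [map_smul]
  have hval : ∀ ψ : B p, e.continuousLinearEquivAt ℝ p hp ψ = (e ⟨p, ψ⟩).2 := fun ψ => rfl
  simp only [hval, (hsp _).2]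
  exact ((Module.finBasis ℝ G).sum_repr _).symm

theorem exists_coeff_section_frame (p₀ : M) :
    ∃ s : Fin (Module.finrank ℝ G) → Cₛ^∞⟮I; G, B⟯, ∀ a : Cₛ^∞⟮I; G, B⟯,
      ∃ f : Fin (Module.finrank ℝ G) → C^∞⟮I, M; ℝ⟯,
        (∀ᶠ p in 𝓝 p₀, a p = ∑ i, f i p • s i p) ∧ (a p₀ = 0 → ∀ i, f i p₀ = 0) := by
  obtain ⟨s, hs⟩ := exists_section_frame (I := I) (G := G) (B := B) p₀
  refine ⟨s, fun a => ?_⟩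
  set e := trivializationAt G B p₀
  have hp₀ : e.baseSet ∈ 𝓝 p₀ := e.open_baseSet.mem_nhds (mem_baseSet_trivializationAt G B p₀)
  obtain ⟨χ, h1, h2⟩ := exists_smooth_eventuallyEq_one (I := I) p₀ hp₀
  have ha : ContMDiffOn I 𝓘(ℝ, G) ∞ (fun p => (e ⟨p, a p⟩).2) e.baseSet :=
    e.contMDiffOn_section_baseSet_iff.1 a.contMDiff.contMDiffOn
  let l : Fin (Module.finrank ℝ G) → G →L[ℝ] ℝ := fun i =>
    LinearMap.toContinuousLinearMap ((Module.finBasis ℝ G).coord i)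
  have hf : ∀ i, ContMDiff I 𝓘(ℝ, ℝ) ∞ fun p => χ p • l i (e ⟨p, a p⟩).2 := by
    intro i
    refine contMDiff_of_tsupport fun p hp => ?_
    have hpb : p ∈ e.baseSet := h2 (tsupport_smul_subset_left _ _ hp)
    exact χ.contMDiff.contMDiffAt.smul (((l i).contMDiff.comp_contMDiffOn ha).contMDiffAt
      (e.open_baseSet.mem_nhds hpb))
  refine ⟨fun i => ⟨_, hf i⟩, ?_, fun h0 i => ?_⟩
  · filter_upwards [h1, hs] with p hp hsp
    refine (hsp.2 (a p)).trans (Finset.sum_congr rfl fun i _ => ?_)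
    show _ = (χ p • l i (e ⟨p, a p⟩).2) • s i p
    rw [hp, one_smul]
    rfl
  · show χ p₀ • l i (e ⟨p₀, a p₀⟩).2 = 0
    have hb := mem_baseSet_trivializationAt G B p₀
    have : (e ⟨p₀, a p₀⟩).2 = e.continuousLinearEquivAt ℝ p₀ hb (a p₀) := rfl
    rw [this, h0, map_zero, map_zero, smul_zero]

variable (I G B) in
/-- Evaluation of sections at a point. -/
noncomputable def sectionEval (p : M) : Cₛ^∞⟮I; G, B⟯ →ₗ[ℝ] B p where
  toFun s := s p
  map_add' _ _ := rfl
  map_smul' _ _ := rfl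

theorem sectionEval_surjective (p : M) : Function.Surjective (sectionEval I G B p) := by
  intro φ
  obtain ⟨s, hs⟩ := exists_section_frame (I := I) (G := G) (B := B) p
  refine ⟨∑ i, (Module.finBasis ℝ G).repr (trivializationAt G B p ⟨p, φ⟩).2 i • s i, ?_⟩
  rw [map_sum]
  exact (hs.self_of_nhds.2 φ).symm

end Frames

theorem LieBracketStructure.bracket_anti {L : Type*} [AddCommGroup L] [Module ℝ L]
    (𝓛 : LieBracketStructure L) (X Y : L) : 𝓛.bracket X Y = -𝓛.bracket Y X := by
  have h := 𝓛.bracket_self (X + Y)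
  simp only [map_add, LinearMap.add_apply, 𝓛.bracket_self, zero_add, add_zero] at h
  exact eq_neg_of_add_eq_zero_right h

theorem LieBracketStructure.ext' {L : Type*} [AddCommGroup L] [Module ℝ L]
    {𝓛 𝓛' : LieBracketStructure L} (h : 𝓛.bracket = 𝓛'.bracket) : 𝓛 = 𝓛' := by
  cases 𝓛; cases 𝓛'; cases h; rfl

theorem SmoothVectorField.ext_of_deriv [I.Boundaryless] {X Y : SmoothVectorField I M} (p : M)
    (h : ∀ f, SmoothVectorField.deriv X f p = SmoothVectorField.deriv Y f p) : X p = Y p := by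
  refine tangent_ext fun α => ?_
  obtain ⟨f, rfl⟩ := exists_mvfderiv_eq p α
  exact h f

namespace LieQDAlgebroid

variable (L : LieQDAlgebroid I G B)

theorem leibniz_apply (X Y : Cₛ^∞⟮I; G, B⟯) (f : C^∞⟮I, M; ℝ⟯) (p : M) :
    L.bracket X (functionSmul f Y) p
      = f p • L.bracket X Y p + mvfderiv I f p (L.anchor X p) • Y p := by
  rw [L.leibniz]; rfl

theorem bracket_apply_eq_zero (X : Cₛ^∞⟮I; G, B⟯) {Y : Cₛ^∞⟮I; G, B⟯} {p : M}
    (hY : ∀ᶠ q in 𝓝 p, Y q = 0) : L.bracket X Y p = 0 := by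
  obtain ⟨χ, h1, h2⟩ := exists_smooth_eventuallyEq_one (I := I) p hY
  have h3 : functionSmul χ Y = 0 := by
    ext q
    show χ q • Y q = 0
    by_cases hq : χ q = 0
    · rw [hq, zero_smul]
    · rw [show Y q = 0 from h2 (subset_tsupport _ hq), smul_zero]
  have h4 := L.leibniz_apply X Y χ p
  rw [h3, map_zero, h1.self_of_nhds, hY.self_of_nhds, smul_zero, add_zero, one_smul] at h4
  exact h4.symm

theorem support_bracket (s t : Cₛ^∞⟮I; G, B⟯) :
    sectionSupport (L.bracket s t) ⊆ sectionSupport s ∩ sectionSupport t := by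
  have key : ∀ s t : Cₛ^∞⟮I; G, B⟯, sectionSupport (L.bracket s t) ⊆ sectionSupport t := by
    intro s t
    refine closure_minimal (fun p hp => ?_) isClosed_closure
    by_contra hn
    refine hp (L.bracket_apply_eq_zero s ?_)
    filter_upwards [isClosed_closure.isOpen_compl.mem_nhds hn] with q hq
    by_contra hne
    exact hq (subset_closure hne)
  refine subset_inter ?_ (key s t)
  have h := key t s
  rw [L.bracket_anti] at h
  refine subset_trans (closure_mono fun p hp => ?_) h
  intro h0
  refine hp ?_
  have : (-L.bracket s t) p = 0 := h0
  simpa using this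

theorem anchor_eq_of_bracket_eq [I.Boundaryless] [ContMDiffVectorBundle ∞ G B I]
    (hG : 0 < Module.finrank ℝ G) {L L' : LieQDAlgebroid I G B}
    (h : L.bracket = L'.bracket) : L.anchor = L'.anchor := by
  refine LinearMap.ext fun X => ContMDiffSection.ext fun p => ?_
  refine SmoothVectorField.ext_of_deriv p fun f => ?_
  obtain ⟨v, hv⟩ : ∃ v : G, v ≠ 0 :=
    haveI := Module.finrank_pos_iff.1 hG
    exists_ne 0
  obtain ⟨Y, hY⟩ := exists_section_const_coord (I := I) (G := G) (B := B) p v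
  have hYp : Y p ≠ 0 := by
    intro h0
    have hb := mem_baseSet_trivializationAt G B p
    refine hv (hY.self_of_nhds.2.symm.trans ?_)
    have : ((trivializationAt G B p) ⟨p, Y p⟩).2
      = (trivializationAt G B p).continuousLinearEquivAt ℝ p hb (Y p) := rfl
    rw [this, h0, map_zero]
  have h1 := L.leibniz_apply X Y f p
  have h2 := L'.leibniz_apply X Y f p
  rw [h, h2] at h1
  exact (smul_left_injective ℝ hYp (add_left_cancel h1)).symm

theorem ext_of_bracket_eq [I.Boundaryless] [ContMDiffVectorBundle ∞ G B I]
    (hG : 0 < Module.finrank ℝ G) {L L' : LieQDAlgebroid I G B}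
    (h : L.bracket = L'.bracket) : L = L' := by
  have h1 := anchor_eq_of_bracket_eq hG h
  have h2 := LieBracketStructure.ext' h
  cases L; cases L'
  cases h1; cases h2
  rfl

section Tensorial

variable [I.Boundaryless] [ContMDiffVectorBundle ∞ G B I] (hG : 1 < Module.finrank ℝ G)
include hG

theorem exists_section_not_mem_span {p : M} (φ : B p) :
    ∃ Y : Cₛ^∞⟮I; G, B⟯, Y p ∉ Submodule.span ℝ {φ} := by
  have e : B p ≃ₗ[ℝ] G := ((trivializationAt G B p).continuousLinearEquivAt ℝ p
    (mem_baseSet_trivializationAt G B p)).toLinearEquiv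
  have hfin : FiniteDimensional ℝ (B p) := e.symm.finiteDimensional
  have h1 : Submodule.span ℝ {φ} ≠ ⊤ := by
    intro h
    have h2 := finrank_span_le_card (R := ℝ) ({φ} : Set (B p))
    rw [h, finrank_top, e.finrank_eq, Set.toFinset_singleton, Finset.card_singleton] at h2
    omega
  obtain ⟨ψ, hψ⟩ := SetLike.exists_not_mem_of_ne_top _ h1 rfl
  obtain ⟨Y, rfl⟩ := sectionEval_surjective (I := I) (G := G) p ψ
  exact ⟨Y, hψ⟩

theorem anchor_functionSmul (f : C^∞⟮I, M; ℝ⟯) (X : Cₛ^∞⟮I; G, B⟯) (p : M) :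
    L.anchor (functionSmul f X) p = f p • L.anchor X p := by
  have key : ∀ X : Cₛ^∞⟮I; G, B⟯, X p ≠ 0 → L.anchor (functionSmul f X) p = f p • L.anchor X p := by
    intro X hX
    obtain ⟨Y, hY⟩ := exists_section_not_mem_span (I := I) hG (X p)
    refine tangent_ext fun α => ?_
    obtain ⟨g, rfl⟩ := exists_mvfderiv_eq p α
    have h1 := L.leibniz_apply (functionSmul f X) Y g p
    have h2 := L.leibniz_apply (functionSmul g Y) X f p
    have h3 := L.leibniz_apply X Y g p
    have h4 := L.leibniz_apply Y X f p
    have a1 : ∀ s t, L.bracket s t p = -L.bracket t s p := fun s t => by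
      rw [L.bracket_anti]; rfl
    rw [a1 (functionSmul f X) (functionSmul g Y), h2, a1 (functionSmul g Y) X, h3,
      a1 (functionSmul f X) Y, h4, a1 Y X] at h1
    have h5 : (mvfderiv I g p (L.anchor (functionSmul f X) p) - f p * mvfderiv I g p (L.anchor X p)) • Y p
        = (g p * mvfderiv I f p (L.anchor Y p) - mvfderiv I f p (L.anchor (functionSmul g Y) p)) • X p := by
      linear_combination (norm := module) (-1 : ℝ) • h1
    rw [map_smul]
    by_contra hne
    have hne' : mvfderiv I g p (L.anchor (functionSmul f X) p) - f p * mvfderiv I g p (L.anchor X p) ≠ 0 :=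
      sub_ne_zero.2 hne
    refine hY (Submodule.mem_span_singleton.2 ⟨(mvfderiv I g p (L.anchor (functionSmul f X) p) - f p * mvfderiv I g p (L.anchor X p))⁻¹ *
      (g p * mvfderiv I f p (L.anchor Y p) - mvfderiv I f p (L.anchor (functionSmul g Y) p)), ?_⟩)
    rw [mul_smul, ← h5, inv_smul_smul₀ hne']
  by_cases hX : X p = 0
  · obtain ⟨Z, hZ⟩ := exists_section_not_mem_span (I := I) hG (0 : B p)
    have hZ0 : Z p ≠ 0 := fun h => hZ (by rw [h]; exact Submodule.zero_mem _)
    have h1 := key Z hZ0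
    have h2 := key (X + Z) (by
      show X p + Z p ≠ 0
      rwa [hX, zero_add])
    have h3 : functionSmul f (X + Z) = functionSmul f X + functionSmul f Z := by
      ext q
      exact smul_add _ _ _
    rw [h3, map_add, map_add] at h2
    have h4 : L.anchor (functionSmul f X) p + L.anchor (functionSmul f Z) p
      = f p • (L.anchor X p + L.anchor Z p) := h2
    rw [h1, smul_add] at h4
    exact add_right_cancel h4
  · exact key X hX

theorem anchor_apply_eq_zero {X : Cₛ^∞⟮I; G, B⟯} {p : M} (hX : X p = 0) : L.anchor X p = 0 := by
  have hloc : ∀ X : Cₛ^∞⟮I; G, B⟯, (∀ᶠ q in 𝓝 p, X q = 0) → L.anchor X p = 0 := by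
    intro X hX
    obtain ⟨χ, h1, h2⟩ := exists_smooth_eventuallyEq_one (I := I) p hX
    have h3 : functionSmul χ X = 0 := by
      ext q
      show χ q • X q = 0
      by_cases hq : χ q = 0
      · rw [hq, zero_smul]
      · rw [show X q = 0 from h2 (subset_tsupport _ hq), smul_zero]
    have h4 := L.anchor_functionSmul hG χ X p
    rw [h3, map_zero, h1.self_of_nhds, one_smul] at h4
    exact h4.symm
  obtain ⟨s, hs⟩ := exists_coeff_section_frame (I := I) (G := G) (B := B) p
  obtain ⟨f, hf, hf0⟩ := hs X
  have h1 := hloc (X - ∑ i, functionSmul (f i) (s i)) (by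
    filter_upwards [hf] with q hq
    show X q - (∑ i, functionSmul (f i) (s i)) q = 0
    rw [ContMDiffSection.sum_apply, hq, sub_eq_zero]
    rfl)
  rw [map_sub, map_sum] at h1
  have h2 : L.anchor X p = (∑ i, L.anchor (functionSmul (f i) (s i))) p := sub_eq_zero.1 h1
  rw [h2, ContMDiffSection.sum_apply]
  refine Finset.sum_eq_zero fun i _ => ?_
  rw [L.anchor_functionSmul hG, hf0 hX i, zero_smul]

/-- On a vector bundle of rank at least two every Lie QD-algebroid is a Lie algebroid. -/
theorem exists_lieAlgebroid :
    ∃ L' : LieAlgebroid I G B, L'.toLieBracketStructure = L.toLieBracketStructure := by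
  choose σ hσ using fun p => (sectionEval I G B p).exists_rightInverse_of_surjective
    (LinearMap.range_eq_top.2 (sectionEval_surjective (I := I) (G := G) (B := B) p))
  have hσ' : ∀ p φ, (σ p φ) p = φ := fun p φ => LinearMap.congr_fun (hσ p) φ
  have hanch : ∀ p (X Y : Cₛ^∞⟮I; G, B⟯), X p = Y p → L.anchor X p = L.anchor Y p := by
    intro p X Y h
    have h1 := L.anchor_apply_eq_zero hG (X := X - Y) (p := p) (sub_eq_zero.2 h)
    rw [map_sub] at h1
    exact sub_eq_zero.1 h1
  let ρ : ∀ p, B p →ₗ[ℝ] TangentSpace I p := fun p =>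
    { toFun := fun φ => L.anchor (σ p φ) p
      map_add' := fun φ ψ => by rw [map_add, map_add]; rfl
      map_smul' := fun c φ => by rw [map_smul, map_smul]; rfl }
  have hρ : ∀ p (X : Cₛ^∞⟮I; G, B⟯), ρ p (X p) = L.anchor X p := fun p X =>
    hanch p _ _ (hσ' p (X p))
  refine ⟨{ toLieBracketStructure := L.toLieBracketStructure
            anchor := ρ
            contMDiff_anchor := ?_
            leibniz := fun X Y f p => ?_ }, rfl⟩
  · intro v₀
    obtain ⟨s, hs⟩ := exists_section_frame (I := I) (G := G) (B := B) v₀.1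
    rw [contMDiffAt_totalSpace]
    refine ⟨contMDiffAt_proj B, ?_⟩
    set e := trivializationAt G B v₀.1 with he
    set τ := trivializationAt E (TangentSpace I : M → Type _) v₀.1 with hτ
    have hproj : ContinuousAt (fun v : TotalSpace G B => v.1) v₀ := (FiberBundle.continuous_proj G B).continuousAt
    have hτb : ∀ᶠ p in 𝓝 v₀.1, p ∈ τ.baseSet := τ.open_baseSet.mem_nhds (mem_baseSet_trivializationAt _ _ _)
    have hcoord : ContMDiffAt (I.prod 𝓘(ℝ, G)) 𝓘(ℝ, G) ∞ (fun v : TotalSpace G B => (e v).2) v₀ :=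
      (contMDiffAt_totalSpace.1 (contMDiffAt_id (x := v₀))).2
    let l : Fin (Module.finrank ℝ G) → G →L[ℝ] ℝ := fun i =>
      LinearMap.toContinuousLinearMap ((Module.finBasis ℝ G).coord i)
    have hsm : ContMDiffAt (I.prod 𝓘(ℝ, G)) 𝓘(ℝ, E) ∞ (fun v : TotalSpace G B =>
        ∑ i, l i (e v).2 • (τ ⟨v.1, L.anchor (s i) v.1⟩).2) v₀ := by
      refine ContMDiffAt.sum fun i _ => ((l i).contMDiff.contMDiffAt.comp v₀ hcoord).smul ?_
      have h1 : ContMDiffAt I 𝓘(ℝ, E) ∞ (fun p => (τ ⟨p, L.anchor (s i) p⟩).2) v₀.1 :=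
        (contMDiffAt_section _).1 (L.anchor (s i)).contMDiff.contMDiffAt
      exact h1.comp v₀ (contMDiffAt_proj B)
    refine hsm.congr_of_eventuallyEq ?_
    filter_upwards [hproj.eventually hs, hproj.eventually hτb] with v hv hvb
    have h1 : ρ v.1 v.2 = ∑ i, l i (e v).2 • L.anchor (s i) v.1 := by
      conv_lhs => rw [hv.2 v.2]
      rw [map_sum]
      refine Finset.sum_congr rfl fun i _ => ?_
      rw [map_smul, hρ]
      rfl
    have h2 : ∀ w : TangentSpace I v.1, (τ ⟨v.1, w⟩).2 = τ.continuousLinearEquivAt ℝ v.1 hvb w := fun _ => rfl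
    rw [h2, h1, map_sum]
    refine Finset.sum_congr rfl fun i _ => ?_
    rw [map_smul]
    rfl
  · rw [hρ]
    exact L.leibniz_apply X Y f p

end Tensorial

end LieQDAlgebroid

theorem LieAlgebroid.exists_lieQDAlgebroid (L : LieAlgebroid I G B) :
    ∃ L' : LieQDAlgebroid I G B, L'.toLieBracketStructure = L.toLieBracketStructure ∧
      ∀ X p, L'.anchor X p = L.anchor p (X p) := by
  refine ⟨{ toLieBracketStructure := L.toLieBracketStructure
            anchor :=
              { toFun := fun X => ⟨fun p => L.anchor p (X p), L.contMDiff_anchor.comp X.contMDiff⟩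
                map_add' := fun X Y => by
                  ext p
                  exact map_add (L.anchor p) _ _
                map_smul' := fun c X => by
                  ext p
                  exact map_smul (L.anchor p) _ _ }
            leibniz := fun X Y f => by
              ext p
              exact L.leibniz X Y f p }, rfl, fun _ _ => rfl⟩

theorem LieAlgebroid.ext_of_bracket_eq [I.Boundaryless] [ContMDiffVectorBundle ∞ G B I]
    (hG : 0 < Module.finrank ℝ G) {L L' : LieAlgebroid I G B}
    (h : L.toLieBracketStructure = L'.toLieBracketStructure) : L = L' := by
  obtain ⟨D, hD, hDa⟩ := L.exists_lieQDAlgebroid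
  obtain ⟨D', hD', hDa'⟩ := L'.exists_lieQDAlgebroid
  have h1 : D.anchor = D'.anchor := LieQDAlgebroid.anchor_eq_of_bracket_eq hG (by rw [hD, hD', h])
  have h2 : L.anchor = L'.anchor := by
    funext p
    refine LinearMap.ext fun φ => ?_
    obtain ⟨X, rfl⟩ := sectionEval_surjective (I := I) (G := G) p φ
    exact (hDa X p).symm.trans ((by rw [h1] : D.anchor X p = D'.anchor X p).trans (hDa' X p))
  cases L; cases L'
  cases h; cases h2
  rfl

end VectorBundles

section TotalSpaceTopology

theorem FiberBundle.t2Space_totalSpace {M : Type*} [TopologicalSpace M] (F : Type*) [TopologicalSpace F]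
    (A : M → Type*) [TopologicalSpace (TotalSpace F A)] [∀ p, TopologicalSpace (A p)]
    [FiberBundle F A] [T2Space M] [T2Space F] : T2Space (TotalSpace F A) := by
  refine ⟨fun x y hxy => ?_⟩
  by_cases h : x.1 = y.1
  · let e := trivializationAt F A x.1
    have hx : x ∈ e.source := e.mem_source.2 (mem_baseSet_trivializationAt F A x.1)
    have hy : y ∈ e.source := e.mem_source.2 (by
      rw [← h]
      exact mem_baseSet_trivializationAt F A x.1)
    have hne : e x ≠ e y := fun h => hxy (e.toOpenPartialHomeomorph.injOn hx hy h)
    obtain ⟨u, v, hu, hv, hxu, hyv, huv⟩ := t2_separation hne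
    exact ⟨e.source ∩ e ⁻¹' u, e.source ∩ e ⁻¹' v,
      e.toOpenPartialHomeomorph.isOpen_inter_preimage hu,
      e.toOpenPartialHomeomorph.isOpen_inter_preimage hv, ⟨hx, hxu⟩, ⟨hy, hyv⟩,
      (huv.preimage e).mono inter_subset_right inter_subset_right⟩
  · exact separated_by_continuous (FiberBundle.continuous_proj F A) h

end TotalSpaceTopology

section AffineBundle

open Filter Topology

variable {E : Type*} [NormedAddCommGroup E] [NormedSpace ℝ E] [FiniteDimensional ℝ E]
  {H : Type*} [TopologicalSpace H] {I : ModelWithCorners ℝ E H} [I.Boundaryless]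
  {M : Type*} [TopologicalSpace M] [ChartedSpace H M] [IsManifold I ∞ M] [T2Space M]
  {F : Type*} [NormedAddCommGroup F] [NormedSpace ℝ F] [FiniteDimensional ℝ F]
  {V A : M → Type*} [∀ p, AddCommGroup (V p)] [∀ p, Module ℝ (V p)] [∀ p, AddTorsor (V p) (A p)]
  [TopologicalSpace (TotalSpace F A)] [∀ p, TopologicalSpace (A p)]
  [FiberBundle F A] [IsAffineBundle F V A] [SmoothFiberBundle I F A]

theorem FiberBundle.extChartAt_apply (x : TotalSpace F A) {z : TotalSpace F A}
    (hz : z.1 ∈ (trivializationAt F A x.1).baseSet) :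
    extChartAt (I.prod 𝓘(ℝ, F)) x z = (extChartAt I x.1 z.1, (trivializationAt F A x.1 z).2) := by
  rw [FiberBundle.extChartAt]
  refine Prod.ext ?_ rfl
  show extChartAt I x.1 (trivializationAt F A x.1 z).1 = _
  rw [(trivializationAt F A x.1).coe_fst ((trivializationAt F A x.1).mem_source.2 hz)]

theorem FiberBundle.extChartAt_symm_apply (x : TotalSpace F A) (w : F) :
    (extChartAt (I.prod 𝓘(ℝ, F)) x).symm (extChartAt I x.1 x.1, w)
      = (trivializationAt F A x.1).toOpenPartialHomeomorph.symm (x.1, w) := by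
  rw [FiberBundle.extChartAt]
  show (trivializationAt F A x.1).toOpenPartialHomeomorph.symm
    ((extChartAt I x.1).symm (extChartAt I x.1 x.1), w) = _
  rw [(extChartAt I x.1).left_inv (mem_extChartAt_source x.1)]

theorem SmoothFiberBundle.contMDiffOn_trivialization_symm_const
    (e : Trivialization F (π F A)) [MemTrivializationAtlas e] (w : F) :
    ContMDiffOn I (I.prod 𝓘(ℝ, F)) ∞
      (fun p => e.toOpenPartialHomeomorph.symm (p, w)) e.baseSet := by
  intro p hp
  have hproj : ∀ q ∈ e.baseSet, (e.toOpenPartialHomeomorph.symm (q, w)).proj = q :=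
    fun q hq => e.proj_symm_apply' hq
  rw [Bundle.contMDiffWithinAt_totalSpace]
  refine ⟨contMDiffWithinAt_id.congr hproj (hproj p hp), ?_⟩
  rw [hproj p hp]
  have h2 : ContMDiffAt (I.prod 𝓘(ℝ, F)) 𝓘(ℝ, F) ∞
      (fun q : M × F => (trivializationAt F A p (e.toOpenPartialHomeomorph.symm q)).2) (p, w) :=
    (SmoothFiberBundle.smooth_transition (I := I) e (trivializationAt F A p)).contMDiffAt
      (((e.open_baseSet.inter (trivializationAt F A p).open_baseSet).prod isOpen_univ).mem_nhds
        ⟨⟨hp, mem_baseSet_trivializationAt F A p⟩, mem_univ _⟩)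
  exact (h2.comp p (contMDiffAt_id.prodMk contMDiffAt_const)).contMDiffWithinAt

/-! ### Functions pulled back from the base -/

variable (F A) in
/-- The pullback of a smooth function along the projection of a fibre bundle. -/
noncomputable def basePullback (f : C^∞⟮I, M; ℝ⟯) : C^∞⟮I.prod 𝓘(ℝ, F), TotalSpace F A; ℝ⟯ :=
  f.comp ⟨TotalSpace.proj, contMDiff_proj A⟩

theorem basePullback_apply (f : C^∞⟮I, M; ℝ⟯) (x : TotalSpace F A) :
    basePullback F A f x = f x.1 := rfl

theorem basePullback_eventuallyEq {f : C^∞⟮I, M; ℝ⟯} {g : E → ℝ} {x : TotalSpace F A}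
    (hf : f =ᶠ[𝓝 x.1] fun q => g (extChartAt I x.1 q)) :
    basePullback F A f =ᶠ[𝓝 x] fun z => g (extChartAt (I.prod 𝓘(ℝ, F)) x z).1 := by
  have hc : ContinuousAt (TotalSpace.proj : TotalSpace F A → M) x :=
    (FiberBundle.continuous_proj F A).continuousAt
  filter_upwards [hc.eventually hf, hc.eventually ((trivializationAt F A x.1).open_baseSet.mem_nhds
    (mem_baseSet_trivializationAt F A x.1))] with z hz hzb
  rw [FiberBundle.extChartAt_apply x hzb]
  exact hz

theorem mvfderiv_basePullback (f : C^∞⟮I, M; ℝ⟯) (x : TotalSpace F A) :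
    mvfderiv (I.prod 𝓘(ℝ, F)) (basePullback F A f) x
      = (mvfderiv I f x.1).comp (mfderiv (I.prod 𝓘(ℝ, F)) I (TotalSpace.proj : TotalSpace F A → M) x) :=
  mvfderiv_comp x f.mdifferentiableAt
    ((contMDiff_proj (n := ∞) A).mdifferentiableAt (by simp))

theorem eq_zero_of_comp_mfderiv_proj_eq_zero (x : TotalSpace F A) {α : TangentSpace I x.1 →L[ℝ] ℝ}
    (h : α.comp (mfderiv (I.prod 𝓘(ℝ, F)) I (TotalSpace.proj : TotalSpace F A → M) x) = 0) : α = 0 := by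
  let α' : E →L[ℝ] ℝ := α
  obtain ⟨f, hf⟩ := exists_smooth_eventuallyEq_comp_extChartAt (I := I) x.1
    (g := fun y => α' y) α'.contDiff
  have h1 : mvfderiv I f x.1 = α := by
    rw [mvfderiv_of_eventuallyEq_comp_extChartAt f hf]
    exact ContinuousLinearMap.fderiv α'
  have h2 : mvfderiv (I.prod 𝓘(ℝ, F)) (basePullback F A f) x = α'.comp (ContinuousLinearMap.fst ℝ E F) := by
    rw [mvfderiv_of_eventuallyEq_comp_extChartAt _ (g := fun y : E × F => α' y.1)
      (basePullback_eventuallyEq hf)]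
    exact ContinuousLinearMap.fderiv (α'.comp (ContinuousLinearMap.fst ℝ E F))
  rw [mvfderiv_basePullback, h1, h] at h2
  have h3 : α' = 0 := by
    ext v
    exact (DFunLike.congr_fun h2 ((v, 0) : E × F)).symm
  exact h3

include V in
theorem exists_eq_basePullback (c : C^∞⟮I.prod 𝓘(ℝ, F), TotalSpace F A; ℝ⟯)
    (hc : ∀ (p : M) (x y : A p), c ⟨p, x⟩ = c ⟨p, y⟩) :
    ∃ f : C^∞⟮I, M; ℝ⟯, basePullback F A f = c := by
  have hne : ∀ p, Nonempty (A p) := fun p => AddTorsor.nonempty (G := V p)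
  refine ⟨⟨fun p => c ⟨p, Classical.arbitrary (A p)⟩, ?_⟩, ?_⟩
  · intro p
    set e := trivializationAt F A p
    have hp : e.baseSet ∈ 𝓝 p := e.open_baseSet.mem_nhds (mem_baseSet_trivializationAt F A p)
    refine ((c.contMDiff.comp_contMDiffOn
      (SmoothFiberBundle.contMDiffOn_trivialization_symm_const (I := I) e 0)).contMDiffAt hp).congr_of_eventuallyEq ?_
    filter_upwards [hp] with q hq
    show _ = c (e.toOpenPartialHomeomorph.symm (q, 0))
    rw [← mk_fiberAffineEquiv_symm V e hq]
    exact hc q _ _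
  · ext ⟨p, x⟩
    exact hc p _ _

/-! ### Affine functions and sections -/

theorem AffineDual.apply_eq {p₀ p : M} (hp : p ∈ (trivializationAt F A p₀).baseSet)
    (φ : AffineDual F V A p) (x : A p) :
    φ x = (trivializationAt (AffineDualModel F) (AffineDual F V A) p₀ ⟨p, φ⟩).2.1
        (trivializationAt F A p₀ ⟨p, x⟩).2
      + (trivializationAt (AffineDualModel F) (AffineDual F V A) p₀ ⟨p, φ⟩).2.2 := by
  let φ' : A p →ᵃ[ℝ] ℝ := φ
  have h := affineFunctionEquiv_symm_apply (fiberAffineEquiv V (trivializationAt F A p₀) p)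
    (affineFunctionEquiv (fiberAffineEquiv V (trivializationAt F A p₀) p) φ') x
  rw [LinearEquiv.symm_apply_apply, fiberAffineEquiv_apply V _ hp] at h
  exact h

theorem AffineDual.ext {p : M} {φ ψ : AffineDual F V A p} (h : ∀ x, φ x = ψ x) : φ = ψ :=
  DFunLike.ext _ _ h

/-- The affine function on `A` associated with a section of `A⁺`. -/
noncomputable def sectionFun :
    AffineDualSection I F V A →ₗ[ℝ] C^∞⟮I.prod 𝓘(ℝ, F), TotalSpace F A; ℝ⟯ where
  toFun s := ⟨fun z => s z.1 z.2, by
    intro x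
    set e := trivializationAt F A x.1
    set e' := trivializationAt (AffineDualModel F) (AffineDual F V A) x.1
    have h1 : ContMDiffAt (I.prod 𝓘(ℝ, F)) 𝓘(ℝ, F) ∞ (fun z : TotalSpace F A => (e z).2) x :=
      (contMDiffAt_totalSpace.1 (contMDiffAt_id (x := x))).2
    have h2 : ContMDiffAt (I.prod 𝓘(ℝ, F)) 𝓘(ℝ, AffineDualModel F) ∞
        (fun z : TotalSpace F A => (e' ⟨z.1, s z.1⟩).2) x :=
      ((contMDiffAt_section _).1 s.contMDiff.contMDiffAt).comp x (contMDiffAt_proj A)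
    have h3 : ContMDiffAt (I.prod 𝓘(ℝ, F)) 𝓘(ℝ, F →L[ℝ] ℝ) ∞
        (fun z : TotalSpace F A => (e' ⟨z.1, s z.1⟩).2.1) x :=
      (ContinuousLinearMap.fst ℝ (F →L[ℝ] ℝ) ℝ).contMDiff.contMDiffAt.comp x h2
    have h4 : ContMDiffAt (I.prod 𝓘(ℝ, F)) 𝓘(ℝ, ℝ) ∞
        (fun z : TotalSpace F A => (e' ⟨z.1, s z.1⟩).2.2) x :=
      (ContinuousLinearMap.snd ℝ (F →L[ℝ] ℝ) ℝ).contMDiff.contMDiffAt.comp x h2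
    refine ((h3.clm_apply h1).add h4).congr_of_eventuallyEq ?_
    filter_upwards [(FiberBundle.continuous_proj F A).continuousAt.eventually
      (e.open_baseSet.mem_nhds (mem_baseSet_trivializationAt F A x.1))] with z hz
    exact AffineDual.apply_eq hz (s z.1) z.2⟩
  map_add' _ _ := rfl
  map_smul' _ _ := rfl

theorem sectionFun_apply (s : AffineDualSection I F V A) (x : TotalSpace F A) :
    sectionFun s x = s x.1 x.2 := rfl

theorem isAffineFunction_sectionFun (s : AffineDualSection I F V A) :
    IsAffineFunction V (sectionFun s) :=
  fun p => ⟨s p, fun _ => rfl⟩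

theorem sectionFun_toSection {a : C^∞⟮I.prod 𝓘(ℝ, F), TotalSpace F A; ℝ⟯} (ha : IsAffineFunction V a) :
    sectionFun (ha.toSection V) = a := by
  ext ⟨p, x⟩
  exact ha.toSection_apply V p x

theorem sectionFun_injective : Function.Injective (sectionFun (I := I) (F := F) (V := V) (A := A)) := by
  intro s t h
  refine ContMDiffSection.ext fun p => AffineDual.ext fun x => ?_
  exact DFunLike.congr_fun h (⟨p, x⟩ : TotalSpace F A)

theorem toSection_eq_iff {a : C^∞⟮I.prod 𝓘(ℝ, F), TotalSpace F A; ℝ⟯} (ha : IsAffineFunction V a)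
    (s : AffineDualSection I F V A) : ha.toSection V = s ↔ a = sectionFun s := by
  rw [← sectionFun_injective.eq_iff, sectionFun_toSection]

theorem toSection_sectionFun (s : AffineDualSection I F V A) (hs : IsAffineFunction V (sectionFun s)) :
    hs.toSection V = s :=
  (toSection_eq_iff hs s).2 rfl

theorem sectionFun_functionSmul (f : C^∞⟮I, M; ℝ⟯) (s : AffineDualSection I F V A) :
    sectionFun (functionSmul f s) = basePullback F A f * sectionFun s := rfl

variable (I F V A) in
theorem isAffineFunction_one :
    IsAffineFunction V (1 : C^∞⟮I.prod 𝓘(ℝ, F), TotalSpace F A; ℝ⟯) :=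
  fun _ => ⟨AffineMap.const ℝ _ 1, fun _ => rfl⟩

variable (I F V A) in
/-- The section of `A⁺` given by the constant function `1`. -/
noncomputable def oneSection : AffineDualSection I F V A := (isAffineFunction_one I F V A).toSection V

theorem sectionFun_oneSection :
    sectionFun (oneSection I F V A) = 1 := sectionFun_toSection _

theorem exists_mvfderiv_sectionFun_eq (x : TotalSpace F A)
    (α : TangentSpace (I.prod 𝓘(ℝ, F)) x →L[ℝ] ℝ) :
    ∃ s : AffineDualSection I F V A, mvfderiv (I.prod 𝓘(ℝ, F)) (sectionFun s) x = α := by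
  have := FiberBundle.t2Space_totalSpace F A
  let α' : E × F →L[ℝ] ℝ := α
  obtain ⟨f, hf⟩ := exists_smooth_eventuallyEq_comp_extChartAt (I := I) x.1
    (g := fun y => α'.comp (ContinuousLinearMap.inl ℝ E F) y) (ContinuousLinearMap.contDiff _)
  obtain ⟨s, hs⟩ := exists_section_const_coord (I := I) (G := AffineDualModel F)
    (B := AffineDual F V A) x.1 (α'.comp (ContinuousLinearMap.inr ℝ E F), 0)
  refine ⟨functionSmul f (oneSection I F V A) + s, ?_⟩
  have h : sectionFun (functionSmul f (oneSection I F V A) + s) =ᶠ[𝓝 x]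
      fun z => α' (extChartAt (I.prod 𝓘(ℝ, F)) x z) := by
    have hc : ContinuousAt (TotalSpace.proj : TotalSpace F A → M) x :=
      (FiberBundle.continuous_proj F A).continuousAt
    filter_upwards [basePullback_eventuallyEq (F := F) (A := A) hf, hc.eventually hs] with z hz hzs
    have hzb : z.1 ∈ (trivializationAt F A x.1).baseSet := hzs.1
    rw [map_add, sectionFun_functionSmul, sectionFun_oneSection, mul_one]
    show basePullback F A f z + s z.1 z.2 = _
    rw [hz, AffineDual.apply_eq hzb, hzs.2, FiberBundle.extChartAt_apply x hzb]
    show α' (_, 0) + (α' (0, _) + 0) = _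
    rw [add_zero, ← map_add]
    simp
  rw [mvfderiv_of_eventuallyEq_comp_extChartAt _ h]
  exact ContinuousLinearMap.fderiv α'

theorem mvfderiv_sectionFun_vertical (s : AffineDualSection I F V A) (x : TotalSpace F A) (w : F) :
    mvfderiv (I.prod 𝓘(ℝ, F)) (sectionFun s) x ((0, w) : E × F) =
      (trivializationAt (AffineDualModel F) (AffineDual F V A) x.1 ⟨x.1, s x.1⟩).2.1 w := by
  set c := (trivializationAt (AffineDualModel F) (AffineDual F V A) x.1 ⟨x.1, s x.1⟩).2
  set e := trivializationAt F A x.1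
  have hb : x.1 ∈ e.baseSet := mem_baseSet_trivializationAt F A x.1
  set S := sectionFun s ∘ (extChartAt (I.prod 𝓘(ℝ, F)) x).symm with hS
  have hx : extChartAt (I.prod 𝓘(ℝ, F)) x x = (extChartAt I x.1 x.1, (e x).2) :=
    FiberBundle.extChartAt_apply x hb
  have hval : ∀ u : F, S (extChartAt I x.1 x.1, u) = c.1 u + c.2 := by
    intro u
    show sectionFun s ((extChartAt (I.prod 𝓘(ℝ, F)) x).symm (extChartAt I x.1 x.1, u)) = _
    rw [FiberBundle.extChartAt_symm_apply, ← mk_fiberAffineEquiv_symm V e hb, sectionFun_apply,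
      AffineDual.apply_eq hb, ← fiberAffineEquiv_apply V e hb, AffineEquiv.apply_symm_apply]
  have hd : DifferentiableAt ℝ S (extChartAt (I.prod 𝓘(ℝ, F)) x x) :=
    ((contDiffOn_comp_extChartAt_symm x (sectionFun s)).contDiffAt
      (extChartAt_target_mem_nhds x)).differentiableAt (by simp)
  rw [mvfderiv_eq_fderiv]
  have h1 : HasFDerivAt (fun u : F => S (extChartAt I x.1 x.1, u))
      ((fderiv ℝ S (extChartAt (I.prod 𝓘(ℝ, F)) x x)).comp (ContinuousLinearMap.inr ℝ E F)) (e x).2 := by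
    have h2 := hd.hasFDerivAt
    rw [hx] at h2
    rw [hx]
    exact h2.comp (e x).2 (hasFDerivAt_prodMk_right _ _)
  have h2 : HasFDerivAt (fun u : F => S (extChartAt I x.1 x.1, u)) c.1 (e x).2 := by
    have h3 : (fun u : F => S (extChartAt I x.1 x.1, u)) = fun u => c.1 u + c.2 := funext hval
    rw [h3]
    exact c.1.hasFDerivAt.add_const _
  exact DFunLike.congr_fun (h1.unique h2) w

theorem eq_zero_of_mvfderiv_sectionFun_eq_zero {s : AffineDualSection I F V A} {x : TotalSpace F A}
    (h : mvfderiv (I.prod 𝓘(ℝ, F)) (sectionFun s) x = 0) (h0 : s x.1 x.2 = 0) : s x.1 = 0 := by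
  have hb : x.1 ∈ (trivializationAt F A x.1).baseSet := mem_baseSet_trivializationAt F A x.1
  have h1 : (trivializationAt (AffineDualModel F) (AffineDual F V A) x.1 ⟨x.1, s x.1⟩).2.1 = 0 := by
    ext w
    rw [← mvfderiv_sectionFun_vertical, h]
    rfl
  rw [AffineDual.apply_eq hb, h1, zero_apply, zero_add] at h0
  refine AffineDual.ext fun y => ?_
  rw [AffineDual.apply_eq hb, h1, h0]
  exact add_zero _

theorem IsAffineFunction.const_of_mul_self {a : C^∞⟮I.prod 𝓘(ℝ, F), TotalSpace F A; ℝ⟯}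
    (ha : IsAffineFunction V a) (ha2 : IsAffineFunction V (a * a)) (p : M) (x y : A p) :
    a ⟨p, x⟩ = a ⟨p, y⟩ := by
  obtain ⟨φ, hφ⟩ := ha p
  obtain ⟨ψ, hψ⟩ := ha2 p
  have h : ∀ z, φ z * φ z = ψ z := fun z => by rw [← hφ, ← hψ]; rfl
  have h1 := h (AffineMap.lineMap x y (2 : ℝ))
  have h2 := h x
  have h3 := h y
  rw [AffineMap.apply_lineMap, AffineMap.apply_lineMap, AffineMap.lineMap_apply, AffineMap.lineMap_apply] at h1
  simp only [vsub_eq_sub, vadd_eq_add, smul_eq_mul] at h1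
  rw [hφ, hφ]
  have h4 : (φ x - φ y) ^ 2 = 0 := by linear_combination (1 / 2) * h1 + (1 / 2) * h2 - h3
  exact sub_eq_zero.1 (pow_eq_zero_iff two_ne_zero |>.1 h4)

end AffineBundle

section Jacobi

variable {E : Type*} [NormedAddCommGroup E] [NormedSpace ℝ E] [FiniteDimensional ℝ E]
  {H : Type*} [TopologicalSpace H] {I : ModelWithCorners ℝ E H}
  {N : Type*} [TopologicalSpace N] [ChartedSpace H N] [IsManifold I ∞ N]

/-- The derivative along a vector field as a linear map. -/
noncomputable def SmoothVectorField.derivLinear (X : SmoothVectorField I N) :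
    C^∞⟮I, N; ℝ⟯ →ₗ[ℝ] C^∞⟮I, N; ℝ⟯ where
  toFun := SmoothVectorField.deriv X
  map_add' f g := by
    ext x
    show mvfderiv I (f + g : C^∞⟮I, N; ℝ⟯) x (X x) = mvfderiv I f x (X x) + mvfderiv I g x (X x)
    rw [mvfderiv_smooth_add]; rfl
  map_smul' c f := by
    ext x
    show mvfderiv I (c • f : C^∞⟮I, N; ℝ⟯) x (X x) = c • mvfderiv I f x (X x)
    rw [mvfderiv_smooth_smul]; rfl

theorem SmoothVectorField.derivLinear_apply (X : SmoothVectorField I N) (f : C^∞⟮I, N; ℝ⟯) :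
    SmoothVectorField.derivLinear X f = SmoothVectorField.deriv X f := rfl

theorem SmoothVectorField.derivLinear_mul (X : SmoothVectorField I N) (f g : C^∞⟮I, N; ℝ⟯) :
    SmoothVectorField.derivLinear X (f * g)
      = f * SmoothVectorField.derivLinear X g + g * SmoothVectorField.derivLinear X f := by
  ext x
  show mvfderiv I (f * g : C^∞⟮I, N; ℝ⟯) x (X x) = f x * mvfderiv I g x (X x) + g x * mvfderiv I f x (X x)
  rw [mvfderiv_smooth_mul]; rfl

theorem SmoothVectorField.derivLinear_one (X : SmoothVectorField I N) :
    SmoothVectorField.derivLinear X (1 : C^∞⟮I, N; ℝ⟯) = 0 := by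
  ext x
  show mvfderiv I (1 : C^∞⟮I, N; ℝ⟯) x (X x) = 0
  rw [mvfderiv_smooth_one]; rfl

namespace BivectorField

variable (Λ : BivectorField I N)

/-- The map `(f, g) ↦ Λ(df, dg)` as a bilinear map. -/
noncomputable def evalLinear : C^∞⟮I, N; ℝ⟯ →ₗ[ℝ] C^∞⟮I, N; ℝ⟯ →ₗ[ℝ] C^∞⟮I, N; ℝ⟯ :=
  LinearMap.mk₂ ℝ Λ.eval
    (fun f f' g => by
      ext x
      show Λ.toFun x _ _ = Λ.toFun x _ _ + Λ.toFun x _ _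
      rw [mvfderiv_smooth_add, map_add, LinearMap.add_apply])
    (fun c f g => by
      ext x
      show Λ.toFun x _ _ = c • Λ.toFun x _ _
      rw [mvfderiv_smooth_smul, map_smul, LinearMap.smul_apply])
    (fun f g g' => by
      ext x
      show Λ.toFun x _ _ = Λ.toFun x _ _ + Λ.toFun x _ _
      rw [mvfderiv_smooth_add, map_add])
    (fun c f g => by
      ext x
      show Λ.toFun x _ _ = c • Λ.toFun x _ _
      rw [mvfderiv_smooth_smul, map_smul])

theorem evalLinear_apply (f g : C^∞⟮I, N; ℝ⟯) : Λ.evalLinear f g = Λ.eval f g := rfl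

theorem evalLinear_anti (f g : C^∞⟮I, N; ℝ⟯) : Λ.evalLinear f g = -Λ.evalLinear g f := by
  ext x
  exact (LinearMap.BilinForm.IsAlt.neg_eq (Λ.alt x) _ _).symm

theorem evalLinear_mul (f g h : C^∞⟮I, N; ℝ⟯) :
    Λ.evalLinear f (g * h) = g * Λ.evalLinear f h + h * Λ.evalLinear f g := by
  ext x
  show Λ.toFun x _ _ = g x * Λ.toFun x _ _ + h x * Λ.toFun x _ _
  rw [mvfderiv_smooth_mul, map_add, map_smul, map_smul]
  rfl

theorem evalLinear_one (f : C^∞⟮I, N; ℝ⟯) : Λ.evalLinear f 1 = 0 := by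
  ext x
  show Λ.toFun x _ _ = 0
  rw [mvfderiv_smooth_one, map_zero]

end BivectorField

namespace JacobiStructure

variable (J : JacobiStructure I N)

theorem bracket_eq (f g : C^∞⟮I, N; ℝ⟯) :
    J.bracket f g = J.bivector.evalLinear f g + f * SmoothVectorField.derivLinear J.reeb g
      - g * SmoothVectorField.derivLinear J.reeb f := rfl

theorem bracket_self (f : C^∞⟮I, N; ℝ⟯) : J.bracket f f = 0 := by
  have h : J.bivector.evalLinear f f = 0 := by
    ext x
    exact J.bivector.alt x _
  rw [bracket_eq, h, zero_add, sub_self]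

theorem one_bracket (f : C^∞⟮I, N; ℝ⟯) :
    J.bracket 1 f = SmoothVectorField.derivLinear J.reeb f := by
  rw [bracket_eq, J.bivector.evalLinear_anti, J.bivector.evalLinear_one,
    SmoothVectorField.derivLinear_one]
  ring

theorem bracket_jacobi (f g h : C^∞⟮I, N; ℝ⟯) :
    J.bracket f (J.bracket g h) + J.bracket g (J.bracket h f) + J.bracket h (J.bracket f g) = 0 := by
  have hr := fun f g => J.schouten_reeb f g
  have hs := J.schouten_self f g h
  have hs' := (smul_right_injective _ (show (-2 : ℝ) ≠ 0 by norm_num)) hs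
  simp only [BivectorField.schoutenVector, BivectorField.wedgeVector,
    ← BivectorField.evalLinear_apply, ← SmoothVectorField.derivLinear_apply] at hr hs'
  rw [jacobiator_eq (fun a b => J.bivector.evalLinear a b) (SmoothVectorField.derivLinear J.reeb)
    (fun a => map_add _) (fun a => map_sub _) J.bivector.evalLinear_mul J.bivector.evalLinear_anti
    (map_add _) (map_sub _) (SmoothVectorField.derivLinear_mul _) J.bracket J.bracket_eq]
  rw [hs', hr, hr, hr]
  ring

/-- The derivation `F ↦ Λ(da, dF) + a E(F)` associated with a function `a`. -/
noncomputable def hamiltonian (a F : C^∞⟮I, N; ℝ⟯) : C^∞⟮I, N; ℝ⟯ :=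
  J.bivector.evalLinear a F + a * SmoothVectorField.derivLinear J.reeb F

theorem bracket_mul (a F b : C^∞⟮I, N; ℝ⟯) :
    J.bracket a (F * b) = F * J.bracket a b + J.hamiltonian a F * b := by
  rw [bracket_eq, bracket_eq, hamiltonian, J.bivector.evalLinear_mul,
    SmoothVectorField.derivLinear_mul]
  ring

theorem ext_of_bracket_eq (𝒮 : Set C^∞⟮I, N; ℝ⟯) (h1 : 1 ∈ 𝒮)
    (h𝒮 : ∀ x, ∀ α : TangentSpace I x →L[ℝ] ℝ, ∃ a ∈ 𝒮, mvfderiv I a x = α)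
    {J J' : JacobiStructure I N} (h : ∀ a ∈ 𝒮, ∀ b ∈ 𝒮, J.bracket a b = J'.bracket a b) : J = J' := by
  have hr : ∀ a ∈ 𝒮, SmoothVectorField.derivLinear J.reeb a = SmoothVectorField.derivLinear J'.reeb a :=
    fun a ha => by rw [← one_bracket, ← one_bracket, h 1 h1 a ha]
  have hΛ : ∀ a ∈ 𝒮, ∀ b ∈ 𝒮, J.bivector.evalLinear a b = J'.bivector.evalLinear a b := by
    intro a ha b hb
    have := h a ha b hb
    rw [bracket_eq, bracket_eq, hr a ha, hr b hb] at this
    simpa using this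
  have e1 : J.reeb = J'.reeb := by
    refine ContMDiffSection.ext fun x => tangent_ext fun α => ?_
    obtain ⟨a, ha, rfl⟩ := h𝒮 x α
    exact DFunLike.congr_fun (hr a ha) x
  have e2 : J.bivector = J'.bivector := by
    have : J.bivector.toFun = J'.bivector.toFun := by
      funext x
      refine LinearMap.ext₂ fun α β => ?_
      obtain ⟨a, ha, rfl⟩ := h𝒮 x α
      obtain ⟨b, hb, rfl⟩ := h𝒮 x β
      exact DFunLike.congr_fun (hΛ a ha b hb) x
    revert this
    generalize J.bivector = Λ
    generalize J'.bivector = Λ'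
    intro this
    cases Λ; cases Λ'; cases this; rfl
  exact JacobiStructure.ext e2 e1

end JacobiStructure

end Jacobi

section AffineJacobi

open Filter Topology

variable {E : Type*} [NormedAddCommGroup E] [NormedSpace ℝ E] [FiniteDimensional ℝ E]
  {H : Type*} [TopologicalSpace H] {I : ModelWithCorners ℝ E H} [I.Boundaryless]
  {M : Type*} [TopologicalSpace M] [ChartedSpace H M] [IsManifold I ∞ M] [T2Space M]
  {F : Type*} [NormedAddCommGroup F] [NormedSpace ℝ F] [FiniteDimensional ℝ F]
  {V A : M → Type*} [∀ p, AddCommGroup (V p)] [∀ p, Module ℝ (V p)] [∀ p, AddTorsor (V p) (A p)]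
  [TopologicalSpace (TotalSpace F A)] [∀ p, TopologicalSpace (A p)]
  [FiberBundle F A] [IsAffineBundle F V A] [SmoothFiberBundle I F A]

namespace AffineJacobiStructure

theorem correspondsTo_iff (J : AffineJacobiStructure I F V A)
    (L : LieBracketStructure (AffineDualSection I F V A)) :
    J.CorrespondsTo L ↔ ∀ s t, J.bracket (sectionFun s) (sectionFun t) = sectionFun (L.bracket s t) := by
  constructor
  · intro h s t
    have := h _ _ (isAffineFunction_sectionFun s) (isAffineFunction_sectionFun t)
    rw [toSection_sectionFun, toSection_sectionFun] at this
    rwa [toSection_eq_iff] at this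
  · intro h a b ha hb
    rw [toSection_eq_iff, ← h, sectionFun_toSection, sectionFun_toSection]

theorem CorrespondsTo.bracket_unique {J : AffineJacobiStructure I F V A}
    {L L' : LieBracketStructure (AffineDualSection I F V A)}
    (h : J.CorrespondsTo L) (h' : J.CorrespondsTo L') : L = L' := by
  rw [correspondsTo_iff] at h h'
  refine LieBracketStructure.ext' (LinearMap.ext₂ fun s t => sectionFun_injective ?_)
  rw [← h, ← h']

theorem CorrespondsTo.jacobi_unique {J J' : AffineJacobiStructure I F V A}
    {L : LieBracketStructure (AffineDualSection I F V A)}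
    (h : J.CorrespondsTo L) (h' : J'.CorrespondsTo L) : J = J' := by
  rw [correspondsTo_iff] at h h'
  have e : J.toJacobiStructure = J'.toJacobiStructure := by
    refine JacobiStructure.ext_of_bracket_eq (range (sectionFun (V := V)))
      ⟨_, sectionFun_oneSection⟩ (fun x α => ?_) ?_
    · obtain ⟨s, hs⟩ := exists_mvfderiv_sectionFun_eq (V := V) x α
      exact ⟨_, ⟨s, rfl⟩, hs⟩
    · rintro _ ⟨s, rfl⟩ _ ⟨t, rfl⟩
      rw [h, h']
  cases J; cases J'; cases e; rfl

variable (J : AffineJacobiStructure I F V A)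

/-- The bracket of sections of `A⁺` induced by an affine Jacobi structure. -/
noncomputable def sectionBracket (s t : AffineDualSection I F V A) : AffineDualSection I F V A :=
  (J.isAffine_bracket _ _ (isAffineFunction_sectionFun s) (isAffineFunction_sectionFun t)).toSection V

theorem sectionFun_sectionBracket (s t : AffineDualSection I F V A) :
    sectionFun (J.sectionBracket s t) = J.bracket (sectionFun s) (sectionFun t) :=
  sectionFun_toSection _

/-- The Lie bracket on `Γ(A⁺)` induced by an affine Jacobi structure. -/
noncomputable def toLieBracketStructure : LieBracketStructure (AffineDualSection I F V A) where
  bracket := LinearMap.mk₂ ℝ J.sectionBracket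
    (fun s s' t => sectionFun_injective (by
      simp only [sectionFun_sectionBracket, map_add, JacobiStructure.bracket_eq, LinearMap.add_apply]
      ring))
    (fun c s t => sectionFun_injective (by
      simp only [sectionFun_sectionBracket, map_smul, JacobiStructure.bracket_eq, LinearMap.smul_apply,
        smul_add, smul_sub, smul_mul_assoc, mul_smul_comm]))
    (fun s t t' => sectionFun_injective (by
      simp only [sectionFun_sectionBracket, map_add, JacobiStructure.bracket_eq]
      ring))
    (fun c s t => sectionFun_injective (by
      simp only [sectionFun_sectionBracket, map_smul, JacobiStructure.bracket_eq,
        smul_add, smul_sub, smul_mul_assoc, mul_smul_comm]))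
  bracket_self s := sectionFun_injective (by
    rw [LinearMap.mk₂_apply, sectionFun_sectionBracket, JacobiStructure.bracket_self, map_zero])
  jacobi s t u := sectionFun_injective (by
    simp only [LinearMap.mk₂_apply, map_add, sectionFun_sectionBracket, map_zero]
    exact J.bracket_jacobi _ _ _)

theorem correspondsTo_toLieBracketStructure : J.CorrespondsTo J.toLieBracketStructure :=
  J.correspondsTo_iff _ |>.2 fun s t => (J.sectionFun_sectionBracket s t).symm

theorem exists_hamiltonian_eq_basePullback (s : AffineDualSection I F V A) (f : C^∞⟮I, M; ℝ⟯) :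
    ∃ g : C^∞⟮I, M; ℝ⟯, basePullback F A g = J.hamiltonian (sectionFun s) (basePullback F A f) := by
  have key : ∀ t : AffineDualSection I F V A, ∃ u : AffineDualSection I F V A,
      sectionFun u = J.hamiltonian (sectionFun s) (basePullback F A f) * sectionFun t := by
    intro t
    refine ⟨J.sectionBracket s (functionSmul f t) - functionSmul f (J.sectionBracket s t), ?_⟩
    rw [map_sub, sectionFun_sectionBracket, sectionFun_functionSmul, sectionFun_functionSmul,
      sectionFun_sectionBracket, JacobiStructure.bracket_mul]
    ring
  obtain ⟨u, hu⟩ := key (oneSection I F V A)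
  rw [sectionFun_oneSection, mul_one] at hu
  obtain ⟨w, hw⟩ := key u
  rw [← hu] at hw ⊢
  refine exists_eq_basePullback (V := V) _ ((isAffineFunction_sectionFun u).const_of_mul_self ?_)
  rw [← hw]
  exact isAffineFunction_sectionFun w

theorem exists_anchor (s : AffineDualSection I F V A) :
    ∃ X : SmoothVectorField I M, ∀ f, basePullback F A (SmoothVectorField.deriv X f)
      = J.hamiltonian (sectionFun s) (basePullback F A f) := by
  choose D hD using J.exists_hamiltonian_eq_basePullback s
  have hne : ∀ p, Nonempty (A p) := fun p => AddTorsor.nonempty (G := V p)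
  let pt : ∀ p : M, TotalSpace F A := fun p => ⟨p, Classical.arbitrary (A p)⟩
  let l : ∀ p : M, (TangentSpace I p →L[ℝ] ℝ) →ₗ[ℝ] (TangentSpace (I.prod 𝓘(ℝ, F)) (pt p) →L[ℝ] ℝ) := fun p =>
    { toFun := fun α => α.comp (mfderiv (I.prod 𝓘(ℝ, F)) I (TotalSpace.proj : TotalSpace F A → M) (pt p))
      map_add' := fun _ _ => rfl
      map_smul' := fun _ _ => rfl }
  let ev : ∀ p : M, (TangentSpace (I.prod 𝓘(ℝ, F)) (pt p) →L[ℝ] ℝ) →ₗ[ℝ] ℝ := fun p =>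
    { toFun := fun β => β (J.reeb (pt p))
      map_add' := fun _ _ => rfl
      map_smul' := fun _ _ => rfl }
  let X : ∀ p : M, TangentSpace I p := fun p => tangentOfFunctional
    ((J.bivector.toFun (pt p) (mvfderiv (I.prod 𝓘(ℝ, F)) (sectionFun s) (pt p))) ∘ₗ l p
      + sectionFun s (pt p) • ev p ∘ₗ l p)
  have hX : ∀ (f : C^∞⟮I, M; ℝ⟯) p, mvfderiv I f p (X p) = D f p := by
    intro f p
    have h1 : D f p = J.hamiltonian (sectionFun s) (basePullback F A f) (pt p) := by
      rw [← hD]; rfl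
    rw [h1]
    refine (apply_tangentOfFunctional _ _).trans ?_
    have h2 : l p (mvfderiv I f p) = mvfderiv (I.prod 𝓘(ℝ, F)) (basePullback F A f) (pt p) :=
      (mvfderiv_basePullback f (pt p)).symm
    simp only [LinearMap.add_apply, LinearMap.comp_apply, LinearMap.smul_apply, h2]
    rfl
  refine ⟨⟨X, contMDiff_vectorField_of_forall X fun f => ?_⟩, fun f => ?_⟩
  · have : (fun z => mvfderiv I f z (X z)) = D f := funext (hX f)
    rw [this]
    exact (D f).contMDiff
  · rw [← hD]
    congr 1
    ext p
    exact hX f p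

theorem exists_lieQDAlgebroid :
    ∃ L : LieQDAlgebroid I (AffineDualModel F) (AffineDual F V A),
      J.CorrespondsTo L.toLieBracketStructure := by
  choose X hX using J.exists_anchor
  have hinj : ∀ {f g : C^∞⟮I, M; ℝ⟯}, basePullback F A f = basePullback F A g → f = g := by
    intro f g h
    ext p
    obtain ⟨x⟩ : Nonempty (A p) := AddTorsor.nonempty (G := V p)
    exact DFunLike.congr_fun h (⟨p, x⟩ : TotalSpace F A)
  refine ⟨{ toLieBracketStructure := J.toLieBracketStructure
            anchor :=
              { toFun := X
                map_add' := fun s t => ?_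
                map_smul' := fun c s => ?_ }
            leibniz := fun s t f => sectionFun_injective ?_ }, J.correspondsTo_toLieBracketStructure⟩
  · refine ContMDiffSection.ext fun p => SmoothVectorField.ext_of_deriv p fun f => ?_
    have h : basePullback F A (SmoothVectorField.deriv (X (s + t)) f)
        = basePullback F A (SmoothVectorField.deriv (X s) f + SmoothVectorField.deriv (X t) f) := by
      show _ = basePullback F A (SmoothVectorField.deriv (X s) f)
        + basePullback F A (SmoothVectorField.deriv (X t) f)
      simp only [hX, JacobiStructure.hamiltonian, map_add, LinearMap.add_apply]
      ring
    rw [hinj h]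
    exact (map_add (mvfderiv I f p) _ _).symm
  · refine ContMDiffSection.ext fun p => SmoothVectorField.ext_of_deriv p fun f => ?_
    have h : basePullback F A (SmoothVectorField.deriv (X (c • s)) f)
        = basePullback F A (c • SmoothVectorField.deriv (X s) f) := by
      show _ = c • basePullback F A (SmoothVectorField.deriv (X s) f)
      simp only [hX, JacobiStructure.hamiltonian, map_smul, LinearMap.smul_apply, smul_add,
        smul_mul_assoc]
    rw [hinj h]
    exact (map_smul (mvfderiv I f p) _ _).symm
  · rw [map_add, sectionFun_functionSmul, sectionFun_functionSmul]
    show sectionFun (J.sectionBracket _ _) = _ * sectionFun (J.sectionBracket _ _)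
      + basePullback F A (SmoothVectorField.deriv (X s) f) * _
    rw [sectionFun_sectionBracket, sectionFun_sectionBracket, sectionFun_functionSmul,
      JacobiStructure.bracket_mul, hX]

end AffineJacobiStructure

end AffineJacobi

section Defects

variable {C : Type*} [CommRing C] [Algebra ℝ C] (P : C →ₗ[ℝ] C →ₗ[ℝ] C) (D : C →ₗ[ℝ] C)

/-- The Lie derivative of the biderivation `P` along the derivation `D`, with one argument fixed. -/
noncomputable def reebDefect (f : C) : C →ₗ[ℝ] C := D ∘ₗ P f - P (D f) - P f ∘ₗ D

/-- The Jacobiator of the biderivation `P`, corrected by `D ∧ P`, with two arguments fixed. -/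
noncomputable def schoutenDefect (f g : C) : C →ₗ[ℝ] C :=
  P (P f g) + P.flip f ∘ₗ P g + P.flip g ∘ₗ P.flip f
    - (LinearMap.mulLeft ℝ (D f) ∘ₗ P g + LinearMap.mulLeft ℝ (D g) ∘ₗ P.flip f
      + LinearMap.mulLeft ℝ (P f g) ∘ₗ D)

theorem reebDefect_apply (f g : C) :
    reebDefect P D f g = D (P f g) - P (D f) g - P f (D g) := rfl

theorem schoutenDefect_apply (f g h : C) :
    schoutenDefect P D f g h = P (P f g) h + P (P g h) f + P (P h f) g
      - (D f * P g h + D g * P h f + P f g * D h) := rfl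

variable {P D} (hP : ∀ f g h, P f (g * h) = g * P f h + h * P f g) (anti : ∀ f g, P f g = -P g f)
  (hD : ∀ f g, D (f * g) = f * D g + g * D f)

include anti in
theorem reebDefect_anti (f g : C) : reebDefect P D f g = -reebDefect P D g f := by
  rw [reebDefect_apply, reebDefect_apply, anti f g, anti (D f) g, anti f (D g), map_neg]
  ring

include hP hD in
theorem reebDefect_mul (f g h : C) :
    reebDefect P D f (g * h) = g * reebDefect P D f h + h * reebDefect P D f g := by
  simp only [reebDefect_apply, hP, hD, map_add]
  ring

theorem schoutenDefect_cycl (f g h : C) : schoutenDefect P D f g h = schoutenDefect P D g h f := by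
  rw [schoutenDefect_apply, schoutenDefect_apply]
  ring

include hP anti hD in
theorem schoutenDefect_mul (f g h k : C) :
    schoutenDefect P D f g (h * k) = h * schoutenDefect P D f g k + k * schoutenDefect P D f g h := by
  have hP' : ∀ f g h, P (g * h) f = g * P h f + h * P g f := fun f g h => by
    rw [anti, hP, anti f h, anti f g]
    ring
  simp only [schoutenDefect_apply, hP, hP', hD, map_add, LinearMap.add_apply]
  rw [anti g h, anti g k]
  ring

include hP anti hD in
theorem defects_eq_zero {𝒮 : Set C} (one_mem : 1 ∈ 𝒮)
    (hext : ∀ Q : C →ₗ[ℝ] C, (∀ f g, Q (f * g) = f * Q g + g * Q f) → (∀ a ∈ 𝒮, Q a = 0) → Q = 0)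
    (jac : ∀ f ∈ 𝒮, ∀ g ∈ 𝒮, ∀ h ∈ 𝒮, -schoutenDefect P D f g h
      + (f * reebDefect P D g h + g * reebDefect P D h f + h * reebDefect P D f g) = 0) (f g h : C) :
    reebDefect P D f g = 0 ∧ schoutenDefect P D f g h = 0 := by
  have P_one : ∀ f, P f 1 = 0 := fun f => by
    have := hP f 1 1
    simpa using this
  have one_P : ∀ f, P 1 f = 0 := fun f => by rw [anti, P_one, neg_zero]
  have D_one : D 1 = 0 := by
    have := hD 1 1
    simpa using this
  have hT : ∀ f ∈ 𝒮, ∀ g ∈ 𝒮, reebDefect P D f g = 0 := by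
    intro f hf g hg
    have := jac 1 one_mem f hf g hg
    simpa [schoutenDefect_apply, reebDefect_apply, P_one, one_P, D_one] using this
  have hT1 : ∀ f ∈ 𝒮, reebDefect P D f = 0 := fun f hf =>
    hext _ (reebDefect_mul hP hD f) (hT f hf)
  have hT2 : ∀ f, reebDefect P D f = 0 := fun f =>
    hext _ (reebDefect_mul hP hD f) fun a ha => by
      rw [reebDefect_anti anti, hT1 a ha, LinearMap.zero_apply, neg_zero]
  have hS : ∀ f ∈ 𝒮, ∀ g ∈ 𝒮, ∀ h ∈ 𝒮, schoutenDefect P D f g h = 0 := by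
    intro f hf g hg h hh
    have := jac f hf g hg h hh
    simpa [hT2] using this
  have hS1 : ∀ f ∈ 𝒮, ∀ g ∈ 𝒮, schoutenDefect P D f g = 0 := fun f hf g hg =>
    hext _ (schoutenDefect_mul hP anti hD f g) (hS f hf g hg)
  have hS2 : ∀ f ∈ 𝒮, ∀ g, schoutenDefect P D f g = 0 := fun f hf g =>
    hext _ (schoutenDefect_mul hP anti hD f g) fun a ha => by
      rw [← schoutenDefect_cycl, hS1 a ha f hf, LinearMap.zero_apply]
  have hS3 : ∀ f g, schoutenDefect P D f g = 0 := fun f g =>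
    hext _ (schoutenDefect_mul hP anti hD f g) fun a ha => by
      rw [← schoutenDefect_cycl, hS2 a ha f, LinearMap.zero_apply]
  exact ⟨by rw [hT2, LinearMap.zero_apply], by rw [hS3, LinearMap.zero_apply]⟩

end Defects

section SpanningFunctions

variable {E : Type*} [NormedAddCommGroup E] [NormedSpace ℝ E] [FiniteDimensional ℝ E]
  {H : Type*} [TopologicalSpace H] {I : ModelWithCorners ℝ E H} [I.Boundaryless]
  {N : Type*} [TopologicalSpace N] [ChartedSpace H N] [IsManifold I ∞ N] [T2Space N]

theorem derivation_eq_zero_of_spanning {𝒮 : Set C^∞⟮I, N; ℝ⟯}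
    (h𝒮 : ∀ x, ∀ α : TangentSpace I x →L[ℝ] ℝ, ∃ a ∈ 𝒮, mvfderiv I a x = α)
    (Q : C^∞⟮I, N; ℝ⟯ →ₗ[ℝ] C^∞⟮I, N; ℝ⟯) (hQ : ∀ f g, Q (f * g) = f * Q g + g * Q f)
    (h : ∀ a ∈ 𝒮, Q a = 0) : Q = 0 := by
  refine LinearMap.ext fun f => ?_
  ext x
  obtain ⟨a, ha, hax⟩ := h𝒮 x (mvfderiv I f x)
  let ev : C^∞⟮I, N; ℝ⟯ →ₗ[ℝ] ℝ :=
    { toFun := fun f => f x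
      map_add' := fun _ _ => rfl
      map_smul' := fun _ _ => rfl }
  have h1 := pointDerivation_eq (ev ∘ₗ Q) (x := x) (fun f g => by
    show Q (f * g) x = f x * Q g x + g x * Q f x
    rw [hQ]
    rfl) hax
  have h2 : Q a x = Q f x := h1
  rw [← h2, h a ha]
  rfl

end SpanningFunctions

section QDToJacobi

open Filter Topology

variable {E : Type*} [NormedAddCommGroup E] [NormedSpace ℝ E] [FiniteDimensional ℝ E]
  {H : Type*} [TopologicalSpace H] {I : ModelWithCorners ℝ E H} [I.Boundaryless]
  {M : Type*} [TopologicalSpace M] [ChartedSpace H M] [IsManifold I ∞ M] [T2Space M]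
  {F : Type*} [NormedAddCommGroup F] [NormedSpace ℝ F] [FiniteDimensional ℝ F]
  {V A : M → Type*} [∀ p, AddCommGroup (V p)] [∀ p, Module ℝ (V p)] [∀ p, AddTorsor (V p) (A p)]
  [TopologicalSpace (TotalSpace F A)] [∀ p, TopologicalSpace (A p)]
  [FiberBundle F A] [IsAffineBundle F V A] [SmoothFiberBundle I F A]

theorem derivationAlong_eq_zero {x : TotalSpace F A} (T : AffineDualSection I F V A →ₗ[ℝ] ℝ)
    (v : TangentSpace I x.1)
    (hT : ∀ f s, T (functionSmul f s) = f x.1 * T s + mvfderiv I f x.1 v * s x.1 x.2)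
    {s : AffineDualSection I F V A} (hd : mvfderiv (I.prod 𝓘(ℝ, F)) (sectionFun s) x = 0)
    (h0 : s x.1 x.2 = 0) : T s = 0 := by
  have hloc : ∀ s : AffineDualSection I F V A, (∀ᶠ q in 𝓝 x.1, s q = 0) → T s = 0 := by
    intro s hs
    obtain ⟨χ, h1, h2⟩ := exists_smooth_eventuallyEq_one (I := I) x.1 hs
    have h3 : functionSmul χ s = 0 := by
      ext q
      show χ q • s q = 0
      by_cases hq : χ q = 0
      · rw [hq, zero_smul]
      · rw [show s q = 0 from h2 (subset_tsupport _ hq), smul_zero]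
    have h4 := hT χ s
    rw [h3, map_zero, h1.self_of_nhds, hs.self_of_nhds] at h4
    have h5 : (0 : AffineDual F V A x.1) x.2 = 0 := rfl
    rw [h5] at h4
    linarith
  have hs0 : s x.1 = 0 := eq_zero_of_mvfderiv_sectionFun_eq_zero hd h0
  obtain ⟨e, he⟩ := exists_coeff_section_frame (I := I) (G := AffineDualModel F)
    (B := AffineDual F V A) x.1
  obtain ⟨f, hf, hf0⟩ := he s
  have hf0 := hf0 hs0
  set t : AffineDualSection I F V A := ∑ i, functionSmul (f i) (e i) with ht
  have hst : ∀ᶠ q in 𝓝 x.1, s q = t q := by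
    filter_upwards [hf] with q hq
    rw [hq, ht, ContMDiffSection.sum_apply]
    rfl
  have h1 : T s = T t := by
    rw [← sub_eq_zero, ← map_sub]
    refine hloc _ ?_
    filter_upwards [hst] with q hq
    show s q - t q = 0
    rw [hq, sub_self]
  have h2 : T t = mvfderiv I (∑ i, (e i x.1 x.2) • f i : C^∞⟮I, M; ℝ⟯) x.1 v := by
    have h3 := map_sum (smoothDifferential (I := I) x.1) (fun i => (e i x.1 x.2) • f i) Finset.univ
    rw [smoothDifferential_apply] at h3
    rw [h3, ht, map_sum, sum_apply]
    refine Finset.sum_congr rfl fun i _ => ?_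
    rw [hT, hf0, smoothDifferential_apply, mvfderiv_smooth_smul, zero_mul, zero_add]
    exact mul_comm _ _
  have h3 : mvfderiv I (∑ i, (e i x.1 x.2) • f i : C^∞⟮I, M; ℝ⟯) x.1 = 0 := by
    refine eq_zero_of_comp_mfderiv_proj_eq_zero x ?_
    have h4 : mvfderiv (I.prod 𝓘(ℝ, F)) (sectionFun t) x = 0 := by
      rw [← hd]
      refine mvfderiv_congr ?_
      filter_upwards [(FiberBundle.continuous_proj F A).continuousAt.eventually hst] with z hz
      rw [sectionFun_apply, sectionFun_apply, hz]
    have h5 := map_sum (smoothDifferential (I := I.prod 𝓘(ℝ, F)) x)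
      (fun i => sectionFun (functionSmul (f i) (e i))) Finset.univ
    rw [← map_sum, ← ht, smoothDifferential_apply, h4] at h5
    have h6 := map_sum (smoothDifferential (I := I) x.1) (fun i => (e i x.1 x.2) • f i) Finset.univ
    rw [smoothDifferential_apply] at h6
    rw [h6, ContinuousLinearMap.finsetSum_comp, h5]
    refine Finset.sum_congr rfl fun i _ => ?_
    rw [smoothDifferential_apply, smoothDifferential_apply, mvfderiv_smooth_smul, sectionFun_functionSmul, mvfderiv_smooth_mul,
      basePullback_apply, hf0, zero_smul, zero_add, mvfderiv_basePullback]
    rfl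
  rw [h1, h2, h3]
  rfl

theorem exists_mem_range_sectionFun (x : TotalSpace F A) (α : TangentSpace (I.prod 𝓘(ℝ, F)) x →L[ℝ] ℝ) :
    ∃ a ∈ range (sectionFun (I := I) (F := F) (V := V) (A := A)), mvfderiv (I.prod 𝓘(ℝ, F)) a x = α := by
  obtain ⟨s, hs⟩ := exists_mvfderiv_sectionFun_eq (V := V) x α
  exact ⟨_, ⟨s, rfl⟩, hs⟩

namespace LieQDAlgebroid

variable (L : LieQDAlgebroid I (AffineDualModel F) (AffineDual F V A))

/-- The bilinear map whose value at `(s, t)` is the bivector of the Jacobi structure evaluated on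
the differentials of the affine functions associated with `s` and `t`. -/
noncomputable def affineBivector (s t : AffineDualSection I F V A) :
    C^∞⟮I.prod 𝓘(ℝ, F), TotalSpace F A; ℝ⟯ :=
  sectionFun (L.bracket s t) - sectionFun s * sectionFun (L.bracket (oneSection I F V A) t)
    + sectionFun t * sectionFun (L.bracket (oneSection I F V A) s)

theorem affineBivector_self (s : AffineDualSection I F V A) : L.affineBivector s s = 0 := by
  rw [affineBivector, L.bracket_self, map_zero]
  ring

theorem affineBivector_anti (s t : AffineDualSection I F V A) :
    L.affineBivector s t = -L.affineBivector t s := by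
  rw [affineBivector, affineBivector, L.bracket_anti, map_neg]
  ring

theorem sectionFun_bracket_functionSmul (s t : AffineDualSection I F V A) (f : C^∞⟮I, M; ℝ⟯)
    (x : TotalSpace F A) :
    sectionFun (L.bracket s (functionSmul f t)) x
      = f x.1 * sectionFun (L.bracket s t) x + mvfderiv I f x.1 (L.anchor s x.1) * t x.1 x.2 := by
  rw [sectionFun_apply, L.leibniz_apply]
  rfl

theorem bracket_eq_zero_of_jet_eq_zero {x : TotalSpace F A} {s : AffineDualSection I F V A}
    (hd : mvfderiv (I.prod 𝓘(ℝ, F)) (sectionFun s) x = 0) (h0 : s x.1 x.2 = 0)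
    (t : AffineDualSection I F V A) : sectionFun (L.bracket t s) x = 0 := by
  let ev : C^∞⟮I.prod 𝓘(ℝ, F), TotalSpace F A; ℝ⟯ →ₗ[ℝ] ℝ :=
    { toFun := fun f => f x
      map_add' := fun _ _ => rfl
      map_smul' := fun _ _ => rfl }
  exact derivationAlong_eq_zero (ev ∘ₗ sectionFun ∘ₗ L.bracket t) (L.anchor t x.1)
    (fun f s => L.sectionFun_bracket_functionSmul t s f x) hd h0

theorem affineBivector_congr {x : TotalSpace F A} (s : AffineDualSection I F V A)
    {t t' : AffineDualSection I F V A}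
    (h : mvfderiv (I.prod 𝓘(ℝ, F)) (sectionFun t) x = mvfderiv (I.prod 𝓘(ℝ, F)) (sectionFun t') x) :
    sectionFun (L.bracket (oneSection I F V A) t) x = sectionFun (L.bracket (oneSection I F V A) t') x ∧
      L.affineBivector s t x = L.affineBivector s t' x := by
  set c : ℝ := sectionFun (t - t') x with hc
  set u := t - t' - c • oneSection I F V A with hu
  have hone : sectionFun (oneSection I F V A) x = 1 := by
    rw [sectionFun_oneSection]; rfl
  have hu0 : sectionFun u x = 0 := by
    rw [hu, map_sub, map_smul]
    show sectionFun (t - t') x - c * sectionFun (oneSection I F V A) x = 0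
    rw [hone, mul_one, sub_self]
  have hud : mvfderiv (I.prod 𝓘(ℝ, F)) (sectionFun u) x = 0 := by
    rw [hu, map_sub, map_sub, map_smul, sectionFun_oneSection, mvfderiv_smooth_sub,
      mvfderiv_smooth_sub, mvfderiv_smooth_smul, mvfderiv_smooth_one, h, sub_self, smul_zero, sub_zero]
  have ht : t = t' + c • oneSection I F V A + u := by rw [hu]; abel
  have hb := fun s => L.bracket_eq_zero_of_jet_eq_zero hud hu0 s
  have h1 : sectionFun (L.bracket (oneSection I F V A) t) x
      = sectionFun (L.bracket (oneSection I F V A) t') x := by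
    rw [ht]
    simp only [map_add, map_smul, L.bracket_self, smul_zero, add_zero]
    show sectionFun _ x + sectionFun _ x = _
    rw [hb, add_zero]
  refine ⟨h1, ?_⟩
  have h2 : sectionFun (L.bracket s t) x = sectionFun (L.bracket s t') x
      - c * sectionFun (L.bracket (oneSection I F V A) s) x := by
    conv_lhs => rw [ht]
    simp only [map_add, map_smul, L.bracket_anti s (oneSection I F V A), map_neg]
    show sectionFun _ x + c * -sectionFun _ x + sectionFun _ x = _
    rw [hb]
    ring
  have h3 : sectionFun t x = sectionFun t' x + c := by
    rw [hc, map_sub]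
    show _ = _ + (sectionFun t x - sectionFun t' x)
    ring
  show sectionFun _ x - sectionFun s x * sectionFun _ x + sectionFun t x * sectionFun _ x
    = sectionFun _ x - sectionFun s x * sectionFun _ x + sectionFun t' x * sectionFun _ x
  rw [h1, h2, h3]
  ring

theorem affineBivector_congr₂ {x : TotalSpace F A} {s s' t t' : AffineDualSection I F V A}
    (hs : mvfderiv (I.prod 𝓘(ℝ, F)) (sectionFun s) x = mvfderiv (I.prod 𝓘(ℝ, F)) (sectionFun s') x)
    (ht : mvfderiv (I.prod 𝓘(ℝ, F)) (sectionFun t) x = mvfderiv (I.prod 𝓘(ℝ, F)) (sectionFun t') x) :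
    L.affineBivector s t x = L.affineBivector s' t' x := by
  rw [(L.affineBivector_congr s ht).2, L.affineBivector_anti, L.affineBivector_anti s']
  show -L.affineBivector t' s x = -L.affineBivector t' s' x
  rw [(L.affineBivector_congr t' hs).2]

/-- The bilinear map `affineBivector`. -/
noncomputable def affineBivectorLinear : AffineDualSection I F V A →ₗ[ℝ] AffineDualSection I F V A →ₗ[ℝ]
    C^∞⟮I.prod 𝓘(ℝ, F), TotalSpace F A; ℝ⟯ :=
  LinearMap.mk₂ ℝ L.affineBivector
    (fun s s' t => by
      simp only [affineBivector, map_add, LinearMap.add_apply]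
      ring)
    (fun c s t => by
      simp only [affineBivector, map_smul, LinearMap.smul_apply, smul_add, smul_sub, smul_mul_assoc,
        mul_smul_comm])
    (fun s t t' => by
      simp only [affineBivector, map_add]
      ring)
    (fun c s t => by
      simp only [affineBivector, map_smul, smul_add, smul_sub, smul_mul_assoc, mul_smul_comm])

/-- A Lie QD-algebroid structure on `A⁺` determines a bivector field and a vector field on `A`. -/
theorem exists_bivector_reeb :
    ∃ (Λ : BivectorField (I.prod 𝓘(ℝ, F)) (TotalSpace F A))
      (X : SmoothVectorField (I.prod 𝓘(ℝ, F)) (TotalSpace F A)),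
      (∀ s t, Λ.eval (sectionFun s) (sectionFun t) = L.affineBivector s t) ∧
      ∀ s, SmoothVectorField.deriv X (sectionFun s) = sectionFun (L.bracket (oneSection I F V A) s) := by
  have := FiberBundle.t2Space_totalSpace F A
  let d : ∀ x : TotalSpace F A, AffineDualSection I F V A →ₗ[ℝ] (TangentSpace (I.prod 𝓘(ℝ, F)) x →L[ℝ] ℝ) :=
    fun x => smoothDifferential x ∘ₗ sectionFun
  have hsurj : ∀ x, LinearMap.range (d x) = ⊤ := fun x =>
    LinearMap.range_eq_top.2 (exists_mvfderiv_sectionFun_eq x)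
  choose σ hσ using fun x => (d x).exists_rightInverse_of_surjective (hsurj x)
  have hσ' : ∀ x α, mvfderiv (I.prod 𝓘(ℝ, F)) (sectionFun (σ x α)) x = α :=
    fun x α => LinearMap.congr_fun (hσ x) α
  have hspan := exists_mem_range_sectionFun (I := I) (F := F) (V := V) (A := A)
  let ev : ∀ x : TotalSpace F A, C^∞⟮I.prod 𝓘(ℝ, F), TotalSpace F A; ℝ⟯ →ₗ[ℝ] ℝ := fun x =>
    { toFun := fun f => f x
      map_add' := fun _ _ => rfl
      map_smul' := fun _ _ => rfl }
  let Λ : ∀ x : TotalSpace F A, LinearMap.BilinForm ℝ (TangentSpace (I.prod 𝓘(ℝ, F)) x →L[ℝ] ℝ) :=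
    fun x => (L.affineBivectorLinear.compl₁₂ (σ x) (σ x)).compr₂ (ev x)
  have hΛ : ∀ s t x, Λ x (mvfderiv (I.prod 𝓘(ℝ, F)) (sectionFun s) x)
      (mvfderiv (I.prod 𝓘(ℝ, F)) (sectionFun t) x) = L.affineBivector s t x :=
    fun s t x => L.affineBivector_congr₂ (hσ' x _) (hσ' x _)
  let X : ∀ x : TotalSpace F A, TangentSpace (I.prod 𝓘(ℝ, F)) x := fun x =>
    tangentOfFunctional (ev x ∘ₗ sectionFun ∘ₗ L.bracket (oneSection I F V A) ∘ₗ σ x)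
  have hX : ∀ s x, mvfderiv (I.prod 𝓘(ℝ, F)) (sectionFun s) x (X x)
      = sectionFun (L.bracket (oneSection I F V A) s) x := fun s x =>
    (apply_tangentOfFunctional _ _).trans (L.affineBivector_congr s (hσ' x _)).1
  refine ⟨⟨Λ, fun x α => ?_, contMDiff_bilinear_mvfderiv (range (sectionFun (V := V))) hspan Λ ?_⟩,
    ⟨X, contMDiff_vectorField (range (sectionFun (V := V))) hspan X ?_⟩, fun s t => ?_, fun s => ?_⟩
  · show L.affineBivector (σ x α) (σ x α) x = 0
    rw [affineBivector_self]
    rfl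
  · rintro _ ⟨s, rfl⟩ _ ⟨t, rfl⟩
    have := (L.affineBivector s t).contMDiff
    rwa [show (L.affineBivector s t : TotalSpace F A → ℝ) = fun z => Λ z _ _ from
      funext fun z => (hΛ s t z).symm] at this
  · rintro _ ⟨s, rfl⟩
    have := (sectionFun (L.bracket (oneSection I F V A) s)).contMDiff
    rwa [show (sectionFun (L.bracket (oneSection I F V A) s) : TotalSpace F A → ℝ)
      = fun z => mvfderiv (I.prod 𝓘(ℝ, F)) (sectionFun s) z (X z) from
      funext fun z => (hX s z).symm] at this
  · ext x
    exact hΛ s t x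
  · ext x
    exact hX s x

theorem exists_affineJacobiStructure :
    ∃ J : AffineJacobiStructure I F V A, J.CorrespondsTo L.toLieBracketStructure := by
  have := FiberBundle.t2Space_totalSpace F A
  obtain ⟨Λ, X, hΛ, hX⟩ := L.exists_bivector_reeb
  have hspan := exists_mem_range_sectionFun (I := I) (F := F) (V := V) (A := A)
  have hbr : ∀ s t, Λ.evalLinear (sectionFun s) (sectionFun t)
      + sectionFun s * SmoothVectorField.derivLinear X (sectionFun t)
      - sectionFun t * SmoothVectorField.derivLinear X (sectionFun s) = sectionFun (L.bracket s t) := by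
    intro s t
    rw [BivectorField.evalLinear_apply, SmoothVectorField.derivLinear_apply,
      SmoothVectorField.derivLinear_apply, hΛ, hX, hX, affineBivector]
    ring
  have key := defects_eq_zero Λ.evalLinear_mul Λ.evalLinear_anti
    (SmoothVectorField.derivLinear_mul X) (𝒮 := range (sectionFun (V := V)))
    ⟨_, sectionFun_oneSection⟩ (derivation_eq_zero_of_spanning hspan) (by
      rintro _ ⟨s, rfl⟩ _ ⟨t, rfl⟩ _ ⟨u, rfl⟩
      have h1 := jacobiator_eq (fun a b => Λ.evalLinear a b) (SmoothVectorField.derivLinear X)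
        (fun a => map_add _) (fun a => map_sub _) Λ.evalLinear_mul Λ.evalLinear_anti
        (map_add _) (map_sub _) (SmoothVectorField.derivLinear_mul _) _ (fun _ _ => rfl)
        (sectionFun s) (sectionFun t) (sectionFun u)
      simp only [hbr, ← map_add] at h1
      rw [L.jacobi, map_zero] at h1
      rw [schoutenDefect_apply, reebDefect_apply, reebDefect_apply, reebDefect_apply, h1]
      ring)
  let J : JacobiStructure (I.prod 𝓘(ℝ, F)) (TotalSpace F A) :=
    { bivector := Λ
      reeb := X
      schouten_self := fun f g h => by
        have := (key f g h).2
        rw [schoutenDefect_apply, sub_eq_zero] at this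
        show (-2 : ℝ) • (Λ.evalLinear (Λ.evalLinear f g) h + Λ.evalLinear (Λ.evalLinear g h) f
          + Λ.evalLinear (Λ.evalLinear h f) g) = _
        rw [this, mul_comm (Λ.evalLinear f g)]
        rfl
      schouten_reeb := fun f g => (key f g g).1 }
  have hJ : ∀ s t, J.bracket (sectionFun s) (sectionFun t) = sectionFun (L.bracket s t) := hbr
  refine ⟨{ toJacobiStructure := J
            isAffine_bracket := fun a b ha hb => ?_ }, ?_⟩
  · rw [← sectionFun_toSection ha, ← sectionFun_toSection hb, hJ]
    exact isAffineFunction_sectionFun _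
  · rw [AffineJacobiStructure.correspondsTo_iff]
    exact hJ

end LieQDAlgebroid

end QDToJacobi

section LocalLie

open Filter Topology

variable {E : Type*} [NormedAddCommGroup E] [NormedSpace ℝ E] [FiniteDimensional ℝ E]
  {H : Type*} [TopologicalSpace H] {I : ModelWithCorners ℝ E H} [I.Boundaryless]
  {M : Type*} [TopologicalSpace M] [ChartedSpace H M] [IsManifold I ∞ M] [T2Space M]

/-- A derivation of the algebra of smooth functions is a vector field. -/
theorem exists_vectorField_of_derivation (D : C^∞⟮I, M; ℝ⟯ →ₗ[ℝ] C^∞⟮I, M; ℝ⟯)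
    (hD : ∀ f g, D (f * g) = f * D g + g * D f) :
    ∃ X : SmoothVectorField I M, ∀ f, SmoothVectorField.deriv X f = D f := by
  have hsurj : ∀ x : M, LinearMap.range (smoothDifferential (I := I) x) = ⊤ := fun x =>
    LinearMap.range_eq_top.2 (exists_mvfderiv_eq x)
  choose σ hσ using fun x => (smoothDifferential (I := I) x).exists_rightInverse_of_surjective (hsurj x)
  have hσ' : ∀ x α, mvfderiv I (σ x α) x = α := fun x α => LinearMap.congr_fun (hσ x) α
  let ev : ∀ x : M, C^∞⟮I, M; ℝ⟯ →ₗ[ℝ] ℝ := fun x =>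
    { toFun := fun f => f x
      map_add' := fun _ _ => rfl
      map_smul' := fun _ _ => rfl }
  let X : ∀ x : M, TangentSpace I x := fun x => tangentOfFunctional (ev x ∘ₗ D ∘ₗ σ x)
  have hX : ∀ (f : C^∞⟮I, M; ℝ⟯) x, mvfderiv I f x (X x) = D f x := fun f x =>
    (apply_tangentOfFunctional _ _).trans (pointDerivation_eq (ev x ∘ₗ D) (x := x) (fun f g => by
      show D (f * g) x = f x * D g x + g x * D f x
      rw [hD]
      rfl) (hσ' x _))
  refine ⟨⟨X, contMDiff_vectorField_of_forall X fun f => ?_⟩, fun f => ?_⟩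
  · rw [show (fun z => mvfderiv I f z (X z)) = D f from funext (hX f)]
    exact (D f).contMDiff
  · ext x
    exact hX f x

variable {G : Type*} [NormedAddCommGroup G] [NormedSpace ℝ G] [FiniteDimensional ℝ G]
  {B : M → Type*} [∀ p, AddCommGroup (B p)] [∀ p, Module ℝ (B p)]
  [TopologicalSpace (TotalSpace G B)] [∀ p, TopologicalSpace (B p)]
  [FiberBundle G B] [VectorBundle ℝ G B]

namespace LocalLieAlgebra

theorem ext_of_bracket_eq {L L' : LocalLieAlgebra I G B}
    (h : L.toLieBracketStructure = L'.toLieBracketStructure) : L = L' := by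
  cases L; cases L'
  cases h
  rfl

variable (L : LocalLieAlgebra I G B)

theorem bracket_apply_eq_zero (s : Cₛ^∞⟮I; G, B⟯) {t : Cₛ^∞⟮I; G, B⟯} {p : M}
    (ht : ∀ᶠ q in 𝓝 p, t q = 0) : L.bracket s t p = 0 := by
  by_contra hne
  have h1 : p ∈ sectionSupport t := (L.support_bracket s t (subset_closure hne)).2
  obtain ⟨q, hq, hq'⟩ := mem_closure_iff_nhds.1 h1 _ ht
  exact hq' hq

/-- On a trivial line bundle every local Lie algebra is a Lie QD-algebroid. -/
theorem exists_lieQDAlgebroid (e : Cₛ^∞⟮I; G, B⟯) (he0 : ∀ p, e p ≠ 0)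
    (he : ∀ s : Cₛ^∞⟮I; G, B⟯, ∃ f : C^∞⟮I, M; ℝ⟯, functionSmul f e = s) :
    ∃ L' : LieQDAlgebroid I G B, L'.toLieBracketStructure = L.toLieBracketStructure := by
  let ι : C^∞⟮I, M; ℝ⟯ →ₗ[ℝ] Cₛ^∞⟮I; G, B⟯ :=
    { toFun := fun f => functionSmul f e
      map_add' := fun f g => by
        ext p
        exact add_smul (f p) (g p) (e p)
      map_smul' := fun c f => by
        ext p
        exact mul_smul c (f p) (e p) }
  have hι : Function.Injective ι := by
    intro f g h
    ext p
    exact smul_left_injective ℝ (he0 p) (DFunLike.congr_fun h p)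
  let κ := (LinearEquiv.ofBijective ι ⟨hι, he⟩).symm
  have hικ : ∀ s, ι (κ s) = s := (LinearEquiv.ofBijective ι ⟨hι, he⟩).apply_symm_apply
  have hκι : ∀ f, κ (ι f) = f := (LinearEquiv.ofBijective ι ⟨hι, he⟩).symm_apply_apply
  have hmul : ∀ f g, functionSmul f (ι g) = ι (f * g) := fun f g => by
    ext p
    exact smul_smul (f p) (g p) (e p)
  let b : C^∞⟮I, M; ℝ⟯ →ₗ[ℝ] C^∞⟮I, M; ℝ⟯ →ₗ[ℝ] C^∞⟮I, M; ℝ⟯ :=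
    (L.bracket.compl₁₂ ι ι).compr₂ κ.toLinearMap
  have hb : ∀ f g, ι (b f g) = L.bracket (ι f) (ι g) := fun f g => hικ _
  have hloc : ∀ (x : M) (f g : C^∞⟮I, M; ℝ⟯), (g =ᶠ[𝓝 x] fun _ => (0 : ℝ)) → b f g x = 0 := by
    intro x f g hg
    have h1 : L.bracket (ι f) (ι g) x = 0 := L.bracket_apply_eq_zero _ (by
      filter_upwards [hg] with q hq
      show g q • e q = 0
      rw [hq, zero_smul])
    rw [← hb] at h1
    exact (smul_eq_zero.1 (show b f g x • e x = 0 from h1)).resolve_right (he0 x)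
  have hanti : ∀ f g, b f g = -b g f := fun f g => hι (by
    rw [hb, map_neg, hb, L.bracket_anti])
  have hjac : ∀ f g h, b f (b g h) = b (b f g) h + b g (b f h) := fun f g h => hι (by
    simp only [map_add, hb]
    have h1 := L.jacobi (ι f) (ι g) (ι h)
    rw [L.bracket_anti (ι h) (ι f), map_neg, L.bracket_anti (ι h)] at h1
    rw [← sub_eq_zero, ← h1]
    abel)
  have hfirst := mulCommutator_mulCommutator_eq_zero (mulCommutator_sq_eq_zero_of_local b hloc hanti hjac)
  let D : C^∞⟮I, M; ℝ⟯ → C^∞⟮I, M; ℝ⟯ →ₗ[ℝ] C^∞⟮I, M; ℝ⟯ := fun f =>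
    b f - LinearMap.mulRight ℝ (b f 1)
  have hD : ∀ f h, D f h = b f h - h * b f 1 := fun f h => rfl
  have hbm : ∀ f h g, b f (h * g) = h * b f g + D f h * g := by
    intro f h g
    have h1 := LinearMap.congr_fun (hfirst h g f) 1
    simp only [mulCommutator_apply, mul_one, LinearMap.zero_apply] at h1
    rw [hD]
    linear_combination h1
  have hDm : ∀ f g h, D f (g * h) = g * D f h + h * D f g := by
    intro f g h
    rw [hD, hbm, hD, hD]
    ring
  choose X hX using fun f => exists_vectorField_of_derivation (D f) (hDm f)
  refine ⟨{ toLieBracketStructure := L.toLieBracketStructure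
            anchor :=
              { toFun := fun s => X (κ s)
                map_add' := fun s t => ?_
                map_smul' := fun c s => ?_ }
            leibniz := fun s t f => ?_ }, rfl⟩
  · refine ContMDiffSection.ext fun p => SmoothVectorField.ext_of_deriv p fun f => ?_
    have h : SmoothVectorField.deriv (X (κ (s + t))) f
        = SmoothVectorField.deriv (X (κ s)) f + SmoothVectorField.deriv (X (κ t)) f := by
      simp only [hX, hD, map_add, LinearMap.add_apply]
      ring
    rw [h]
    exact (map_add (mvfderiv I f p) _ _).symm
  · refine ContMDiffSection.ext fun p => SmoothVectorField.ext_of_deriv p fun f => ?_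
    have h : SmoothVectorField.deriv (X (κ (c • s))) f
        = c • SmoothVectorField.deriv (X (κ s)) f := by
      simp only [hX, hD, map_smul, LinearMap.smul_apply, smul_sub, mul_smul_comm]
    rw [h]
    exact (map_smul (mvfderiv I f p) _ _).symm
  · obtain ⟨a, rfl⟩ := he s
    obtain ⟨c, rfl⟩ := he t
    show L.bracket (ι a) (functionSmul f (ι c)) = functionSmul f (L.bracket (ι a) (ι c))
      + functionSmul (SmoothVectorField.deriv (X (κ (ι a))) f) (ι c)
    rw [hmul, ← hb, ← hb, hmul, hmul, hX, hκι, hbm, map_add]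

end LocalLieAlgebra

theorem LieQDAlgebroid.exists_localLieAlgebra (L : LieQDAlgebroid I G B) :
    ∃ L' : LocalLieAlgebra I G B, L'.toLieBracketStructure = L.toLieBracketStructure :=
  ⟨⟨L.toLieBracketStructure, L.support_bracket⟩, rfl⟩

end LocalLie

section RankZero

variable {E : Type*} [NormedAddCommGroup E] [NormedSpace ℝ E] [FiniteDimensional ℝ E]
  {H : Type*} [TopologicalSpace H] {I : ModelWithCorners ℝ E H} [I.Boundaryless]
  {M : Type*} [TopologicalSpace M] [ChartedSpace H M] [IsManifold I ∞ M] [T2Space M]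
  {F : Type*} [NormedAddCommGroup F] [NormedSpace ℝ F] [FiniteDimensional ℝ F]
  {V A : M → Type*} [∀ p, AddCommGroup (V p)] [∀ p, Module ℝ (V p)] [∀ p, AddTorsor (V p) (A p)]
  [TopologicalSpace (TotalSpace F A)] [∀ p, TopologicalSpace (A p)]
  [FiberBundle F A] [IsAffineBundle F V A] [SmoothFiberBundle I F A]

theorem existsUnique_function_of_section [Subsingleton F] (s : AffineDualSection I F V A) :
    ∃! f : C^∞⟮I, M; ℝ⟯, ∀ (p : M) (x : A p), s p x = f p := by
  obtain ⟨f, hf⟩ := exists_eq_basePullback (V := V) (sectionFun s) (fun p x y => by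
    rw [(fiberAffineEquiv V (trivializationAt F A p) p).injective (Subsingleton.elim _ _) (a₁ := x) (a₂ := y)])
  have hf' : ∀ (p : M) (x : A p), s p x = f p := fun p x =>
    (DFunLike.congr_fun hf (⟨p, x⟩ : TotalSpace F A)).symm
  refine ⟨f, hf', fun g hg => ?_⟩
  ext p
  obtain ⟨x⟩ : Nonempty (A p) := AddTorsor.nonempty (G := V p)
  rw [← hg p x, hf' p x]

theorem oneSection_apply (p : M) (x : A p) : oneSection I F V A p x = 1 :=
  IsAffineFunction.toSection_apply V _ p x

theorem exists_functionSmul_oneSection [Subsingleton F] (s : AffineDualSection I F V A) :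
    ∃ f : C^∞⟮I, M; ℝ⟯, functionSmul f (oneSection I F V A) = s := by
  obtain ⟨f, hf, -⟩ := existsUnique_function_of_section s
  refine ⟨f, sectionFun_injective ?_⟩
  ext ⟨p, x⟩
  rw [sectionFun_functionSmul, sectionFun_oneSection, mul_one]
  exact (hf p x).symm

theorem oneSection_ne_zero (p : M) : oneSection I F V A p ≠ 0 := by
  intro h
  obtain ⟨x⟩ : Nonempty (A p) := AddTorsor.nonempty (G := V p)
  have h1 : oneSection I F V A p x = 1 := oneSection_apply p x
  rw [h] at h1
  exact zero_ne_one h1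

end RankZero

theorem finrank_affineDualModel (F : Type*) [NormedAddCommGroup F] [NormedSpace ℝ F]
    [FiniteDimensional ℝ F] : Module.finrank ℝ (AffineDualModel F) = Module.finrank ℝ F + 1 := by
  have h : Module.finrank ℝ (F →L[ℝ] ℝ) = Module.finrank ℝ F := by
    rw [← (LinearMap.toContinuousLinearMap (𝕜 := ℝ) (E := F) (F' := ℝ)).finrank_eq]
    exact Subspace.dual_finrank_eq
  rw [Module.finrank_prod, h, Module.finrank_self]

theorem corollary3p7
    {E : Type*} [NormedAddCommGroup E] [NormedSpace ℝ E] [FiniteDimensional ℝ E]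
    {M : Type*} [TopologicalSpace M] [ChartedSpace E M] [IsManifold 𝓘(ℝ, E) ∞ M]
    [T2Space M] [SigmaCompactSpace M]
    {F : Type*} [NormedAddCommGroup F] [NormedSpace ℝ F] [FiniteDimensional ℝ F]
    {V A : M → Type*} [∀ p, AddCommGroup (V p)] [∀ p, Module ℝ (V p)]
    [∀ p, AddTorsor (V p) (A p)]
    [TopologicalSpace (TotalSpace F A)] [∀ p, TopologicalSpace (A p)]
    [FiberBundle F A] [SmoothFiberBundle 𝓘(ℝ, E) F A] [IsAffineBundle F V A] :
    (0 < Module.finrank ℝ F →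
      (∀ J : AffineJacobiStructure 𝓘(ℝ, E) F V A,
        ∃! L : LieAlgebroid 𝓘(ℝ, E) (AffineDualModel F) (AffineDual F V A),
          J.CorrespondsTo L.toLieBracketStructure) ∧
      (∀ L : LieAlgebroid 𝓘(ℝ, E) (AffineDualModel F) (AffineDual F V A),
        ∃! J : AffineJacobiStructure 𝓘(ℝ, E) F V A,
          J.CorrespondsTo L.toLieBracketStructure)) ∧
    (Module.finrank ℝ F = 0 →
      (∀ s : AffineDualSection 𝓘(ℝ, E) F V A,
        ∃! f : C^∞⟮𝓘(ℝ, E), M; ℝ⟯, ∀ (p : M) (x : A p), s p x = f p) ∧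
      (∀ J : AffineJacobiStructure 𝓘(ℝ, E) F V A,
        ∃! L : LocalLieAlgebra 𝓘(ℝ, E) (AffineDualModel F) (AffineDual F V A),
          J.CorrespondsTo L.toLieBracketStructure) ∧
      (∀ L : LocalLieAlgebra 𝓘(ℝ, E) (AffineDualModel F) (AffineDual F V A),
        ∃! J : AffineJacobiStructure 𝓘(ℝ, E) F V A,
          J.CorrespondsTo L.toLieBracketStructure) ∧
      (∀ J : AffineJacobiStructure 𝓘(ℝ, E) F V A,
        ∃! L : LieQDAlgebroid 𝓘(ℝ, E) (AffineDualModel F) (AffineDual F V A),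
          J.CorrespondsTo L.toLieBracketStructure) ∧
      (∀ L : LieQDAlgebroid 𝓘(ℝ, E) (AffineDualModel F) (AffineDual F V A),
        ∃! J : AffineJacobiStructure 𝓘(ℝ, E) F V A,
          J.CorrespondsTo L.toLieBracketStructure)) := by
  have hm : 0 < Module.finrank ℝ (AffineDualModel F) := by
    rw [finrank_affineDualModel]
    exact Nat.succ_pos _
  have hJ : ∀ Q : LieQDAlgebroid 𝓘(ℝ, E) (AffineDualModel F) (AffineDual F V A),
      ∃! J : AffineJacobiStructure 𝓘(ℝ, E) F V A, J.CorrespondsTo Q.toLieBracketStructure := by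
    intro Q
    obtain ⟨J, hJ⟩ := Q.exists_affineJacobiStructure
    exact ⟨J, hJ, fun J' hJ' => hJ'.jacobi_unique hJ⟩
  refine ⟨fun hn => ⟨fun J => ?_, fun L => ?_⟩, fun hn => ?_⟩
  · obtain ⟨Q, hQ⟩ := J.exists_lieQDAlgebroid
    obtain ⟨L, hL⟩ := Q.exists_lieAlgebroid (by rw [finrank_affineDualModel]; omega)
    rw [← hL] at hQ
    exact ⟨L, hQ, fun L' hL' => LieAlgebroid.ext_of_bracket_eq hm (hL'.bracket_unique hQ)⟩
  · obtain ⟨Q, hQ, -⟩ := L.exists_lieQDAlgebroid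
    rw [← hQ]
    exact hJ Q
  · have : Subsingleton F := Module.finrank_zero_iff.1 hn
    refine ⟨existsUnique_function_of_section, fun J => ?_, fun L => ?_, fun J => ?_, hJ⟩
    · obtain ⟨Q, hQ⟩ := J.exists_lieQDAlgebroid
      obtain ⟨L, hL⟩ := Q.exists_localLieAlgebra
      rw [← hL] at hQ
      exact ⟨L, hQ, fun L' hL' => LocalLieAlgebra.ext_of_bracket_eq (hL'.bracket_unique hQ)⟩
    · obtain ⟨Q, hQ⟩ := L.exists_lieQDAlgebroid (oneSection 𝓘(ℝ, E) F V A) oneSection_ne_zero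
        exists_functionSmul_oneSection
      rw [← hQ]
      exact hJ Q
    · obtain ⟨Q, hQ⟩ := J.exists_lieQDAlgebroid
      exact ⟨Q, hQ, fun Q' hQ' => LieQDAlgebroid.ext_of_bracket_eq hm
        (congrArg LieBracketStructure.bracket (hQ'.bracket_unique hQ))⟩
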